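/- Let an algebra over a field $F$ mean an $F$-vector space $L$, possibly infinite-dimensional, with a bilinear product $[\,,\,]$ (not assumed associative, commutative or anticommutative). For $n\ge 1$, a $(\mathbb Z/n\mathbb Z)$-graded Lie type algebra is such an algebra $L$ with a decomposition $L=\bigoplus_{i\in\mathbb Z/n\mathbb Z}L_i$ into subspaces satisfying $[L_i,L_j]\subseteq L_{i+j}$ for all $i,j\in\mathbb Z/n\mathbb Z$, and such that for all homogeneous elements $a,b,c$ (elements of $\bigcup_i L_i$) there exist $\alpha,\beta\in F$, possibly depending on $a,b,c$, with $\alpha\neq 0$ and $$[[a,b],c]=\alpha[a,[b,c]]+\beta[[a,c],b].$$ A subspace $H$ of $L$ is homogeneous if $H=\bigoplus_i (H\cap L_i)$. For a subspace $H$ put $H^{(0)}=H$ and let $H^{(k+1)}=[H^{(k)},H^{(k)}]$ be the span of all products $[x,y]$ with $x,y\in H^{(k)}$; a subalgebra $H$ is soluble of derived length at most $d$ if $H^{(d)}=0$. **Theorem.** There exist functions $d:\mathbb N\to\mathbb N$ and $c:\mathbb N\times\mathbb N\to\mathbb N$ such that the following holds for every integer $n\ge 1$, every integer $m\ge 0$,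 every field $F$ and every $(\mathbb Z/n\mathbb Z)$-graded Lie type algebra $L=\bigoplus_i L_i$ over $F$ whose zero component $L_0$ has finite dimension $m$. 1. $L$ has a homogeneous two-sided ideal $I$ of finite codimension $\dim_F(L/I)\le c(n,m)$ that is soluble of derived length at most $d(n)$. 2. If $m=0$, then $L$ itself is soluble of derived length at most $d(n)$. -/

import Mathlib

/-!
An algebra over a field `F` (non-associative, non-unital, of arbitrary dimension) is a type `L` with
`[NonUnitalNonAssocRing L] [Module F L] [IsScalarTower F L L] [SMulCommClass F L L]`;
the product `[a, b]` is written `a * b`.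
-/

namespace LieTypeAlgebra

variable {F L : Type*} [Field F] [NonUnitalNonAssocRing L] [Module F L]

/-- `L` is the direct sum of the subspaces `𝒜 i`, `i ∈ ℤ/nℤ`, and `[𝒜 i, 𝒜 j] ⊆ 𝒜 (i + j)`. -/
structure IsGrading {n : ℕ} (𝒜 : ZMod n → Submodule F L) : Prop where
  isInternal : DirectSum.IsInternal 𝒜
  mul_mem : ∀ (i j : ZMod n) (a b : L), a ∈ 𝒜 i → b ∈ 𝒜 j → a * b ∈ 𝒜 (i + j)

/-- A `(ℤ/nℤ)`-graded Lie type algebra: a graded algebra such that for all homogeneous `a, b, c`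
there are scalars `α ≠ 0` and `β`, depending on `a, b, c`, with
`[[a, b], c] = α [a, [b, c]] + β [[a, c], b]`. -/
structure IsGradedLieType {n : ℕ} (𝒜 : ZMod n → Submodule F L) : Prop
    extends IsGrading 𝒜 where
  lie_type : ∀ a b c : L, SetLike.IsHomogeneousElem 𝒜 a → SetLike.IsHomogeneousElem 𝒜 b →
    SetLike.IsHomogeneousElem 𝒜 c →
    ∃ α β : F, α ≠ 0 ∧ (a * b) * c = α • (a * (b * c)) + β • ((a * c) * b)

/-- A subspace `H` is homogeneous if it is the sum of its intersections with the components
(for a grading this sum is automatically direct). -/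
def IsHomogeneousSubspace {n : ℕ} (𝒜 : ZMod n → Submodule F L) (H : Submodule F L) : Prop :=
  H = ⨆ i : ZMod n, H ⊓ 𝒜 i

/-- A subspace that is a two-sided ideal. -/
def IsIdeal (I : Submodule F L) : Prop :=
  ∀ x a : L, a ∈ I → x * a ∈ I ∧ a * x ∈ I

/-- The derived series of a subspace: `H⁽⁰⁾ = H` and `H⁽ᵏ⁺¹⁾ = [H⁽ᵏ⁾, H⁽ᵏ⁾]`, the span of all
products of two elements of `H⁽ᵏ⁾`. -/
def derived [IsScalarTower F L L] [SMulCommClass F L L] (H : Submodule F L) : ℕ → Submodule F L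
  | 0 => H
  | k + 1 => Submodule.map₂ (LinearMap.mul F L) (derived H k) (derived H k)

/-- `H` is soluble of derived length at most `d`. -/
def IsSolubleOfLength [IsScalarTower F L L] [SMulCommClass F L L]
    (H : Submodule F L) (d : ℕ) : Prop :=
  derived H d = ⊥

end LieTypeAlgebra

/-! Only products of homogeneous subspaces matter. For these, `α ≠ 0` turns the identity into two
inclusions, `(AB)C ⊆ A(BC) + (AC)B` and `A(BC) ⊆ (AB)C + (AC)B`, so the proof lives in a lattice
with a product and a grading.

Call `x * w * ⋯ * w` with many factors `w ≤ L₀` a `w`-heavy element. Kreknin's elimination of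
components, run with error terms, gives `exists_iterate_der_le`: if `H` is a subalgebra with `H₀ ≤
w` and `w` acts nilpotently on `L₀`, then a bounded derived term of `H` consists of heavy elements
and their products with one further element. With `L₀ = 0` and `w = 0` this is already solubility.
In general the zero component of that derived term is spanned by zero-degree products of heavy
elements, and the argument can be repeated if these are again under control. `Tame` records this
control to a given depth, and `exists_iterate_der_eq_bot` performs the repetition.

Tame right ideals come from generic elements, that is, elements of subspaces of bounded codimension.
Since `dim L₀ = m`, some subspace `U` of codimension at most `m` has zero component `0`, so a
degree-zero word with one sufficiently generic letter vanishes. `exists_ideal` yields an ideal of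
bounded codimension whose zero component is covered by right ideals `Y a` of `L₀`, `a ≠ 0`, each
`Thin`: it lies in the zero-degree products of the components of degrees `±a` of every subspace of
codimension at most `γ`.

Thin right ideals are tame (`exists_tame_of_thin`). Each factor `Y` is rewritten as generic letters
`P * M` and `M * P` of degrees `±a` (`Tower`). Rearranging the letters proves that `Y` is nilpotent
on the components of degrees `±a`, transports heavy elements from degree `i` to `i + κ a`, and
rewrites a product of a heavy element with an arbitrary one as a product of a heavy element with a
generic one. The resulting zero-degree products are thin in several directions modulo right ideals
already known to be tame (`Split`), relative to a larger subgroup of `ℤ/nℤ`; the induction on that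
subgroup ends within `n` steps. All lengths and nilpotency indices depend on `n` alone; only
codimensions depend on `m`. This is why statements have the shape `∃ N, ∀ m, ∃ γ`. -/

/-- A complete lattice with a sup-distributive product and a `ℤ/nℤ`-grading, satisfying the lattice
form of the Lie type identity. The model is the lattice of graded subspaces of a graded Lie type
algebra. -/
class LieTypeLattice (n : outParam ℕ) (Q : Type*) extends CompleteLattice Q, Mul Q where
  sSup_mul' : ∀ (s : Set Q) (b : Q), sSup s * b = ⨆ a ∈ s, a * b
  mul_sSup' : ∀ (b : Q) (s : Set Q), b * sSup s = ⨆ a ∈ s, b * a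
  mul_mul_le' : ∀ a b c : Q, a * (b * c) ≤ a * b * c ⊔ a * c * b
  mul_mul_le : ∀ a b c : Q, a * b * c ≤ a * (b * c) ⊔ a * c * b
  pr : ZMod n → Q → Q
  pr_sSup : ∀ i (s : Set Q), pr i (sSup s) = ⨆ a ∈ s, pr i a
  iSup_pr : ∀ x, ⨆ i, pr i x = x
  pr_pr_same : ∀ i x, pr i (pr i x) = pr i x
  pr_pr_ne : ∀ i j x, i ≠ j → pr i (pr j x) = ⊥
  pr_mul_pr_le : ∀ i j x y, pr i x * pr j y ≤ pr (i + j) ⊤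

namespace LieTypeLattice

/-! ### Calculus of residuals, components and iterated products. -/

section Basic

variable {n : ℕ} {Q : Type*} [LieTypeLattice n Q]

theorem iSup_mul' {ι : Sort*} (f : ι → Q) (b : Q) : (⨆ i, f i) * b = ⨆ i, f i * b := by
  rw [iSup, sSup_mul', iSup_range]

theorem mul_iSup' {ι : Sort*} (f : ι → Q) (b : Q) : b * (⨆ i, f i) = ⨆ i, b * f i := by
  rw [iSup, mul_sSup', iSup_range]

theorem sup_mul' (a b c : Q) : (a ⊔ b) * c = a * c ⊔ b * c := by
  rw [← sSup_pair, sSup_mul', iSup_pair]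

theorem mul_sup' (a b c : Q) : c * (a ⊔ b) = c * a ⊔ c * b := by
  rw [← sSup_pair, mul_sSup', iSup_pair]

@[simp] theorem bot_mul' (a : Q) : ⊥ * a = ⊥ := by
  rw [← sSup_empty, sSup_mul']; simp

@[simp] theorem mul_bot' (a : Q) : a * ⊥ = ⊥ := by
  rw [← sSup_empty, mul_sSup']; simp

theorem mul_le {a b c d : Q} (h : a ≤ b) (h' : c ≤ d) : a * c ≤ b * d := by
  have h1 : a * c ≤ b * c := by
    rw [← sup_eq_right.2 h, sup_mul']; exact le_sup_left
  have h2 : b * c ≤ b * d := by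
    rw [← sup_eq_right.2 h', mul_sup']; exact le_sup_left
  exact h1.trans h2

theorem mul_le_l {a b : Q} (h : a ≤ b) (c : Q) : a * c ≤ b * c := mul_le h le_rfl

theorem mul_le_r {a b : Q} (h : a ≤ b) (c : Q) : c * a ≤ c * b := mul_le le_rfl h

/-- Right residual: the largest `y` with `y * w ≤ z`. -/
def rdiv (z w : Q) : Q := sSup {y | y * w ≤ z}

/-- Left residual: the largest `y` with `w * y ≤ z`. -/
def ldiv (w z : Q) : Q := sSup {y | w * y ≤ z}

theorem le_rdiv {z w y : Q} : y ≤ rdiv z w ↔ y * w ≤ z := by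
  refine ⟨fun h => (mul_le_l h w).trans ?_, fun h => le_sSup h⟩
  rw [rdiv, sSup_mul']; exact iSup₂_le fun a ha => ha

theorem le_ldiv {z w y : Q} : y ≤ ldiv w z ↔ w * y ≤ z := by
  refine ⟨fun h => (mul_le_r h w).trans ?_, fun h => le_sSup h⟩
  rw [ldiv, mul_sSup']; exact iSup₂_le fun a ha => ha

theorem iSup_mul_le {ι : Sort*} {f : ι → Q} {b z : Q} (h : ∀ i, f i * b ≤ z) :
    (⨆ i, f i) * b ≤ z := by rw [iSup_mul']; exact iSup_le h

theorem mul_iSup_le {ι : Sort*} {f : ι → Q} {b z : Q} (h : ∀ i, b * f i ≤ z) :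
    b * (⨆ i, f i) ≤ z := by rw [mul_iSup']; exact iSup_le h

/-! ### The grading -/

theorem pr_iSup {ι : Sort*} (i : ZMod n) (f : ι → Q) : pr i (⨆ j, f j) = ⨆ j, pr i (f j) := by
  rw [iSup, pr_sSup, iSup_range]

theorem pr_sup (i : ZMod n) (a b : Q) : pr i (a ⊔ b) = pr i a ⊔ pr i b := by
  rw [← sSup_pair, pr_sSup, iSup_pair]

@[simp] theorem pr_bot (i : ZMod n) : pr i (⊥ : Q) = ⊥ := by
  rw [← sSup_empty, pr_sSup]; simp

theorem pr_mono (i : ZMod n) {a b : Q} (h : a ≤ b) : pr i a ≤ pr i b := by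
  rw [← sup_eq_right.2 h, pr_sup]; exact le_sup_left

theorem pr_le (i : ZMod n) (a : Q) : pr i a ≤ a :=
  (le_iSup (fun i => pr i a) i).trans (iSup_pr a).le

/-- The homogeneous component of degree `i` of the whole lattice. -/
def comp (Q : Type*) [LieTypeLattice n Q] (i : ZMod n) : Q := pr i ⊤

theorem pr_le_comp (i : ZMod n) (a : Q) : pr i a ≤ comp Q i := pr_mono i le_top

theorem pr_of_le {i : ZMod n} {a : Q} (h : a ≤ comp Q i) : pr i a = a := by
  have h2 : ∀ j, j ≠ i → pr j a = ⊥ := fun j hj =>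
    le_bot_iff.1 ((pr_mono j h).trans (pr_pr_ne j i _ hj).le)
  apply le_antisymm (pr_le i a)
  conv_lhs => rw [← iSup_pr a]
  refine iSup_le fun j => ?_
  by_cases hj : j = i
  · rw [hj]
  · rw [h2 j hj]; exact bot_le

theorem pr_of_le_ne {i j : ZMod n} {a : Q} (h : a ≤ comp Q i) (hij : j ≠ i) : pr j a = ⊥ :=
  le_bot_iff.1 ((pr_mono j h).trans (pr_pr_ne j i _ hij).le)

theorem mul_le_comp {i j : ZMod n} {a b : Q} (ha : a ≤ comp Q i) (hb : b ≤ comp Q j) :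
    a * b ≤ comp Q (i + j) := by
  rw [← pr_of_le ha, ← pr_of_le hb]; exact pr_mul_pr_le i j a b

theorem mul_le_comp' {i j k : ZMod n} {a b : Q} (ha : a ≤ comp Q i) (hb : b ≤ comp Q j)
    (h : i + j = k) : a * b ≤ comp Q k := h ▸ mul_le_comp ha hb

theorem pr_mul (k : ZMod n) (x y : Q) : pr k (x * y) = ⨆ i, pr i x * pr (k - i) y := by
  have h : x * y = ⨆ i, ⨆ j, pr i x * pr j y := by
    conv_lhs => rw [← iSup_pr x, ← iSup_pr y, iSup_mul']
    exact iSup_congr fun i => by rw [mul_iSup']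
  apply le_antisymm
  · rw [h, pr_iSup]
    refine iSup_le fun i => ?_
    rw [pr_iSup]
    refine iSup_le fun j => ?_
    have hc := mul_le_comp (pr_le_comp i x) (pr_le_comp j y)
    by_cases hk : k = i + j
    · have : j = k - i := by rw [hk]; ring
      subst this
      exact (pr_le _ _).trans (le_iSup (fun i => pr i x * pr (k - i) y) i)
    · rw [pr_of_le_ne hc hk]; exact bot_le
  · refine iSup_le fun i => ?_
    rw [← pr_of_le (mul_le_comp' (pr_le_comp i x) (pr_le_comp (k - i) y) (by ring : i + (k - i) = k))]
    exact pr_mono k (mul_le (pr_le i x) (pr_le _ y))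

theorem le_of_pr_le {x z : Q} (h : ∀ i, pr i x ≤ z) : x ≤ z := by
  rw [← iSup_pr x]; exact iSup_le h

/-! ### Iterated right multiplication -/

/-- `act x w s = x * w * ⋯ * w` with `s` factors `w`. -/
def act (x w : Q) : ℕ → Q
  | 0 => x
  | s + 1 => act x w s * w

@[simp] theorem act_zero (x w : Q) : act x w 0 = x := rfl

theorem act_succ (x w : Q) (s : ℕ) : act x w (s + 1) = act x w s * w := rfl

theorem act_succ' (x w : Q) (s : ℕ) : act x w (s + 1) = act (x * w) w s := by
  induction s with
  | zero => rfl
  | succ s ih => rw [act_succ, ih, act_succ]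

theorem act_add (x w : Q) (s t : ℕ) : act x w (s + t) = act (act x w s) w t := by
  induction t with
  | zero => rfl
  | succ t ih => rw [← add_assoc, act_succ, ih, act_succ]

theorem act_mono {x y w v : Q} (h : x ≤ y) (h' : w ≤ v) (s : ℕ) : act x w s ≤ act y v s := by
  induction s with
  | zero => exact h
  | succ s ih => exact mul_le ih h'

theorem act_iSup {ι : Sort*} (f : ι → Q) (w : Q) (s : ℕ) :
    act (⨆ i, f i) w s = ⨆ i, act (f i) w s := by
  induction s with
  | zero => rfl
  | succ s ih => simp only [act_succ, ih, iSup_mul']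

theorem act_sup (x y w : Q) (s : ℕ) : act (x ⊔ y) w s = act x w s ⊔ act y w s := by
  induction s with
  | zero => rfl
  | succ s ih => simp only [act_succ, ih, sup_mul']

@[simp] theorem act_bot (w : Q) (s : ℕ) : act ⊥ w s = ⊥ := by
  induction s with
  | zero => rfl
  | succ s ih => rw [act_succ, ih, bot_mul']

theorem act_bot_right (x : Q) (s : ℕ) : act x ⊥ (s + 1) = ⊥ := by rw [act_succ, mul_bot']

theorem act_le_comp {i : ZMod n} {x w : Q} (hx : x ≤ comp Q i) (hw : w ≤ comp Q 0) (s : ℕ) :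
    act x w s ≤ comp Q i := by
  induction s with
  | zero => exact hx
  | succ s ih => exact mul_le_comp' ih hw (add_zero i)

theorem act_le_self {x w : Q} (h : x * w ≤ x) (s : ℕ) : act x w s ≤ x := by
  induction s with
  | zero => exact le_rfl
  | succ s ih => exact (mul_le_l ih w).trans h

theorem act_anti {x w : Q} (h : x * w ≤ x) {s t : ℕ} (hst : s ≤ t) : act x w t ≤ act x w s := by
  obtain ⟨u, rfl⟩ := Nat.exists_eq_add_of_le hst
  rw [add_comm s u, act_add]
  exact act_mono (act_le_self h u) le_rfl s

theorem act_eq_bot_of_le {x w : Q} {s t : ℕ} (h : act x w s = ⊥) (hst : s ≤ t) :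
    act x w t = ⊥ := by
  obtain ⟨u, rfl⟩ := Nat.exists_eq_add_of_le hst
  rw [act_add, h, act_bot]

/-- Leibniz-type expansion of the action on a product. -/
theorem act_mul_le {w z : Q} : ∀ (s : ℕ) (x y : Q),
    (∀ i j, i + j = s → act x w i * act y w j ≤ z) → act (x * y) w s ≤ z
  | 0, x, y, h => h 0 0 rfl
  | s + 1, x, y, h => by
    rw [act_succ']
    refine (act_mono (mul_mul_le x y w) le_rfl s).trans ?_
    rw [act_sup]
    refine sup_le (act_mul_le s x (y * w) fun i j hij => ?_)
      (act_mul_le s (x * w) y fun i j hij => ?_)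
    · rw [← act_succ']; exact h i (j + 1) (by omega)
    · rw [← act_succ']; exact h (i + 1) j (by omega)

/-- Iterated left multiplication. -/
def lact (w l : Q) : ℕ → Q
  | 0 => l
  | s + 1 => w * lact w l s

theorem lact_succ' (w l : Q) (s : ℕ) : lact w l (s + 1) = lact w (w * l) s := by
  induction s with
  | zero => rfl
  | succ s ih => rw [lact, ih, lact]

/-- By `(xw)l ≤ x(wl) + (xl)w`, each factor `w` either passes to the left side of `l` or moves
outside the whole product. -/
theorem act_mul_right_le {w x : Q} : ∀ (s : ℕ) (l z : Q),
    (∀ i j, i + j = s → act (x * lact w l j) w i ≤ z) → act x w s * l ≤ z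
  | 0, l, z, h => h 0 0 rfl
  | s + 1, l, z, h => by
    rw [act_succ]
    refine (mul_mul_le _ _ _).trans (sup_le ?_ ?_)
    · refine act_mul_right_le s (w * l) z fun i j hij => ?_
      rw [← lact_succ']; exact h i (j + 1) (by omega)
    · rw [← le_rdiv]
      refine act_mul_right_le s l _ fun i j hij => ?_
      rw [le_rdiv, ← act_succ]; exact h (i + 1) j (by omega)

/-- By `l(xw) ≤ (lx)w + (lw)x`, each factor `w` either moves outside or lands on the right of `l`.
-/
theorem mul_act_le {w x : Q} : ∀ (s : ℕ) (l z : Q),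
    (∀ i j, i + j = s → act (act l w j * x) w i ≤ z) → l * act x w s ≤ z
  | 0, l, z, h => h 0 0 rfl
  | s + 1, l, z, h => by
    rw [act_succ]
    refine (mul_mul_le' _ _ _).trans (sup_le ?_ ?_)
    · rw [← le_rdiv]
      refine mul_act_le s l _ fun i j hij => ?_
      rw [le_rdiv, ← act_succ]; exact h (i + 1) j (by omega)
    · refine mul_act_le s (l * w) z fun i j hij => ?_
      rw [← act_succ']; exact h i (j + 1) (by omega)

/-- Words with one letter `x` and `c` letters `w`, multiplied on either side. -/
def twoSided (x w : Q) : ℕ → Q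
  | 0 => x
  | c + 1 => twoSided x w c * w ⊔ w * twoSided x w c

theorem lact_le_twoSided (x w : Q) (c : ℕ) : lact w x c ≤ twoSided x w c := by
  induction c with
  | zero => exact le_rfl
  | succ c ih => exact (mul_le_r ih w).trans le_sup_right

theorem mul_act_self_le (w : Q) : ∀ (i : ℕ) (y : Q), y * act w w i ≤ act y w (i + 1)
  | 0, y => le_rfl
  | i + 1, y => by
    rw [act_succ]
    refine (mul_mul_le' _ _ _).trans (sup_le ?_ ?_)
    · rw [act_succ]; exact mul_le_l (mul_act_self_le w i y) w
    · rw [act_succ']; exact mul_act_self_le w i (y * w)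

/-- Left factors `w` can be gathered into one left-normed word in `w` standing to the left of `x`;
by `hN` that word has at most `N` letters, so all but `N` of the factors end up on the right. -/
theorem twoSided_le {x w : Q} {N : ℕ} (hw : w ≤ comp Q 0) (hN : act (comp Q 0) w N = ⊥)
    (hl : comp Q 0 * x ≤ x) (hr : x * comp Q 0 ≤ x) (c : ℕ) :
    twoSided x w c ≤ act x w (c - N) := by
  -- `P i` carries exactly `i` letters `w` on its left, since `act w w i` has `i + 1` letters. `G c`
  -- collects all normal forms with `c` letters in total and is stable under multiplication by `w`
  -- on either side.
  let P : ℕ → Q := fun i => Nat.casesOn i x fun i => act w w i * x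
  let G : ℕ → Q := fun c => ⨆ p : {p : ℕ × ℕ // p.1 + p.2 = c}, act (P p.1.1) w p.1.2
  have hG : ∀ {c} i j, i + j = c → act (P i) w j ≤ G c := fun {c} i j h =>
    le_iSup (fun p : {p : ℕ × ℕ // p.1 + p.2 = c} => act (P p.1.1) w p.1.2) ⟨(i, j), h⟩
  have hG1 : ∀ c, G c * w ≤ G (c + 1) := fun c => iSup_mul_le fun p => by
    rw [← act_succ]; exact hG _ _ (by have := p.2; omega)
  have hG2 : ∀ c, w * G c ≤ G (c + 1) := fun c => mul_iSup_le fun ⟨⟨i, s⟩, hp⟩ => by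
    refine mul_act_le s w _ fun u v huv => ?_
    dsimp only at hp
    rcases i with _ | i
    · exact hG (v + 1) u (by omega)
    · change act (act w w v * (act w w i * x)) w u ≤ _
      refine (act_mono (mul_mul_le' _ _ _) le_rfl u).trans ?_
      rw [act_sup]
      refine sup_le ?_ ?_
      · refine le_trans ?_ (hG (v + i + 2) u (by omega))
        refine act_mono (mul_le_l ?_ x) le_rfl u
        refine (mul_act_self_le w i _).trans ?_
        rw [← act_add, add_assoc]
      · refine le_trans ?_ (hG (v + 1) (i + 1 + u) (by omega))
        rw [act_add]
        exact act_mono (mul_act_self_le w i _) le_rfl u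
  have h1 : twoSided x w c ≤ G c := by
    induction c with
    | zero => exact hG 0 0 rfl
    | succ c ih =>
      exact sup_le ((mul_le_l ih w).trans (hG1 c)) ((mul_le_r ih w).trans (hG2 c))
  refine h1.trans (iSup_le fun ⟨⟨i, s⟩, hp⟩ => ?_)
  dsimp only at hp ⊢
  have hxw : x * w ≤ x := (mul_le_r hw x).trans hr
  rcases i with _ | i
  · exact act_anti hxw (by omega)
  · by_cases hi : N ≤ i
    · have : act w w i = ⊥ :=
        le_bot_iff.1 ((act_mono hw le_rfl i).trans (act_eq_bot_of_le hN hi).le)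
      change act (act w w i * x) w s ≤ _
      rw [this, bot_mul', act_bot]; exact bot_le
    · refine le_trans ?_ (act_anti hxw (show c - N ≤ s by omega))
      exact act_mono ((mul_le_l (act_le_comp hw hw i) x).trans hl) le_rfl s

/-- `w` is a right ideal of the zero component. -/
structure IsRightIdeal (w : Q) : Prop where
  le : w ≤ comp Q 0
  mul_le : w * comp Q 0 ≤ w

theorem IsRightIdeal.bot : IsRightIdeal (⊥ : Q) := ⟨bot_le, by simp⟩

theorem IsRightIdeal.sup {v w : Q} (hv : IsRightIdeal v) (hw : IsRightIdeal w) :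
    IsRightIdeal (v ⊔ w) :=
  ⟨sup_le hv.le hw.le, by rw [sup_mul']; exact sup_le_sup hv.mul_le hw.mul_le⟩

theorem IsRightIdeal.iSup {ι : Sort*} {f : ι → Q} (h : ∀ i, IsRightIdeal (f i)) :
    IsRightIdeal (⨆ i, f i) :=
  ⟨iSup_le fun i => (h i).le, by rw [iSup_mul']; exact iSup_mono fun i => (h i).mul_le⟩

/-- A factor from `L₀` is absorbed either by a letter `w`, because `w` is a right ideal, or by `P`.
Hence such factors never reduce heaviness. -/
theorem act_mul_comp_le {P w : Q} (hP : P * comp Q 0 ≤ P) (hw : IsRightIdeal w) (q : ℕ) :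
    act P w q * comp Q 0 ≤ act P w q := by
  induction q with
  | zero => exact hP
  | succ q ih =>
    rw [act_succ]
    exact (mul_mul_le _ _ _).trans (sup_le (mul_le_r hw.mul_le _) (mul_le_l ih w))

/-- Expand into words in `w₁` and `w₂`. A word with `i` letters `w₁` and `j` letters `w₂` lies in
both `act P w₁ i` and `act P w₂ j`, as the other letters are absorbed; by pigeonhole `i ≥ q₁` or `j
≥ q₂`. -/
theorem act_sup_right_le {P w₁ w₂ : Q} (hP : P * comp Q 0 ≤ P) (h₁ : IsRightIdeal w₁)
    (h₂ : IsRightIdeal w₂) {q₁ q₂ s : ℕ} (hs : q₁ + q₂ ≤ s) :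
    act P (w₁ ⊔ w₂) s ≤ act P w₁ q₁ ⊔ act P w₂ q₂ := by
  have key : ∀ s z, (∀ i j, i + j = s → act P w₁ i ⊓ act P w₂ j ≤ z) →
      act P (w₁ ⊔ w₂) s ≤ z := by
    intro s
    induction s with
    | zero => intro z h; exact (le_inf le_rfl le_rfl).trans (h 0 0 rfl)
    | succ s ih =>
      intro z h
      rw [act_succ, ← le_rdiv]
      refine ih _ fun i j hij => ?_
      rw [le_rdiv, mul_sup']
      refine sup_le (le_trans (le_inf ?_ ?_) (h (i + 1) j (by omega)))
        (le_trans (le_inf ?_ ?_) (h i (j + 1) (by omega)))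
      · exact mul_le_l inf_le_left _
      · exact (mul_le inf_le_right h₁.le).trans (act_mul_comp_le hP h₂ j)
      · exact (mul_le inf_le_left h₂.le).trans (act_mul_comp_le hP h₁ i)
      · exact mul_le_l inf_le_right _
  refine key s _ fun i j hij => ?_
  have hw₁ : P * w₁ ≤ P := (mul_le_r h₁.le P).trans hP
  have hw₂ : P * w₂ ≤ P := (mul_le_r h₂.le P).trans hP
  rcases le_or_gt q₁ i with hi | hi
  · exact inf_le_left.trans ((act_anti hw₁ hi).trans le_sup_left)
  · exact inf_le_right.trans ((act_anti hw₂ (by omega)).trans le_sup_right)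

theorem act_finset_sup_le {ι : Type*} (t : Finset ι) {P : Q} {w : ι → Q}
    (hP : P * comp Q 0 ≤ P) (h : ∀ i ∈ t, IsRightIdeal (w i)) (q : ℕ) :
    act P (t.sup w) (t.card * q + 1) ≤ t.sup fun i => act P (w i) q := by
  classical
  induction t using Finset.induction_on with
  | empty => simp [act_succ]
  | insert a t ha ih =>
    rw [Finset.sup_insert, Finset.sup_insert, Finset.card_insert_of_notMem ha]
    have ht : IsRightIdeal (t.sup w) := by
      rw [Finset.sup_eq_iSup]
      exact IsRightIdeal.iSup fun i => IsRightIdeal.iSup fun hi => h i (by simp [hi])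
    refine (act_sup_right_le (q₁ := q) (q₂ := t.card * q + 1) hP (h a (by simp)) ht
      (by ring_nf; omega)).trans ?_
    exact sup_le_sup le_rfl (ih fun i hi => h i (by simp [hi]))

theorem comp_mul_comp_zero (i : ZMod n) : comp Q i * comp Q 0 ≤ comp Q i :=
  mul_le_comp' le_rfl le_rfl (add_zero i)

theorem comp_zero_mul_comp (i : ZMod n) : comp Q 0 * comp Q i ≤ comp Q i :=
  mul_le_comp' le_rfl le_rfl (zero_add i)

end Basic

end LieTypeLattice

namespace LieTypeLattice

universe u

/-! ### Multiples of heavy elements. -/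

section Absorb

variable {n : ℕ} {Q : Type*} [LieTypeLattice n Q]

/-- Closure of `x` under at most `r` multiplications by arbitrary elements. -/
def mulCl (x : Q) : ℕ → Q
  | 0 => x
  | r + 1 => mulCl x r ⊔ mulCl x r * ⊤ ⊔ ⊤ * mulCl x r

theorem mulCl_le_succ (x : Q) (r : ℕ) : mulCl x r ≤ mulCl x (r + 1) :=
  le_sup_left.trans le_sup_left

theorem mulCl_mul_top_le (x : Q) (r : ℕ) : mulCl x r * ⊤ ≤ mulCl x (r + 1) :=
  le_sup_right.trans le_sup_left

theorem top_mul_mulCl_le (x : Q) (r : ℕ) : ⊤ * mulCl x r ≤ mulCl x (r + 1) := le_sup_right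

theorem mulCl_mono {x y : Q} (h : x ≤ y) {r s : ℕ} (hrs : r ≤ s) : mulCl x r ≤ mulCl y s := by
  have h1 : mulCl x r ≤ mulCl y r := by
    clear hrs
    induction r with
    | zero => exact h
    | succ r ih => exact sup_le_sup (sup_le_sup ih (mul_le_l ih _)) (mul_le_r ih _)
  exact h1.trans (monotone_nat_of_le_succ (mulCl_le_succ y) hrs)

theorem mulCl_mulCl (x : Q) (r s : ℕ) : mulCl (mulCl x r) s = mulCl x (r + s) := by
  induction s with
  | zero => rfl
  | succ s ih => rw [mulCl, ih]; rfl

theorem mulCl_sup (x y : Q) (r : ℕ) : mulCl (x ⊔ y) r = mulCl x r ⊔ mulCl y r := by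
  induction r with
  | zero => rfl
  | succ r ih => rw [mulCl, ih, sup_mul', mul_sup', mulCl, mulCl]; ac_rfl

theorem mulCl_iSup_le {ι : Sort*} {f : ι → Q} {r : ℕ} {z : Q} (h : ∀ i, mulCl (f i) r ≤ z) :
    mulCl (⨆ i, f i) r ≤ z := by
  have key : ∀ r, mulCl (⨆ i, f i) r ≤ ⨆ i, mulCl (f i) r := by
    intro r
    induction r with
    | zero => exact le_rfl
    | succ r ih =>
      refine sup_le (sup_le ?_ ?_) ?_
      · exact ih.trans (iSup_mono fun i => mulCl_le_succ _ _)
      · refine (mul_le_l ih _).trans ?_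
        rw [iSup_mul']; exact iSup_mono fun i => mulCl_mul_top_le _ _
      · refine (mul_le_r ih _).trans ?_
        rw [mul_iSup']; exact iSup_mono fun i => top_mul_mulCl_le _ _
  exact (key r).trans (iSup_le h)

/-- Both inclusions distribute an outside factor over the two factors of a product. -/
theorem mulCl_mul_self_le {x z : Q} (r : ℕ)
    (h : ∀ a b, a + b ≤ r → mulCl x a * mulCl x b ≤ z) : mulCl (x * x) r ≤ z := by
  have key : ∀ r, mulCl (x * x) r ≤
      ⨆ p : {p : ℕ × ℕ // p.1 + p.2 ≤ r}, mulCl x p.1.1 * mulCl x p.1.2 := by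
    intro r
    have hle : ∀ {r} a b, a + b ≤ r → mulCl x a * mulCl x b ≤
        ⨆ p : {p : ℕ × ℕ // p.1 + p.2 ≤ r}, mulCl x p.1.1 * mulCl x p.1.2 := fun {r} a b h =>
      le_iSup (fun p : {p : ℕ × ℕ // p.1 + p.2 ≤ r} => mulCl x p.1.1 * mulCl x p.1.2) ⟨(a, b), h⟩
    induction r with
    | zero => exact hle 0 0 le_rfl
    | succ r ih =>
      refine sup_le (sup_le ?_ ?_) ?_
      · exact ih.trans (iSup_le fun p => hle _ _ (by have := p.2; omega))
      · refine (mul_le_l ih _).trans (iSup_mul_le fun ⟨⟨a, b⟩, hp⟩ => ?_)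
        dsimp only at hp ⊢
        refine (mul_mul_le _ _ _).trans (sup_le ?_ ?_)
        · exact (mul_le_r (mulCl_mul_top_le _ _) _).trans (hle a (b + 1) (by omega))
        · exact (mul_le_l (mulCl_mul_top_le _ _) _).trans (hle (a + 1) b (by omega))
      · refine (mul_le_r ih _).trans (mul_iSup_le fun ⟨⟨a, b⟩, hp⟩ => ?_)
        dsimp only at hp ⊢
        refine (mul_mul_le' _ _ _).trans (sup_le ?_ ?_)
        · exact (mul_le_l (top_mul_mulCl_le _ _) _).trans (hle (a + 1) b (by omega))
        · exact (mul_le_l (top_mul_mulCl_le _ _) _).trans (hle (b + 1) a (by omega))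
  exact (key r).trans (iSup_le fun p => h _ _ p.2)

theorem act_mul_act_le_self (x y w : Q) (hx : x * w ≤ x) (hy : y * w ≤ y) (s : ℕ) :
    act (x * y) w s ≤ x * y :=
  act_mul_le s x y fun _ _ _ => mul_le (act_le_self hx _) (act_le_self hy _)

/-- When a very heavy element is multiplied by `l`, either `s` of its letters stay outside the
product, or so many pass to `l` that `l` becomes heavy too. The first `s` letters are set aside so
that the original factor remains heavy; the extra `N` pays for turning left factors `w` on `l` into
right ones. -/
theorem mulCl_one_act_le {w : Q} {N : ℕ} (hw : w ≤ comp Q 0) (hN : act (comp Q 0) w N = ⊥)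
    (s : ℕ) : mulCl (act ⊤ w (s + (s + N + s))) 1 ≤
      act ⊤ w s ⊔ act ⊤ w s * act ⊤ w s := by
  have hx : act (⊤ : Q) w s * w ≤ act ⊤ w s := by
    rw [← act_succ]; exact act_anti le_top (Nat.le_succ s)
  refine sup_le (sup_le ?_ ?_) ?_
  · exact (act_anti le_top (by omega)).trans le_sup_left
  · change act ⊤ w _ * ⊤ ≤ _
    rw [act_add]
    refine act_mul_right_le _ _ _ fun i j hij => ?_
    rcases lt_or_ge j (N + s) with h | h
    · refine le_trans ?_ ((act_anti le_top (by omega : s ≤ i)).trans le_sup_left)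
      exact act_mono le_top le_rfl i
    · refine le_trans ?_ ((act_mul_act_le_self _ _ w hx hx i).trans le_sup_right)
      refine act_mono (mul_le_r ?_ _) le_rfl i
      refine (lact_le_twoSided _ _ _).trans ((twoSided_le hw hN le_top le_top j).trans ?_)
      exact act_anti le_top (by omega)
  · change ⊤ * act ⊤ w _ ≤ _
    rw [act_add]
    refine mul_act_le _ _ _ fun i j hij => ?_
    rcases lt_or_ge j s with h | h
    · refine le_trans ?_ ((act_anti le_top (by omega : s ≤ i)).trans le_sup_left)
      exact act_mono le_top le_rfl i
    · refine le_trans ?_ ((act_mul_act_le_self _ _ w hx hx i).trans le_sup_right)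
      exact act_mono (mul_le_l (act_anti le_top h) _) le_rfl i

end Absorb

/-- Multiples of elements with a long tail of `w`'s are single multiples of such elements. -/
theorem exists_mulCl_act_le (n N : ℕ) (r q : ℕ) : ∃ s, ∀ (Q : Type u) [LieTypeLattice n Q] (w : Q),
    w ≤ comp Q 0 → act (comp Q 0) w N = ⊥ → mulCl (act ⊤ w s) r ≤ mulCl (act ⊤ w q) 1 := by
  induction r with
  | zero => exact ⟨q, fun Q _ w _ _ => mulCl_le_succ _ 0⟩
  | succ r ih =>
    obtain ⟨s₁, hs₁⟩ := ih
    set s := max s₁ q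
    refine ⟨s + (s + N + s), fun Q _ w hw hN => ?_⟩
    rw [add_comm r 1, ← mulCl_mulCl]
    refine (mulCl_mono (mulCl_one_act_le hw hN s) le_rfl).trans ?_
    have h1 : mulCl (act ⊤ w s) r ≤ mulCl (act ⊤ w q) 1 :=
      (mulCl_mono (act_anti le_top (le_max_left _ _)) le_rfl).trans (hs₁ Q w hw hN)
    rw [mulCl_sup]
    refine sup_le h1 (mulCl_mul_self_le r fun a b hab => ?_)
    -- If the second factor has received no further multiplication, the product is a single multiple
    -- of it. Otherwise `a < r`, and the product lies in `mulCl _ (a + 1)`, which the induction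
    -- hypothesis covers.
    rcases b with _ | b
    · refine (mul_le_l le_top _).trans ((top_mul_mulCl_le _ 0).trans ?_)
      exact mulCl_mono (act_anti le_top (le_max_right _ _)) le_rfl
    · refine (mul_le_r le_top _).trans ((mulCl_mul_top_le _ a).trans ?_)
      exact (mulCl_mono le_rfl (by omega)).trans h1

/-! ### Kreknin's elimination of components, with error terms. -/

section Kreknin

variable {n : ℕ} {Q : Type*} [LieTypeLattice n Q]

/-- The derived operation. -/
def der (H : Q) : Q := H * H

theorem der_mono {H K : Q} (h : H ≤ K) : der H ≤ der K := mul_le h h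

theorem iterate_der_le {H : Q} (hH : H * H ≤ H) (f : ℕ) : der^[f] H ≤ H := by
  induction f with
  | zero => exact le_rfl
  | succ f ih => rw [Function.iterate_succ_apply']; exact (der_mono ih).trans hH

theorem iterate_der_mul_self {H : Q} (hH : H * H ≤ H) (f : ℕ) :
    der^[f] H * der^[f] H ≤ der^[f] H := by
  induction f with
  | zero => exact hH
  | succ f ih => rw [Function.iterate_succ_apply']; exact mul_le ih ih

/-- The components of degree `0` and of degree at least `k`. -/
def upper (k : ℕ) (H : Q) : Q := ⨆ i : {i : ZMod n // i = 0 ∨ k ≤ i.val}, pr i.1 H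

theorem le_upper {k : ℕ} (H : Q) {i : ZMod n} (h : i = 0 ∨ k ≤ i.val) : pr i H ≤ upper k H :=
  le_iSup (fun i : {i : ZMod n // i = 0 ∨ k ≤ i.val} => pr i.1 H) ⟨i, h⟩

theorem upper_le (k : ℕ) (H : Q) : upper k H ≤ H := iSup_le fun i => pr_le i.1 H

/-- Left-normed words of length at most `ρ + 1` in `upper k H`. -/
def upperWords (k : ℕ) (H : Q) : ℕ → Q
  | 0 => upper k H
  | ρ + 1 => upperWords k H ρ ⊔ upperWords k H ρ * upper k H

theorem upperWords_mono (k : ℕ) (H : Q) {ρ σ : ℕ} (h : ρ ≤ σ) :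
    upperWords k H ρ ≤ upperWords k H σ :=
  monotone_nat_of_le_succ (f := upperWords k H) (fun _ => le_sup_left) h

theorem upperWords_mul_le (k : ℕ) (H : Q) (b : ℕ) : ∀ a,
    upperWords k H a * upperWords k H b ≤ upperWords k H (a + b + 1) := by
  induction b with
  | zero => intro a; exact le_sup_right
  | succ b ih =>
    intro a
    rw [upperWords, mul_sup']
    refine sup_le ((ih a).trans (upperWords_mono k H (by omega))) ?_
    refine (mul_mul_le' _ _ _).trans (sup_le ?_ ?_)
    · exact (mul_le_l (ih a) _).trans (le_sup_right : _ ≤ upperWords k H (a + b + 1 + 1))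
    · exact (mul_le_l (le_sup_right : _ ≤ upperWords k H (a + 1)) _).trans
        ((ih (a + 1)).trans (upperWords_mono k H (by omega)))

theorem upperWords_le {k : ℕ} {H : Q} (hH : H * H ≤ H) (ρ : ℕ) : upperWords k H ρ ≤ H := by
  induction ρ with
  | zero => exact upper_le k H
  | succ ρ ih => exact sup_le ih ((mul_le ih (upper_le k H)).trans hH)

/-- Multiplying a subalgebra by a long word reduces to multiplying it by a single letter; this is
what gives access to degrees. -/
theorem mul_upperWords_le {k : ℕ} {H : Q} (hH : H * H ≤ H) (ρ : ℕ) :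
    H * upperWords k H ρ ≤ H * upper k H := by
  induction ρ with
  | zero => exact le_rfl
  | succ ρ ih =>
    rw [upperWords, mul_sup']
    refine sup_le ih ((mul_mul_le' _ _ _).trans (sup_le ?_ ?_))
    · exact mul_le_l ((mul_le_r (upperWords_le hH ρ) H).trans hH) _
    · exact (mul_le_l ((mul_le_r (upper_le k H) H).trans hH) _).trans ih

/-- The error terms. -/
def err (w : Q) (φ : ℕ → ℕ) (R : ℕ) : Q := ⨆ r : Fin (R + 1), mulCl (act ⊤ w (φ r)) r

theorem le_err (w : Q) (φ : ℕ → ℕ) {R r : ℕ} (h : r ≤ R) :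
    mulCl (act ⊤ w (φ r)) r ≤ err w φ R :=
  le_iSup (fun r : Fin (R + 1) => mulCl (act ⊤ w (φ r)) r) ⟨r, by omega⟩

theorem err_mono (w : Q) (φ : ℕ → ℕ) {R S : ℕ} (h : R ≤ S) : err w φ R ≤ err w φ S :=
  iSup_le fun r => le_err w φ (by omega)

/-- The heaviness `φ` is prescribed as a function of the number of multiplications, so errors
survive `ρ` more multiplications once `φ` is shifted by `ρ`. -/
theorem mulCl_err_le (w : Q) (φ : ℕ → ℕ) (R ρ : ℕ) :
    mulCl (err w (fun r => φ (r + ρ)) R) ρ ≤ err w φ (R + ρ) :=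
  mulCl_iSup_le fun r => by
    rw [mulCl_mulCl]; exact le_err w φ (by omega)

theorem pr_mul_right_le (k : ZMod n) {j : ZMod n} (x : Q) {y : Q} (hy : y ≤ comp Q j) :
    pr k (x * y) ≤ pr (k - j) x * y := by
  rw [pr_mul]
  refine iSup_le fun i => ?_
  by_cases h : k - i = j
  · rw [← h, sub_sub_cancel]
    exact mul_le_r (pr_le _ _) _
  · rw [pr_of_le_ne hy h, mul_bot']; exact bot_le

end Kreknin

variable {n : ℕ}

/-- The standing hypotheses for Kreknin's argument. -/
structure KrekninData (N : ℕ) {Q : Type*} [LieTypeLattice n Q] (w H : Q) : Prop where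
  le : w ≤ comp Q 0
  nil : act (comp Q 0) w N = ⊥
  closed : H * H ≤ H
  zero : pr 0 H ≤ w

theorem KrekninData.iterate {N : ℕ} {Q : Type*} [LieTypeLattice n Q] {w H : Q}
    (h : KrekninData N w H) (f : ℕ) : KrekninData N w (der^[f] H) :=
  ⟨h.le, h.nil, iterate_der_mul_self h.closed f,
    (pr_mono 0 (iterate_der_le h.closed f)).trans h.zero⟩

/-- After boundedly many derived steps only the components of degree `0` and `≥ k` matter. -/
def KrekninUpTo (n N k : ℕ) : Prop :=
  ∀ φ : ℕ → ℕ, ∃ f ρ R : ℕ, ∀ (Q : Type u) [LieTypeLattice n Q] (w H : Q), KrekninData N w H →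
    der^[f] H ≤ upperWords k H ρ ⊔ err w φ R

/-- After further derived steps, the component of degree `k` is expressed by higher components, up
to errors and words with `t` letters `w` on either side. In degree `κ` a product of components
either involves the zero component, which contributes one more `w`, or has both degrees above `k`.
-/
theorem KrekninUpTo.claim [NeZero n] {N k : ℕ} (hK : KrekninUpTo.{u} n N k) {κ : ZMod n}
    (hκ : κ.val = k) (t : ℕ) : ∀ φ : ℕ → ℕ, ∃ g ρ R : ℕ, ∀ (Q : Type u) [LieTypeLattice n Q]
      (w H : Q), KrekninData N w H →
      pr κ (der^[g] H) ≤ upperWords (k + 1) H ρ ⊔ twoSided ⊤ w t ⊔ err w φ R := by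
  induction t with
  | zero => exact fun φ => ⟨0, 0, 0, fun Q _ w H _ => le_top.trans (le_sup_right.trans le_sup_left)⟩
  | succ t ih =>
    intro φ
    obtain ⟨g, ρ, R, hg⟩ := ih fun r => φ (r + 1)
    obtain ⟨f, ρ₁, R₁, hf⟩ := hK fun r => φ (r + 1)
    refine ⟨f + 1 + g, ρ + 2, max R R₁ + 1, fun Q _ w H hH => ?_⟩
    set z := upperWords (k + 1) H (ρ + 2) ⊔ twoSided ⊤ w (t + 1) ⊔ err w φ (max R R₁ + 1) with hz
    have hz1 : upperWords (k + 1) H (ρ + 2) ≤ z := le_sup_left.trans le_sup_left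
    have hz2 : twoSided ⊤ w (t + 1) ≤ z := le_sup_right.trans le_sup_left
    have hz3 : err w φ (max R R₁ + 1) ≤ z := le_sup_right
    have hgH := hg Q w H hH
    set H' := der^[g] H with hH'
    have hd := hH.iterate g
    rw [← hH'] at hd
    have hle : H' ≤ H := iterate_der_le hH.closed g
    have hE : ∀ R', R' ≤ max R R₁ → mulCl (err w (fun r => φ (r + 1)) R') 1 ≤ z := fun R' h =>
      (mulCl_err_le w φ R' 1).trans ((err_mono w φ (by omega)).trans hz3)
    have h0u : pr 0 H' ≤ upperWords (k + 1) H 0 :=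
      (pr_mono 0 hle).trans (le_upper (k := k + 1) H (Or.inl rfl))
    rw [Function.iterate_add_apply, Function.iterate_succ_apply', ← hH']
    have hM := hf Q w H' hd
    have h1 : der (der^[f] H') ≤ H' * upper k H' ⊔ mulCl (err w (fun r => φ (r + 1)) R₁) 1 := by
      refine (mul_le (iterate_der_le hd.closed f) hM).trans ?_
      rw [mul_sup']
      refine sup_le_sup (mul_upperWords_le hd.closed ρ₁) ?_
      exact (mul_le_l le_top _).trans (top_mul_mulCl_le _ 0)
    refine (pr_mono κ h1).trans ?_
    rw [pr_sup]
    refine sup_le ?_ ((pr_le _ _).trans (hE R₁ (le_max_right _ _)))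
    rw [upper, mul_iSup', pr_iSup]
    refine iSup_le fun ⟨i, hi⟩ => (pr_mul_right_le κ H' (pr_le_comp i H')).trans ?_
    by_cases hi0 : i = 0
    · subst hi0
      rw [sub_zero]
      refine (mul_le_l hgH _).trans ?_
      rw [sup_mul', sup_mul']
      refine sup_le (sup_le ?_ ?_) ?_
      · exact (mul_le_r h0u _).trans ((upperWords_mul_le _ _ _ _).trans
          ((upperWords_mono _ _ (by omega)).trans hz1))
      · exact (mul_le_r hd.zero _).trans (le_sup_left.trans hz2)
      · exact (mul_le_r le_top _).trans ((mulCl_mul_top_le _ 0).trans (hE R (le_max_left _ _)))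
    by_cases hiκ : i = κ
    · subst hiκ
      rw [sub_self]
      refine (mul_le_r hgH _).trans ?_
      rw [mul_sup', mul_sup']
      refine sup_le (sup_le ?_ ?_) ?_
      · exact (mul_le_l h0u _).trans ((upperWords_mul_le _ _ _ _).trans
          ((upperWords_mono _ _ (by omega)).trans hz1))
      · exact (mul_le_l hd.zero _).trans (le_sup_right.trans hz2)
      · exact (mul_le_l le_top _).trans ((top_mul_mulCl_le _ 0).trans (hE R (le_max_left _ _)))
    have hik : k < i.val := by
      rcases hi with h | h
      · exact absurd h hi0
      · refine lt_of_le_of_ne h fun h' => hiκ (ZMod.val_injective n ?_)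
        rw [hκ, h']
    -- As `i.val > k = κ.val`, the difference wraps around `n`: its value is `n + k - i.val`, which
    -- exceeds `k` because `i.val < n`.
    have hsub : k < (κ - i).val := by
      have h2 : i.val < n := ZMod.val_lt i
      by_contra hcon
      have h3 : (κ - i + i).val = (κ - i).val + i.val ∨ (κ - i + i).val + n = (κ - i).val + i.val := by
        rcases lt_or_ge ((κ - i).val + i.val) n with h | h
        · exact Or.inl (ZMod.val_add_of_lt h)
        · exact Or.inr (by rw [← ZMod.val_add_val_of_le h])
      rw [sub_add_cancel, hκ] at h3
      omega
    refine le_trans (mul_le ((pr_mono _ hle).trans (le_upper H (Or.inr hsub)))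
      ((pr_mono _ hle).trans (le_upper H (Or.inr hik)))) ?_
    exact (upperWords_mul_le (k + 1) H 0 0).trans ((upperWords_mono _ _ (by omega)).trans hz1)

/-- Substitute the expression for the degree-`k` component into the words in `upper k`. Words of
bounded length in the substituted expressions are either words in `upper (k + 1)` or contain an
error. -/
theorem krekninUpTo [NeZero n] (N k : ℕ) : KrekninUpTo.{u} n N k := by
  induction k with
  | zero =>
    refine fun φ => ⟨0, 0, 0, fun Q _ w H _ => le_sup_of_le_left ?_⟩
    exact le_of_pr_le fun i => le_upper H (Or.inr (Nat.zero_le _))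
  | succ k ih =>
    intro φ
    obtain ⟨f, ρ, R, hf⟩ := ih φ
    -- In this case no nonzero degree has representative `k`, so there is nothing to eliminate.
    by_cases hk : (k : ZMod n) = 0 ∨ (k : ZMod n).val ≠ k
    · refine ⟨f, ρ, R, fun Q _ w H hH => (hf Q w H hH).trans (sup_le_sup ?_ le_rfl)⟩
      have hu : upper k H ≤ upper (k + 1) H := iSup_le fun ⟨i, hi⟩ => by
        refine le_upper H ?_
        by_cases h0 : i = 0
        · exact Or.inl h0
        · refine Or.inr (lt_of_le_of_ne (hi.resolve_left h0) fun h => ?_)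
          have : (k : ZMod n) = i := by rw [h]; simp
          rcases hk with hk | hk
          · exact h0 (this ▸ hk)
          · exact hk (by rw [this, h])
      clear hf
      induction ρ with
      | zero => exact hu
      | succ ρ ihρ => exact sup_le_sup ihρ (mul_le ihρ hu)
    · push Not at hk
      obtain ⟨-, hk⟩ := hk
      -- With `φ ρ + N` two-sided letters, at least `φ ρ` of them become right factors, so the
      -- two-sided term is itself an error. The shift by `ρ` provides for the at most `ρ` later
      -- multiplications.
      obtain ⟨g, ρ', R', hg⟩ := ih.claim hk (φ ρ + N) fun r => φ (r + ρ)
      refine ⟨f + g, (ρ + 1) * (ρ' + 1), max R (R' + ρ), fun Q _ w H hH => ?_⟩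
      have hgH := hg Q w H hH
      rw [Function.iterate_add_apply]
      set P := der^[g] H with hP
      have hPH : P ≤ H := iterate_der_le hH.closed g
      refine (hf Q w P (hH.iterate g)).trans (sup_le ?_ ((err_mono w φ (le_max_left _ _)).trans
        le_sup_right))
      set E := err w (fun r => φ (r + ρ)) R' with hE
      have hG : upper k P ≤ upperWords (k + 1) H ρ' ⊔ E := iSup_le fun ⟨i, hi⟩ => by
        by_cases h : i = 0 ∨ k + 1 ≤ i.val
        · exact (pr_mono i hPH).trans ((le_upper H h).trans
            ((upperWords_mono (k + 1) H (Nat.zero_le ρ')).trans le_sup_left))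
        · push Not at h
          have hik : i = (k : ZMod n) := by
            have := hi.resolve_left h.1
            rw [show k = i.val by omega]; simp
          subst hik
          refine hgH.trans (sup_le (sup_le le_sup_left ?_) le_sup_right)
          refine (twoSided_le hH.le hH.nil le_top le_top _).trans (le_sup_of_le_right ?_)
          have := le_err w (fun r => φ (r + ρ)) (Nat.zero_le R')
          simpa [mulCl] using this
      have hS : ∀ σ, upperWords k P σ ≤ upperWords (k + 1) H ((σ + 1) * (ρ' + 1)) ⊔ mulCl E σ := by
        intro σ
        induction σ with
        | zero => exact hG.trans (sup_le_sup (upperWords_mono _ _ (by omega)) le_rfl)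
        | succ σ ihσ =>
          refine sup_le (ihσ.trans (sup_le_sup (upperWords_mono _ _ (by gcongr; omega))
            (mulCl_le_succ _ _))) ((mul_le ihσ hG).trans ?_)
          rw [sup_mul', mul_sup']
          refine sup_le (sup_le ?_ ?_) ?_
          · refine (upperWords_mul_le _ _ _ _).trans ((upperWords_mono _ _ ?_).trans le_sup_left)
            ring_nf; omega
          · refine (mul_le_l le_top _).trans ((top_mul_mulCl_le E 0).trans
              ((mulCl_mono le_rfl (by omega)).trans le_sup_right))
          · exact (mul_le_r le_top _).trans ((mulCl_mul_top_le E σ).trans le_sup_right)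
      refine (hS ρ).trans (sup_le_sup le_rfl ?_)
      exact (mulCl_err_le w φ R' ρ).trans (err_mono w φ (le_max_right _ _))

/-- Kreknin's theorem with error terms. -/
theorem exists_iterate_der_le [NeZero n] (N q : ℕ) : ∃ d, ∀ (Q : Type u) [LieTypeLattice n Q]
    (w H : Q), KrekninData N w H → der^[d] H ≤ mulCl (act ⊤ w q) 1 := by
  -- The heaviness `s r` is chosen so that an error with `r` multiplications still collapses after
  -- the `N` further derived steps needed to kill the `w`-part.
  choose s hs using fun r => exists_mulCl_act_le.{u} n N (r + N) q
  obtain ⟨f, ρ, R, hf⟩ := krekninUpTo.{u} (n := n) N n s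
  refine ⟨N + f, fun Q _ w H hH => ?_⟩
  rw [Function.iterate_add_apply]
  have h0 : pr 0 H * pr 0 H ≤ pr 0 H := by
    refine le_trans ?_ (pr_mono 0 hH.closed)
    rw [← pr_of_le (mul_le_comp' (pr_le_comp 0 H) (pr_le_comp 0 H) (add_zero 0))]
    exact pr_mono 0 (mul_le (pr_le _ _) (pr_le _ _))
  have hu : upper n H ≤ pr 0 H := iSup_le fun ⟨i, hi⟩ => by
    rcases hi with h | h
    · exact (congrArg (fun j => pr j H) h).le
    · exact absurd (ZMod.val_lt i) (by omega)
  have hw : ∀ σ, upperWords n H σ ≤ pr 0 H := by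
    intro σ
    induction σ with
    | zero => exact hu
    | succ σ ih => exact sup_le ih ((mul_le ih hu).trans h0)
  set M := der^[f] H with hM
  have hM0 : M ≤ w ⊔ err w s R := (hf Q w H hH).trans (sup_le_sup ((hw ρ).trans hH.zero) le_rfl)
  have key : ∀ j, der^[j] M ≤ act (comp Q 0) w j ⊔ mulCl (err w s R) j := by
    intro j
    induction j with
    | zero => exact hM0.trans (sup_le_sup hH.le le_rfl)
    | succ j ih =>
      rw [Function.iterate_succ_apply']
      refine (mul_le ih ((iterate_der_le (iterate_der_mul_self hH.closed f) j).trans hM0)).trans ?_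
      rw [sup_mul', mul_sup']
      refine sup_le (sup_le le_sup_left ?_) ?_
      · exact (mul_le_l le_top _).trans ((top_mul_mulCl_le (err w s R) 0).trans
          ((mulCl_mono le_rfl (by omega)).trans le_sup_right))
      · exact (mul_le_r le_top _).trans ((mulCl_mul_top_le _ j).trans le_sup_right)
  refine (key N).trans (sup_le (hH.nil.le.trans bot_le) (mulCl_iSup_le fun r => ?_))
  rw [mulCl_mulCl]
  exact hs r Q w hH.le hH.nil

end LieTypeLattice

namespace LieTypeLattice

/-! ### Words over a fixed element and words with one distinguished factor. -/

section Words

variable {n : ℕ} {Q : Type*} [LieTypeLattice n Q]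

/-- Products of depth at most `k` of elements of `E`. -/
def words (E : Q) : ℕ → Q
  | 0 => E
  | k + 1 => words E k ⊔ words E k * words E k

/-- Products of depth at most `k` with one factor from `X` and the other factors from `E`. -/
def oneWords (E X : Q) : ℕ → Q
  | 0 => X
  | k + 1 => oneWords E X k ⊔ oneWords E X k * words E k ⊔ words E k * oneWords E X k

theorem words_mono {E E' : Q} (h : E ≤ E') {k k' : ℕ} (hk : k ≤ k') :
    words E k ≤ words E' k' := by
  have h1 : words E k ≤ words E' k := by
    clear hk
    induction k with
    | zero => exact h
    | succ k ih => exact sup_le_sup ih (mul_le ih ih)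
  exact h1.trans (monotone_nat_of_le_succ (f := words E') (fun _ => le_sup_left) hk)

theorem oneWords_mono (E X : Q) {k k' : ℕ} (hk : k ≤ k') : oneWords E X k ≤ oneWords E X k' :=
  monotone_nat_of_le_succ (f := oneWords E X) (fun _ => le_sup_left.trans le_sup_left) hk

theorem mul_le_words {E x y : Q} {i j k : ℕ} (hx : x ≤ words E i) (hy : y ≤ words E j)
    (hk : i + j + 1 ≤ k) : x * y ≤ words E k :=
  (mul_le (hx.trans (words_mono le_rfl (by omega : i ≤ i + j)))
    (hy.trans (words_mono le_rfl (by omega : j ≤ i + j)))).trans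
    ((le_sup_right : _ ≤ words E (i + j + 1)).trans (words_mono le_rfl hk))

theorem mul_le_oneWords {E X x y : Q} {i j k : ℕ} (hx : x ≤ oneWords E X i) (hy : y ≤ words E j)
    (hk : i + j + 1 ≤ k) : x * y ≤ oneWords E X k :=
  (mul_le (hx.trans (oneWords_mono E X (by omega : i ≤ i + j)))
    (hy.trans (words_mono le_rfl (by omega : j ≤ i + j)))).trans
    ((le_sup_right.trans le_sup_left : _ ≤ oneWords E X (i + j + 1)).trans (oneWords_mono E X hk))

theorem mul_le_oneWords' {E X x y : Q} {i j k : ℕ} (hx : x ≤ oneWords E X i) (hy : y ≤ words E j)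
    (hk : i + j + 1 ≤ k) : y * x ≤ oneWords E X k :=
  (mul_le (hy.trans (words_mono le_rfl (by omega : j ≤ i + j)))
    (hx.trans (oneWords_mono E X (by omega : i ≤ i + j)))).trans
    ((le_sup_right : _ ≤ oneWords E X (i + j + 1)).trans (oneWords_mono E X hk))

theorem act_le_words {E x w : Q} {i s k : ℕ} (hx : x ≤ words E i) (hw : w ≤ E)
    (hk : i + s ≤ k) : act x w s ≤ words E k := by
  induction s generalizing k with
  | zero => exact hx.trans (words_mono le_rfl (by omega))
  | succ s ih => exact mul_le_words (ih (k := i + s) le_rfl) (j := 0) hw (by omega)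

theorem act_le_oneWords {E X x w : Q} {i j s k : ℕ} (hx : x ≤ oneWords E X i)
    (hw : w ≤ words E j) (hk : i + s * (j + 1) ≤ k) : act x w s ≤ oneWords E X k := by
  induction s generalizing k with
  | zero => exact hx.trans (oneWords_mono E X (by omega))
  | succ s ih =>
    exact mul_le_oneWords (ih (k := i + s * (j + 1)) le_rfl) hw (by rw [Nat.succ_mul] at hk; omega)

/-- `act x Y u` followed by `t` factors `W`. -/
def act₂ (Y W x : Q) (u t : ℕ) : Q := act (act x Y u) W t

theorem act₂_mono {Y W x y : Q} (h : x ≤ y) (u t : ℕ) : act₂ Y W x u t ≤ act₂ Y W y u t :=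
  act_mono (act_mono h le_rfl u) le_rfl t

theorem act₂_sup {Y W : Q} (x y : Q) (u t : ℕ) :
    act₂ Y W (x ⊔ y) u t = act₂ Y W x u t ⊔ act₂ Y W y u t := by
  rw [act₂, act_sup, act_sup]; rfl

theorem act₂_bot {Y W : Q} (u t : ℕ) : act₂ Y W ⊥ u t = ⊥ := by
  rw [act₂, act_bot, act_bot]

theorem act₂_le_oneWords {E X Y W x : Q} {i u t k : ℕ} (hx : x ≤ oneWords E X i) (hY : Y ≤ E)
    (hW : W ≤ E) (hk : i + u + t ≤ k) : act₂ Y W x u t ≤ oneWords E X k :=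
  act_le_oneWords (j := 0) (act_le_oneWords (j := 0) (k := i + u) hx hY (by omega)) hW (by omega)

theorem act₂_le_words {E Y W x : Q} {i u t k : ℕ} (hx : x ≤ words E i) (hY : Y ≤ E)
    (hW : W ≤ E) (hk : i + u + t ≤ k) : act₂ Y W x u t ≤ words E k :=
  act_le_words (act_le_words (k := i + u) hx hY (by omega)) hW (by omega)

theorem act₂_le_comp {i : ZMod n} {Y W x : Q} (hx : x ≤ comp Q i) (hY : Y ≤ comp Q 0)
    (hW : W ≤ comp Q 0) (u t : ℕ) : act₂ Y W x u t ≤ comp Q i :=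
  act_le_comp (act_le_comp hx hY u) hW t

theorem act₂_mul_le {Y W x y z : Q} (u t : ℕ)
    (h : ∀ v v', v ≤ u → v' ≤ t → act₂ Y W x (u - v) (t - v') * act₂ Y W y v v' ≤ z) :
    act₂ Y W (x * y) u t ≤ z := by
  have h1 : act (x * y) Y u ≤ ⨆ v : {v // v ≤ u}, act x Y (u - v) * act y Y v :=
    act_mul_le u x y fun i j hij => by
      have : i = u - j := by omega
      subst this
      exact le_iSup (fun v : {v // v ≤ u} => act x Y (u - v) * act y Y v) ⟨j, by omega⟩
  refine (act_mono h1 le_rfl t).trans ?_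
  rw [act_iSup]
  refine iSup_le fun v => act_mul_le t _ _ fun i j hij => ?_
  have : i = t - j := by omega
  subst this
  exact h v j v.2 (by omega)

theorem act_le_comp_smul {i c : ZMod n} {x w : Q} (hx : x ≤ comp Q i) (hw : w ≤ comp Q c) (s : ℕ) :
    act x w s ≤ comp Q (i + s • c) := by
  induction s with
  | zero => simpa using hx
  | succ s ih => exact mul_le_comp' ih hw (by rw [succ_nsmul, add_assoc])

/-- When `S * P = 0`, the identity reduces to `(xS)P ≤ (xP)S`, so `P` moves left past the letters
`S`. -/
theorem act_mul_comm_le {x S P : Q} (h : S * P = ⊥) (r : ℕ) :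
    act x S r * P ≤ act (x * P) S r := by
  induction r with
  | zero => exact le_rfl
  | succ r ih =>
    refine (mul_mul_le _ _ _).trans (sup_le ?_ (mul_le_l ih S))
    rw [h, mul_bot']; exact bot_le

theorem act_act_comm_le {x S P : Q} (h : S * P = ⊥) (r s : ℕ) :
    act (act x S r) P s ≤ act (act x P s) S r := by
  induction s with
  | zero => exact le_rfl
  | succ s ih => exact (mul_le_l ih P).trans (act_mul_comm_le h r)

theorem mul_le_of_le_sup {v Y P M : Q} (h : Y ≤ P * M ⊔ M * P) : v * Y ≤ v * P * M ⊔ v * M * P := by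
  refine (mul_le_r h v).trans ?_
  rw [mul_sup']
  refine sup_le (mul_mul_le' _ _ _) ((mul_mul_le' _ _ _).trans ?_)
  rw [sup_comm]

end Words

/-! ### Towers of generic presentations and nilpotency. -/

section Tower

variable {n : ℕ} {Q : Type*} [LieTypeLattice n Q]

/-- `ℓ` successive presentations `Y ≤ P * M ⊔ M * P` with `P` of degree `a` and `M` of degree `-a`,
each generic, relative to `U`, over `E` and the preceding ones. -/
def Tower (k : ℕ) (U Y : Q) (a : ZMod n) : ℕ → Q → Prop
  | 0, _ => True
  | ℓ + 1, E => ∃ P M, P ≤ comp Q a ∧ M ≤ comp Q (-a) ∧ Y ≤ P * M ⊔ M * P ∧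
      oneWords E (P ⊔ M) k ≤ U ∧ Tower k U Y a ℓ (E ⊔ P ⊔ M)

theorem Tower.neg {k : ℕ} {U Y : Q} {a : ZMod n} : ∀ {ℓ : ℕ} {E : Q},
    Tower k U Y a ℓ E → Tower k U Y (-a) ℓ E
  | 0, _, _ => trivial
  | ℓ + 1, E, ⟨P, M, hP, hM, hY, hU, h⟩ =>
    ⟨M, P, hM, by rwa [neg_neg], by rwa [sup_comm], by rwa [sup_comm],
      by rw [sup_right_comm]; exact h.neg⟩

/-- The basic vanishing principle: a word with one generic letter lies in `U`, and `U` has no zero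
component. -/
theorem eq_bot_of_le_oneWords {k k' : ℕ} {U E X x : Q} (hU : pr 0 U = ⊥) (h : oneWords E X k ≤ U)
    (hx : x ≤ oneWords E X k') (hk : k' ≤ k) (hx0 : x ≤ comp Q 0) : x = ⊥ := by
  rw [← pr_of_le hx0, ← le_bot_iff, ← hU]
  exact pr_mono 0 (hx.trans ((oneWords_mono E X hk).trans h))

/-- Replace the next `Y` by `P * M` or `M * P`. Since `act A S r` has degree `a`, its product with
`M` is a degree-zero generic word and vanishes. In the other term `P` moves left past the letters
`S` to join `A`, and `M` joins `S`. At the end `A` has degree zero and a generic last letter, so it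
is zero. -/
theorem Tower.act_act_eq_bot {k : ℕ} {U Y : Q} {a : ZMod n} (hU : pr 0 U = ⊥) :
    ∀ (ℓ r : ℕ) (E A S : Q), Tower k U Y a ℓ E → A ≤ words E r → A ≤ comp Q ((r + 1) • a) →
      S ≤ E → S ≤ comp Q (-a) → (r + 1 + ℓ) • a = 0 → (ℓ = 0 → A = ⊥) → 2 * (r + ℓ) + 3 ≤ k →
      act (act A S r) Y ℓ = ⊥ := by
  intro ℓ
  induction ℓ with
  | zero => intro r E A S _ _ _ _ _ _ h _; rw [h rfl, act_bot, act_bot]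
  | succ ℓ ih =>
    rintro r E A S ⟨P, M, hP, hM, hY, hPM, ht⟩ hA hAd hS hSd hr - hk
    have hPX : P ≤ oneWords E (P ⊔ M) 0 := le_sup_left
    have hMX : M ≤ oneWords E (P ⊔ M) 0 := le_sup_right
    have hv : act A S r ≤ words E (2 * r) := act_le_words hA hS (by omega)
    have hvd : act A S r ≤ comp Q a := by
      refine (act_le_comp_smul hAd hSd r).trans_eq ?_
      congr 1
      rw [smul_neg, succ_nsmul]; abel
    have hvM : act A S r * M = ⊥ := eq_bot_of_le_oneWords hU hPM
      (mul_le_oneWords' hMX hv le_rfl) (by omega) (mul_le_comp' hvd hM (by abel))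
    have hSP : S * P = ⊥ := eq_bot_of_le_oneWords hU hPM
      (mul_le_oneWords' (j := 0) hPX hS le_rfl) (by omega) (mul_le_comp' hSd hP (by abel))
    rw [act_succ', ← le_bot_iff]
    have h1 : act A S r * Y ≤ act (A * P) (S ⊔ M) (r + 1) := by
      refine (mul_le_of_le_sup hY).trans (sup_le ?_ ?_)
      · refine mul_le ((act_mul_comm_le hSP r).trans ?_) le_sup_right
        exact act_mono le_rfl le_sup_left r
      · rw [hvM, bot_mul']; exact bot_le
    refine (act_mono h1 le_rfl ℓ).trans (le_bot_iff.2 ?_)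
    have hEE : E ≤ E ⊔ P ⊔ M := le_sup_left.trans le_sup_left
    refine ih (r + 1) _ (A * P) (S ⊔ M) ht ?_ ?_ ?_ ?_ ?_ ?_ (by omega)
    · exact mul_le_words (j := 0) (hA.trans (words_mono hEE le_rfl))
        (le_sup_right.trans le_sup_left) (by omega)
    · exact mul_le_comp' hAd hP (succ_nsmul a (r + 1)).symm
    · exact sup_le (hS.trans hEE) le_sup_right
    · exact sup_le hSd hM
    · rw [← hr]; congr 1; omega
    · rintro rfl
      refine eq_bot_of_le_oneWords hU hPM (mul_le_oneWords' hPX hA le_rfl) (by omega) ?_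
      refine mul_le_comp' hAd hP ?_
      rw [← succ_nsmul, ← hr]

/-- The components of degree `±a` are annihilated by long products with `Y`. -/
theorem Tower.act_eq_bot [NeZero n] {k : ℕ} {U Y E p : Q} {a : ZMod n} (hU : pr 0 U = ⊥)
    (h : Tower k U Y a n E) (ha : a ≠ 0) (hpE : p ≤ E) (hp : p ≤ comp Q a) (hk : 2 * n + 3 ≤ k) :
    act p Y (n - 1) = ⊥ := by
  have hn : n ≠ 1 := by rintro rfl; exact ha (Subsingleton.elim _ _)
  have hn0 := NeZero.ne n
  have ht : Tower k U Y a (n - 1) E := by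
    have key : ∀ {ℓ : ℕ} {E : Q}, Tower k U Y a (ℓ + 1) E → Tower k U Y a ℓ E := by
      intro ℓ
      induction ℓ with
      | zero => exact fun _ => trivial
      | succ ℓ ih => exact fun ⟨P, M, hP, hM, hY, hPM, ht⟩ => ⟨P, M, hP, hM, hY, hPM, ih ht⟩
    exact key (by rwa [Nat.sub_add_cancel (by omega)])
  refine ht.act_act_eq_bot hU (n - 1) 0 E p ⊥ hpE (by simpa using hp) bot_le bot_le ?_ ?_ (by omega)
  · rw [show 0 + 1 + (n - 1) = n by omega]; simp
  · intro h; omega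

/-- Standing hypotheses on the pair `Y`, `W`. -/
structure NilPair (U Y W : Q) (a : ZMod n) (n' N' : ℕ) : Prop where
  pr_zero : pr 0 U = ⊥
  leY : Y ≤ comp Q 0
  leW : W ≤ comp Q 0
  nilY : act (comp Q a) Y n' = ⊥
  nilY' : act (comp Q (-a)) Y n' = ⊥
  nilW : act (comp Q a) W N' = ⊥
  nilW' : act (comp Q (-a)) W N' = ⊥

theorem NilPair.neg {U Y W : Q} {a : ZMod n} {n' N' : ℕ} (h : NilPair U Y W a n' N') :
    NilPair U Y W (-a) n' N' :=
  ⟨h.1, h.2, h.3, h.5, by rw [neg_neg]; exact h.4, h.7, by rw [neg_neg]; exact h.6⟩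

/-- Letters `Y`, `W` acting on `x * d` distribute over the two factors; `d` can take fewer than `n'`
and `N'` of them, so `x` keeps nearly all. -/
theorem NilPair.push {U Y W x d z : Q} {a : ZMod n} {n' N' : ℕ} (h : NilPair U Y W a n' N')
    (hd : d ≤ comp Q a) {u t : ℕ} (H : ∀ v v', v ≤ u → v' ≤ t → v < n' → v' < N' →
      act₂ Y W x (u - v) (t - v') * act₂ Y W d v v' ≤ z) : act₂ Y W (x * d) u t ≤ z := by
  refine act₂_mul_le u t fun v v' hv hv' => ?_
  by_cases h1 : v < n'
  · by_cases h2 : v' < N'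
    · exact H v v' hv hv' h1 h2
    · have : act₂ Y W d v v' = ⊥ := by
        rw [← le_bot_iff]
        exact (act_mono (act_le_comp hd h.leY v) le_rfl v').trans
          (act_eq_bot_of_le h.nilW (not_lt.1 h2)).le
      rw [this, mul_bot']; exact bot_le
  · have : act₂ Y W d v v' = ⊥ := by
      rw [act₂, ← le_bot_iff]
      refine (act_mono ((act_mono hd le_rfl v).trans
        (act_eq_bot_of_le h.nilY (not_lt.1 h1)).le) le_rfl v').trans (act_bot W v').le
    rw [this, mul_bot']; exact bot_le

/-- Moving the letters `S` to the right. -/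
theorem NilPair.push_act {U Y W x S Z : Q} {a : ZMod n} {n' N' : ℕ} (h : NilPair U Y W a n' N')
    (hZ : Z * (U ⊓ comp Q a) ≤ Z) (hS : S ≤ comp Q a)
    (hSU : ∀ v v', v < n' → v' < N' → act₂ Y W S v v' ≤ U) {T t₀ : ℕ}
    (hx : ∀ u t, u + t ≤ T → t₀ ≤ t → act₂ Y W x u t ≤ Z) :
    ∀ q u t, u + t ≤ T → t₀ + q * N' ≤ t → act₂ Y W (act x S q) u t ≤ Z := by
  intro q
  induction q with
  | zero => intro u t hT ht; exact hx u t hT (by omega)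
  | succ q ih =>
    intro u t hT ht
    rw [Nat.succ_mul] at ht
    refine h.push hS fun v v' hv hv' h1 h2 => ?_
    exact (mul_le (ih _ _ (by omega) (by omega))
      (le_inf (hSU v v' h1 h2) (act₂_le_comp hS h.leY h.leW v v'))).trans hZ

end Tower

end LieTypeLattice

namespace LieTypeLattice

/-! ### Moving a heavy element from one degree to another. -/

section Move

variable {n : ℕ} {Q : Type*} [LieTypeLattice n Q]

/-- One step of the expansion in `act₂_le_of_tower`: the new letter of degree `a` either completes a
generic prefix of degree `j`, or leads to the next state. -/
theorem NilPair.step {U Y W Z E P M y S S' : Q} {a i j : ZMod n} {n' N' k T t₀ p q κ u t : ℕ}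
    (h : NilPair U Y W a n' N') (hZ : Z * (U ⊓ comp Q (-a)) ≤ Z)
    (hZj : act (U ⊓ comp Q j) W t₀ ≤ Z) (hYE : Y ≤ E) (hWE : W ≤ E) (hyE : y ≤ E)
    (hP : P ≤ comp Q a) (hM : M ≤ comp Q (-a)) (hPM : oneWords E (P ⊔ M) k ≤ U)
    (hy : y ≤ comp Q i) (hj : i + κ • a = j) (hSE : S ≤ E) (hS'E : S' ≤ E)
    (hS : S ≤ comp Q a) (hS' : S' ≤ comp Q (-a))
    (hS'U : ∀ v v', v < n' → v' < N' → act₂ Y W S' v v' ≤ U)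
    (hp : p < κ) (hk : T + κ + n' + N' + 2 ≤ k)
    (hut : u + t ≤ T) (ht : t₀ + (q + 1) * N' ≤ t)
    (next : p + 1 < κ → ∀ v v', v ≤ u → v' ≤ t → v < n' → v' < N' →
      act₂ Y W (act (act y (S ⊔ P) (p + 1)) S' q) (u - v) (t - v') ≤ Z) :
    act₂ Y W (act (act y S p) S' q * P * M) u t ≤ Z := by
  have hPX : P ≤ oneWords E (P ⊔ M) 0 := le_sup_left
  have hMX : M ≤ oneWords E (P ⊔ M) 0 := le_sup_right
  have hSP : S' * P = ⊥ := eq_bot_of_le_oneWords h.pr_zero hPM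
    (mul_le_oneWords' (j := 0) hPX hS'E le_rfl) (by omega) (mul_le_comp' hS' hP (by abel))
  have hyp : act y S p ≤ words E p := act_le_words (i := 0) hyE hSE (by omega)
  refine h.neg.push hM fun v v' hv hv' h1 h2 => ?_
  refine (mul_le ?_ (le_inf ?_ (act₂_le_comp hM h.leY h.leW v v'))).trans hZ
  · refine (act₂_mono (act_mul_comm_le hSP q) _ _).trans ?_
    -- If the prefix has fewer than `κ` letters of degree `a`, the expansion goes on. Otherwise it
    -- reaches degree `j` with a generic last letter, and the letters `S'` are pushed right past the
    -- remaining factors.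
    by_cases hpκ : p + 1 < κ
    · refine le_trans (act₂_mono (act_mono ?_ le_rfl q) _ _) (next hpκ v v' hv hv' h1 h2)
      exact mul_le (act_mono le_rfl le_sup_left p) le_sup_right
    · have hκ : κ = p + 1 := by omega
      refine h.neg.push_act hZ hS' hS'U (T := T) (t₀ := t₀) (fun u t hT ht => ?_) q _ _ (by omega)
        (by rw [Nat.succ_mul] at ht; omega)
      refine le_trans ?_ hZj
      obtain ⟨t', rfl⟩ := Nat.exists_eq_add_of_le ht
      rw [act₂, add_comm t₀, act_add]
      refine act_mono (le_inf ?_ ?_) le_rfl t₀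
      · refine (act₂_le_oneWords (k := k) (mul_le_oneWords' hPX hyp le_rfl) hYE hWE
          (by omega)).trans hPM
      · refine act₂_le_comp (mul_le_comp' (act_le_comp_smul hy hS p) hP ?_) h.leY h.leW u t'
        rw [← hj, hκ, succ_nsmul, add_assoc]
  · exact (act₂_le_oneWords hMX hYE hWE (by omega : 0 + v + v' ≤ k)).trans hPM

/-- Every expanded `Y` puts one more letter of degree `a` or `-a` into the prefix. Degree `j` is
reached after `κ` letters of the first kind or `κ'` of the second, and the bound on `κ + κ'` forces
this before the tower is exhausted. Each level costs at most `n'` factors `Y`; the surplus of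
factors `W` pays for pushing letters to the right. -/
theorem Tower.act₂_act_le {U Y W Z y : Q} {a i j : ZMod n} {n' N' k T t₀ κ κ' : ℕ}
    (h : NilPair U Y W a n' N') (hZ : Z * (U ⊓ comp Q a) ≤ Z) (hZ' : Z * (U ⊓ comp Q (-a)) ≤ Z)
    (hZj : act (U ⊓ comp Q j) W t₀ ≤ Z) (hy : y ≤ comp Q i) (hj : i + κ • a = j)
    (hj' : i + κ' • (-a) = j) (hk : T + κ + κ' + n' + N' + 2 ≤ k) :
    ∀ (ℓ : ℕ) (E : Q) (p q u t : ℕ) (S S' : Q), Tower k U Y a ℓ E → Y ≤ E → W ≤ E → y ≤ E →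
      S ≤ E → S' ≤ E → S ≤ comp Q a → S' ≤ comp Q (-a) → S * S' = ⊥ → S' * S = ⊥ →
      (∀ v v', v < n' → v' < N' → act₂ Y W S v v' ≤ U) →
      (∀ v v', v < n' → v' < N' → act₂ Y W S' v v' ≤ U) →
      p < κ → q < κ' → κ + κ' ≤ p + q + ℓ + 1 → n' * ℓ ≤ u → t₀ + N' * (2 * ℓ + p + q) ≤ t →
      0 < n' → u + t ≤ T →
      act₂ Y W (act (act y S p) S' q) u t ≤ Z := by
  intro ℓ
  induction ℓ with
  | zero => intros; omega
  | succ ℓ ih =>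
    rintro E p q u t S S' ⟨P, M, hP, hM, hY, hPM, hT⟩ hYE hWE hyE hSE hS'E hS hS' hSS' hS'S hSU
      hS'U hp hq hκ hu ht hn' hut
    have hPX : P ≤ oneWords E (P ⊔ M) 0 := le_sup_left
    have hMX : M ≤ oneWords E (P ⊔ M) 0 := le_sup_right
    have hEE : E ≤ E ⊔ P ⊔ M := le_sup_left.trans le_sup_left
    rw [Nat.mul_succ] at hu
    obtain ⟨u, rfl⟩ : ∃ u', u = u' + 1 := ⟨u - 1, by omega⟩
    have hPU : ∀ v v', v < n' → v' < N' → act₂ Y W P v v' ≤ U := fun v v' _ _ =>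
      (act₂_le_oneWords hPX hYE hWE (by omega : 0 + v + v' ≤ k)).trans hPM
    have hMU : ∀ v v', v < n' → v' < N' → act₂ Y W M v v' ≤ U := fun v v' _ _ =>
      (act₂_le_oneWords hMX hYE hWE (by omega : 0 + v + v' ≤ k)).trans hPM
    have hPS' : P * S' = ⊥ := eq_bot_of_le_oneWords h.pr_zero hPM
      (mul_le_oneWords (j := 0) hPX hS'E le_rfl) (by omega) (mul_le_comp' hP hS' (by abel))
    have hS'P : S' * P = ⊥ := eq_bot_of_le_oneWords h.pr_zero hPM
      (mul_le_oneWords' (j := 0) hPX hS'E le_rfl) (by omega) (mul_le_comp' hS' hP (by abel))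
    have hMS : M * S = ⊥ := eq_bot_of_le_oneWords h.pr_zero hPM
      (mul_le_oneWords (j := 0) hMX hSE le_rfl) (by omega) (mul_le_comp' hM hS (by abel))
    have hSM : S * M = ⊥ := eq_bot_of_le_oneWords h.pr_zero hPM
      (mul_le_oneWords' (j := 0) hMX hSE le_rfl) (by omega) (mul_le_comp' hS hM (by abel))
    have hNt : N' * (2 * (ℓ + 1) + p + q) = N' * (2 * ℓ + (p + 1) + q) + N' := by ring
    have hNt' : N' * (2 * ℓ + (p + 1) + q) = N' * (2 * ℓ + p) + q * N' + N' := by ring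
    have hNt'' : N' * (2 * ℓ + (p + 1) + q) = N' * (2 * ℓ + q) + p * N' + N' := by ring
    have hNt3 : N' * (2 * ℓ + (p + 1) + q) = N' * (2 * ℓ + p + (q + 1)) := by ring
    have e1 : act₂ Y W (act (act y S p) S' q) (u + 1) t =
        act₂ Y W (act (act y S p) S' q * Y) u t := by rw [act₂, act_succ']; rfl
    rw [e1]
    refine (act₂_mono (mul_le_of_le_sup hY) u t).trans ?_
    rw [act₂_sup]
    refine sup_le ?_ ?_
    · refine h.step (T := T) hZ' hZj hYE hWE hyE hP hM hPM hy hj hSE hS'E hS hS' hS'U hp (by omega)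
        (by omega) (by rw [Nat.succ_mul]; omega) fun hpκ v v' hv hv' h1 h2 => ?_
      refine ih _ (p + 1) q _ _ (S ⊔ P) S' hT (hYE.trans hEE) (hWE.trans hEE) (hyE.trans hEE)
        (sup_le (hSE.trans hEE) (le_sup_right.trans le_sup_left)) (hS'E.trans hEE) (sup_le hS hP)
        hS' ?_ ?_ ?_ hS'U hpκ hq (by omega) (by omega) (by omega) hn' (by omega)
      · rw [sup_mul', hSS', hPS', sup_idem]
      · rw [mul_sup', hS'S, hS'P, sup_idem]
      · intro v v' h1 h2
        rw [act₂_sup]; exact sup_le (hSU v v' h1 h2) (hPU v v' h1 h2)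
    -- The term with `M` first is the mirror image: because `S * S' = ⊥`, the letters `S'` may be
    -- brought before `S`, and `a` is replaced by `-a`.
    · refine (act₂_mono (mul_le_l (mul_le_l (act_act_comm_le hSS' p q) M) P) u t).trans ?_
      have hP' : P ≤ comp Q (- -a) := by rwa [neg_neg]
      refine h.neg.step (T := T) (by rw [neg_neg]; exact hZ) hZj hYE hWE hyE hM hP'
        (by rwa [sup_comm]) hy hj' hS'E hSE hS' (by rwa [neg_neg]) hSU hq (by omega)
        (by omega) (by rw [Nat.succ_mul]; omega) fun hqκ v v' hv hv' h1 h2 => ?_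
      have hS'S2 : (S' ⊔ M) * S = ⊥ := by rw [sup_mul', hS'S, hMS, sup_idem]
      refine (act₂_mono (act_act_comm_le hS'S2 (q + 1) p) _ _).trans ?_
      refine ih _ p (q + 1) _ _ S (S' ⊔ M) hT (hYE.trans hEE) (hWE.trans hEE) (hyE.trans hEE)
        (hSE.trans hEE) (sup_le (hS'E.trans hEE) le_sup_right) hS (sup_le hS' hM)
        ?_ hS'S2 hSU ?_ hp hqκ (by omega) (by omega) (by omega) hn' (by omega)
      · rw [mul_sup', hSS', hSM, sup_idem]
      · intro v v' h1 h2
        rw [act₂_sup]; exact sup_le (hS'U v v' h1 h2) (hMU v v' h1 h2)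

/-- Right multiples of `P` by letters from `B`. -/
def tails (P B : Q) : Q := ⨆ r, act P B r

theorem tails_mul_le (P B : Q) : tails P B * B ≤ tails P B :=
  iSup_mul_le fun r => le_iSup (fun r => act P B r) (r + 1)

theorem le_tails (P B : Q) : P ≤ tails P B := le_iSup (fun r => act P B r) 0

theorem tails_bot (B : Q) : tails ⊥ B = ⊥ := by simp [tails]

/-- By `(xb)l ≤ x(bl) + (xl)b`, a trailing letter either disappears into the other factor or becomes
the last factor of the whole product. -/
theorem pr_zero_tails_mul_le (P B : Q) :
    pr 0 (tails P B * ⊤) ≤ pr 0 (P * ⊤) ⊔ pr 0 (⊤ * B) := by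
  rw [tails, iSup_mul', pr_iSup]
  refine iSup_le fun r => ?_
  induction r with
  | zero => exact le_sup_left
  | succ r ih =>
    refine (pr_mono 0 (mul_mul_le _ _ _)).trans ?_
    rw [pr_sup]
    refine sup_le ((pr_mono 0 (mul_le_r le_top _)).trans ih) ?_
    exact (pr_mono 0 (mul_le_l le_top _)).trans le_sup_right

theorem pr_zero_mul_tails_le (P B : Q) :
    pr 0 (⊤ * tails P B) ≤ pr 0 (⊤ * P) ⊔ pr 0 (⊤ * B) := by
  rw [tails, mul_iSup', pr_iSup]
  refine iSup_le fun r => ?_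
  induction r with
  | zero => exact le_sup_left
  | succ r ih =>
    refine (pr_mono 0 (mul_mul_le' _ _ _)).trans ?_
    rw [pr_sup]
    refine sup_le ?_ ((pr_mono 0 (mul_le_l le_top _)).trans ih)
    exact (pr_mono 0 (mul_le_l le_top _)).trans le_sup_right

/-- An element of degree `i` followed by many factors from `Y` and `W` is a combination of generic
elements of degree `j`, followed by many factors from `W` and some generic letters of degree
`±a`. -/
theorem Tower.act₂_le_tails {U Y W y E : Q} {a i j : ZMod n} {n' N' k t₀ κ κ' ℓ u t : ℕ}
    (h : NilPair U Y W a n' N') (hT : Tower k U Y a ℓ E) (hYE : Y ≤ E) (hWE : W ≤ E) (hyE : y ≤ E)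
    (hy : y ≤ comp Q i) (hj : i + κ • a = j) (hj' : i + κ' • (-a) = j) (hκ : 0 < κ) (hκ' : 0 < κ')
    (hℓ : κ + κ' ≤ ℓ + 1) (hn' : 0 < n') (hu : n' * ℓ ≤ u) (ht : t₀ + N' * (2 * ℓ) ≤ t)
    (hk : u + t + κ + κ' + n' + N' + 2 ≤ k) :
    act₂ Y W y u t ≤ tails (act (U ⊓ comp Q j) W t₀) (U ⊓ comp Q a ⊔ U ⊓ comp Q (-a)) := by
  set B := U ⊓ comp Q a ⊔ U ⊓ comp Q (-a)
  have hb : ∀ v v', v < n' → v' < N' → act₂ Y W (⊥ : Q) v v' ≤ U := fun v v' _ _ => by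
    rw [act₂_bot]; exact bot_le
  exact Tower.act₂_act_le h ((mul_le_r le_sup_left _).trans (tails_mul_le _ B))
    ((mul_le_r le_sup_right _).trans (tails_mul_le _ B)) (le_tails _ _) hy hj hj' hk ℓ E 0 0 u t ⊥ ⊥
    hT hYE hWE hyE bot_le bot_le bot_le bot_le (mul_bot' _) (mul_bot' _) hb hb hκ hκ' (by omega)
    hu (by simpa using ht) hn' le_rfl

end Move

end LieTypeLattice

namespace LieTypeLattice

/-! ### Peeling letters off a heavy element multiplied by another element. -/

section Peel

variable {n : ℕ} {Q : Type*} [LieTypeLattice n Q]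

/-- Right multiplication by a list of elements, the head being the outermost factor. -/
def tail (A : Q) : List Q → Q
  | [] => A
  | d :: τ => tail A τ * d

theorem tail_append (A d : Q) (τ : List Q) : tail A (τ ++ [d]) = tail (A * d) τ := by
  induction τ with
  | nil => rfl
  | cons e τ ih => rw [List.cons_append, tail, ih, tail]

/-- Iterated residuals: inequalities such as `NilPair.push` thereby apply underneath a fixed tail.
-/
theorem exists_le_iff_tail_le (y : Q) (τ : List Q) : ∃ Z, ∀ x, x ≤ Z ↔ tail x τ ≤ y := by
  induction τ generalizing y with
  | nil => exact ⟨y, fun x => Iff.rfl⟩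
  | cons d τ ih =>
    obtain ⟨Z, hZ⟩ := ih (rdiv y d)
    exact ⟨Z, fun x => (hZ x).trans le_rdiv⟩

theorem tail_mul_comm_le {x d : Q} {τ : List Q} (h : ∀ e ∈ τ, d * e = ⊥) :
    tail (x * d) τ ≤ tail x τ * d := by
  induction τ with
  | nil => exact le_rfl
  | cons e τ ih =>
    refine (mul_le_l (ih fun e he => h e (by simp [he])) e).trans
      ((mul_mul_le _ _ _).trans (sup_le ?_ le_rfl))
    rw [h e (by simp), mul_bot']; exact bot_le

theorem tail_le_comp {x : Q} {i c : ZMod n} {τ : List Q} (hx : x ≤ comp Q i)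
    (h : ∀ e ∈ τ, e ≤ comp Q c) : tail x τ ≤ comp Q (i + τ.length • c) := by
  induction τ with
  | nil => simpa [tail] using hx
  | cons e τ ih =>
    refine mul_le_comp' (ih fun e he => h e (by simp [he])) (h e (by simp)) ?_
    rw [List.length_cons, succ_nsmul, add_assoc]

theorem tail_le_oneWords {E X x : Q} {i j : ℕ} {τ : List Q} (hx : x ≤ oneWords E X i)
    (h : ∀ e ∈ τ, e ≤ words E j) : tail x τ ≤ oneWords E X (i + τ.length * (j + 1)) := by
  induction τ with
  | nil => simpa [tail] using hx
  | cons e τ ih =>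
    refine mul_le_oneWords (ih fun e he => h e (by simp [he])) (h e (by simp)) ?_
    rw [List.length_cons, Nat.succ_mul]; omega

/-- The letters of a list, multiplied by `l` and by preceding letters, lie in `U`. -/
def PeelOK (U l : Q) : ℕ → Q → List Q → Prop
  | _, _, [] => True
  | i, S, d :: τ => (∀ j ≤ i, act (d * l ⊔ l * d) S j ≤ U) ∧ PeelOK U l (i + 1) (S ⊔ d) τ

theorem PeelOK.append {U l d G : Q} : ∀ {τ : List Q} {i : ℕ} {S : Q}, PeelOK U l i S τ →
    S ≤ G → (∀ e ∈ τ, e ≤ G) → (∀ j ≤ i + τ.length, act (d * l ⊔ l * d) G j ≤ U) →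
    PeelOK U l i S (τ ++ [d])
  | [], i, S, _, hS, _, h => ⟨fun j hj => (act_mono le_rfl hS j).trans (h j hj), trivial⟩
  | e :: τ, i, S, ⟨h1, h2⟩, hS, hτ, h =>
    ⟨h1, h2.append (sup_le hS (hτ e (by simp))) (fun e he => hτ e (by simp [he]))
      fun j hj => h j (by rw [List.length_cons]; omega)⟩

variable {U V W D l : Q} {c : ℕ}

/-- Each factor from `D` costs at most `c` letters `W`. -/
theorem act_le_heavy (hD : ∀ t, act V W (t + c) * D ≤ act V W t) {S x : Q} (hS : S ≤ D) (i s : ℕ)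
    (hx : x ≤ act V W (s + c * i)) : act x S i ≤ act V W s := by
  induction i generalizing s with
  | zero => simpa using hx
  | succ i ih =>
    refine (mul_le (ih (s + c) ?_) hS).trans (hD s)
    rw [Nat.mul_succ] at hx
    rwa [add_assoc, add_comm c]

theorem tail_le_heavy (hD : ∀ t, act V W (t + c) * D ≤ act V W t) {A : Q} {τ : List Q}
    (hτ : ∀ d ∈ τ, d ≤ D) (s : ℕ) (hA : A ≤ act V W (s + c * τ.length)) :
    tail A τ ≤ act V W s := by
  induction τ generalizing s with
  | nil => simpa [tail] using hA
  | cons d τ ih =>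
    refine (mul_le (ih (fun e he => hτ e (by simp [he])) (s + c) ?_) (hτ d (by simp))).trans (hD s)
    rw [List.length_cons, Nat.mul_succ] at hA
    rwa [add_assoc, add_comm c]

/-- In `(xd)l ≤ x(dl) + (xl)d`, the first term is a heavy `x` times an element of `U`. The second
has a shorter list, with `d` moved to the outer letters `S`. When the list is empty, `A * l` and `l
* A` vanish. -/
theorem peel (hD : ∀ t, act V W (t + c) * D ≤ act V W t) (hVW : V * W ≤ V) {z : Q} {s : ℕ}
    (hz : act V W s * U ≤ z) (hz' : U * act V W s ≤ z) {A : Q} (hA : A * l = ⊥) (hA' : l * A = ⊥) :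
    ∀ (τ : List Q) (j : ℕ) (S : Q), PeelOK U l j S τ → S ≤ D → (∀ d ∈ τ, d ≤ D) →
      A ≤ act V W (s + c * (τ.length + j)) →
      act (tail A τ * l) S j ≤ z ∧ act (l * tail A τ) S j ≤ z
  | [], j, S, _, _, _, _ => by
    simp [tail, hA, hA']
  | d :: τ, j, S, ⟨h1, h2⟩, hS, hτ, hAV => by
    rw [List.length_cons] at hAV
    have hdD : d ≤ D := hτ d (by simp)
    have hτ' : ∀ d ∈ τ, d ≤ D := fun e he => hτ e (by simp [he])
    have ih := peel hD hVW hz hz' hA hA' τ (j + 1) (S ⊔ d) h2 (sup_le hS hdD) hτ'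
      (hAV.trans_eq (by congr 2; ring))
    have hx : tail A τ ≤ act V W (s + c * (j + 1)) :=
      tail_le_heavy hD hτ' _ (hAV.trans_eq (by congr 1; ring))
    have hxi : ∀ i ≤ j, act (tail A τ) S i ≤ act V W s := fun i hi =>
      act_le_heavy hD hS i s (hx.trans (act_anti hVW (by gcongr; omega)))
    have step : ∀ y : Q, act (y * d) S j ≤ act y (S ⊔ d) (j + 1) := fun y => by
      rw [act_succ']
      exact act_mono (mul_le_r le_sup_right y) le_sup_left j
    constructor
    · refine (act_mono (mul_mul_le _ _ _) le_rfl j).trans ?_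
      rw [act_sup]
      refine sup_le (act_mul_le j _ _ fun i i' hi => ?_) ((step _).trans ih.1)
      refine (mul_le (hxi i (by omega)) ?_).trans hz
      exact (act_mono le_sup_left le_rfl i').trans (h1 i' (by omega))
    · refine (act_mono (mul_mul_le' _ _ _) le_rfl j).trans ?_
      rw [act_sup]
      refine sup_le ((step _).trans ih.2) (act_mul_le j _ _ fun i i' hi => ?_)
      refine (mul_le ?_ (hxi i' (by omega))).trans hz'
      exact (act_mono le_sup_right le_rfl i).trans (h1 i (by omega))

/-- A factor of degree `a` takes fewer than `N + N'` letters `W` on its left: of any number of left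
letters all but `N` become right ones, and `N'` right ones annihilate it. -/
theorem act_heavy {a : ZMod n} {N N' : ℕ} (hW : W ≤ comp Q 0) (hN : act (comp Q 0) W N = ⊥)
    (hN' : act (comp Q a) W N' = ⊥) (hV : V * comp Q a ≤ V) (hV0 : V * comp Q 0 ≤ V) (t : ℕ) :
    act V W (t + (N + N')) * comp Q a ≤ act V W t := by
  have hVW : V * W ≤ V := (mul_le_r hW V).trans hV0
  refine act_mul_right_le _ _ _ fun i j hij => ?_
  rcases lt_or_ge j (N + N') with h | h
  · refine le_trans (act_mono ((mul_le_r ?_ _).trans hV) le_rfl i) (act_anti hVW (by omega))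
    clear h hij
    induction j with
    | zero => exact le_rfl
    | succ j ih => exact (mul_le hW ih).trans (comp_zero_mul_comp a)
  · have : lact W (comp Q a) j = ⊥ := by
      rw [← le_bot_iff]
      refine (lact_le_twoSided _ _ j).trans ((twoSided_le hW hN (comp_zero_mul_comp a)
        (comp_mul_comp_zero a) j).trans (act_eq_bot_of_le hN' (by omega)).le)
    rw [this, mul_bot', act_bot]; exact bot_le

end Peel

/-! ### Products of a heavy element with an arbitrary one become products with generic elements. -/

section LongTower

variable {n : ℕ} {Q : Type*} [LieTypeLattice n Q]

/-- The setting for expanding `(m * Y ⋯ Y * W ⋯ W) * l`. -/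
structure PeelSetting (U Y W V l z : Q) (a b : ZMod n) (n' N' c s : ℕ) : Prop where
  nil : NilPair U Y W a n' N'
  pos : 0 < n'
  le : N' ≤ c
  hl : l ≤ comp Q (-b)
  heavy : ∀ t, act V W (t + c) * (comp Q a ⊔ comp Q (-a)) ≤ act V W t
  hV : V * (comp Q a ⊔ comp Q (-a)) ≤ V
  hV0 : V * comp Q 0 ≤ V
  hz : act V W s * U ≤ z
  hz' : U * act V W s ≤ z

theorem PeelSetting.neg {U Y W V l z : Q} {a b : ZMod n} {n' N' c s : ℕ}
    (h : PeelSetting U Y W V l z a b n' N' c s) :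
    PeelSetting U Y W V l z (-a) b n' N' c s :=
  ⟨h.nil.neg, h.pos, h.le, h.hl, by rw [neg_neg, sup_comm]; exact h.heavy,
    by rw [neg_neg, sup_comm]; exact h.hV, h.hV0, h.hz, h.hz'⟩

/-- The state of the expansion: a prefix `A` with `r` letters of degree `a`, and a list of `r`
letters of degree `-a`. -/
structure PeelState (U V l : Q) (a b : ZMod n) (κ r : ℕ) (E A : Q) (τ : List Q) : Prop where
  hlE : l ≤ E
  hA : A ≤ words E r
  hAd : A ≤ comp Q (b + r • a)
  hAV : A ≤ V
  len : τ.length = r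
  hτ : ∀ d ∈ τ, d ≤ words E κ ∧ d ≤ comp Q (-a)
  ok : PeelOK U l 0 ⊥ τ

/-- `P` extends the prefix, while `M`, with the few `Y`, `W` it takes, becomes the new innermost
letter of the list. If `(r + 1) • a = 0`, the prefix is generic of degree `b` and annihilates `l`,
so the list can be peeled off; otherwise the expansion continues. -/
theorem PeelSetting.plus {U Y W V l z : Q} {a b : ZMod n} {n' N' c s k : ℕ}
    (h : PeelSetting U Y W V l z a b n' N' c s) {r u t T : ℕ} {E A P M : Q} {τ : List Q}
    (hs : PeelState U V l a b (n' + N') r E A τ) (hYE : Y ≤ E) (hWE : W ≤ E)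
    (hP : P ≤ comp Q a) (hM : M ≤ comp Q (-a)) (hPM : oneWords E (P ⊔ M) k ≤ U)
    (hk : (r + 2) * (n' + N' + 1) + T + r + 4 ≤ k) (hut : u + t ≤ T)
    (ht : s + c * (r + 1) + N' ≤ t)
    (next : (r + 1) • a ≠ 0 → ∀ v v' τ', v ≤ u → v' ≤ t → v < n' → v' < N' →
      PeelState U V l a b (n' + N') (r + 1) (E ⊔ P ⊔ M) (A * P) τ' →
      tail (act₂ Y W (A * P) (u - v) (t - v')) τ' * l ≤ z ∧
      l * tail (act₂ Y W (A * P) (u - v) (t - v')) τ' ≤ z) :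
    tail (act₂ Y W (A * P * M) u t) τ * l ≤ z ∧ l * tail (act₂ Y W (A * P * M) u t) τ ≤ z := by
  have hPX : P ≤ oneWords E (P ⊔ M) 0 := le_sup_left
  have hMX : M ≤ oneWords E (P ⊔ M) 0 := le_sup_right
  have hEE : E ≤ E ⊔ P ⊔ M := le_sup_left.trans le_sup_left
  have hlW : l ≤ words E 0 := hs.hlE
  obtain ⟨Z, hZ⟩ := exists_le_iff_tail_le (rdiv z l ⊓ ldiv l z) τ
  have hZ' : ∀ x, x ≤ Z ↔ tail x τ * l ≤ z ∧ l * tail x τ ≤ z := fun x => by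
    rw [hZ, le_inf_iff, le_rdiv, le_ldiv]
  rw [← hZ']
  refine h.nil.neg.push hM fun v v' hv hv' h1 h2 => ?_
  rw [hZ', ← tail_append]
  set d := act₂ Y W M v v' with hd
  have hdX : d ≤ oneWords E (P ⊔ M) (n' + N') := act₂_le_oneWords hMX hYE hWE (by omega)
  have hdd : d ≤ comp Q (-a) := act₂_le_comp hM h.nil.leY h.nil.leW v v'
  have hr : r * (n' + N' + 1) ≤ (r + 2) * (n' + N' + 1) := by gcongr; omega
  have hr2 : (r + 2) * (n' + N' + 1) = r * (n' + N' + 1) + 2 * (n' + N' + 1) := by ring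
  have hok : PeelOK U l 0 ⊥ (τ ++ [d]) := by
    refine hs.ok.append (G := words E (n' + N')) bot_le (fun e he => (hs.hτ e he).1)
      fun j hj => ?_
    refine (act_le_oneWords (k := k) (i := n' + N' + 1) (sup_le
      (mul_le_oneWords hdX hlW (by omega)) (mul_le_oneWords' hdX hlW (by omega))) le_rfl
      ?_).trans hPM
    have : j * (n' + N' + 1) ≤ r * (n' + N' + 1) := by
      gcongr; rw [hs.len] at hj; omega
    omega
  have hτ' : ∀ e ∈ τ ++ [d], e ≤ words (E ⊔ P ⊔ M) (n' + N') ∧ e ≤ comp Q (-a) := by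
    intro e he
    rw [List.mem_append, List.mem_singleton] at he
    rcases he with he | rfl
    · exact ⟨(hs.hτ e he).1.trans (words_mono hEE le_rfl), (hs.hτ e he).2⟩
    · exact ⟨act₂_le_words (i := 0) le_sup_right (hYE.trans hEE) (hWE.trans hEE) (by omega), hdd⟩
  have hAPV : A * P ≤ V := (mul_le hs.hAV (hP.trans le_sup_left)).trans h.hV
  have hAPd : A * P ≤ comp Q (b + (r + 1) • a) :=
    mul_le_comp' hs.hAd hP (by rw [succ_nsmul, add_assoc])
  by_cases hr0 : (r + 1) • a = 0
  · have hxX : act₂ Y W (A * P) (u - v) (t - v') ≤ oneWords E (P ⊔ M) (r + 1 + T) :=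
      act₂_le_oneWords (i := r + 1) (mul_le_oneWords' hPX hs.hA (by omega)) hYE hWE (by omega)
    have hxd : act₂ Y W (A * P) (u - v) (t - v') ≤ comp Q b := by
      refine act₂_le_comp (hAPd.trans_eq ?_) h.nil.leY h.nil.leW _ _
      rw [hr0, add_zero]
    have h3 := peel (D := comp Q a ⊔ comp Q (-a)) (U := U) (l := l) h.heavy
      ((mul_le_r h.nil.leW V).trans h.hV0) h.hz h.hz'
      (A := act₂ Y W (A * P) (u - v) (t - v')) ?_ ?_ (τ ++ [d]) 0 ⊥ hok bot_le
      (fun e he => (hτ' e he).2.trans le_sup_right) ?_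
    · exact h3
    · exact eq_bot_of_le_oneWords h.nil.pr_zero hPM (mul_le_oneWords hxX hlW le_rfl) (by omega)
        (mul_le_comp' hxd h.hl (by abel))
    · exact eq_bot_of_le_oneWords h.nil.pr_zero hPM (mul_le_oneWords' hxX hlW le_rfl) (by omega)
        (mul_le_comp' h.hl hxd (by abel))
    · rw [List.length_append, hs.len, List.length_singleton, add_zero]
      have hVW : V * W ≤ V := (mul_le_r h.nil.leW V).trans h.hV0
      have hVY : V * Y ≤ V := (mul_le_r h.nil.leY V).trans h.hV0
      exact (act_mono ((act_mono hAPV le_rfl _).trans (act_le_self hVY _)) le_rfl _).trans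
        (act_anti hVW (by omega))
  · refine next hr0 v v' (τ ++ [d]) hv hv' h1 h2 ⟨hs.hlE.trans hEE, ?_, hAPd, hAPV, ?_, hτ', hok⟩
    · exact mul_le_words (j := 0) (hs.hA.trans (words_mono hEE le_rfl))
        (le_sup_right.trans le_sup_left) (by omega)
    · rw [List.length_append, hs.len, List.length_singleton]

/-- Here no recursion is needed. The letter `d` coming from `P` annihilates every letter of the
list, so it moves to the outside. Then `A * M` followed by all but the outermost letter of the list
is a generic word of degree `b`, which annihilates `l`, and only two letters remain to be peeled. -/
theorem PeelSetting.minus {U Y W V l z : Q} {a b : ZMod n} {n' N' c s k : ℕ}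
    (h : PeelSetting U Y W V l z a b n' N' c s) {r u t T : ℕ} {E A P M : Q} {τ : List Q}
    (hs : PeelState U V l a b (n' + N') r E A τ) (hr0 : 0 < r) (hYE : Y ≤ E) (hWE : W ≤ E)
    (hP : P ≤ comp Q a) (hM : M ≤ comp Q (-a)) (hPM : oneWords E (P ⊔ M) k ≤ U)
    (hk : (r + 2) * (n' + N' + 1) + T + r + 4 ≤ k) (hut : u + t ≤ T)
    (ht : s + c * (r + 1) + N' ≤ t) :
    tail (act₂ Y W (A * M * P) u t) τ * l ≤ z ∧ l * tail (act₂ Y W (A * M * P) u t) τ ≤ z := by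
  have hPX : P ≤ oneWords E (P ⊔ M) 0 := le_sup_left
  have hMX : M ≤ oneWords E (P ⊔ M) 0 := le_sup_right
  have hlW : l ≤ words E 0 := hs.hlE
  have hVW : V * W ≤ V := (mul_le_r h.nil.leW V).trans h.hV0
  have hVY : V * Y ≤ V := (mul_le_r h.nil.leY V).trans h.hV0
  obtain ⟨Z, hZ⟩ := exists_le_iff_tail_le (rdiv z l ⊓ ldiv l z) τ
  have hZ' : ∀ x, x ≤ Z ↔ tail x τ * l ≤ z ∧ l * tail x τ ≤ z := fun x => by
    rw [hZ, le_inf_iff, le_rdiv, le_ldiv]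
  rw [← hZ']
  refine h.nil.push hP fun v v' hv hv' h1 h2 => ?_
  rw [hZ]
  set d := act₂ Y W P v v' with hd
  set x := act₂ Y W (A * M) (u - v) (t - v') with hx
  have hdX : d ≤ oneWords E (P ⊔ M) (n' + N') := act₂_le_oneWords hPX hYE hWE (by omega)
  have hdd : d ≤ comp Q a := act₂_le_comp hP h.nil.leY h.nil.leW v v'
  have hr2 : (r + 2) * (n' + N' + 1) = r * (n' + N' + 1) + 2 * (n' + N' + 1) := by ring
  have hde : ∀ e ∈ τ, d * e = ⊥ := fun e he => eq_bot_of_le_oneWords h.nil.pr_zero hPM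
    (mul_le_oneWords hdX (hs.hτ e he).1 le_rfl) (by omega)
    (mul_le_comp' hdd (hs.hτ e he).2 (by abel))
  refine (tail_mul_comm_le hde).trans ?_
  have hxX : x ≤ oneWords E (P ⊔ M) (r + 1 + T) :=
    act₂_le_oneWords (i := r + 1) (mul_le_oneWords' hMX hs.hA (by omega)) hYE hWE (by omega)
  have hxd : x ≤ comp Q (b + r • a - a) :=
    act₂_le_comp (mul_le_comp' hs.hAd hM (by abel)) h.nil.leY h.nil.leW _ _
  obtain ⟨d₁, τ', rfl⟩ : ∃ d₁ τ', τ = d₁ :: τ' := by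
    cases τ with
    | nil => have := hs.len; simp at this; omega
    | cons d₁ τ' => exact ⟨d₁, τ', rfl⟩
  have hlen : τ'.length + 1 = r := by rw [← hs.len, List.length_cons]
  have hd₁ := hs.hτ d₁ (by simp)
  have hτ' : ∀ e ∈ τ', e ≤ words E (n' + N') ∧ e ≤ comp Q (-a) := fun e he =>
    hs.hτ e (by simp [he])
  have hBX := tail_le_oneWords hxX (fun e he => (hτ' e he).1)
  have hBd : tail x τ' ≤ comp Q b := by
    refine (tail_le_comp hxd (fun e he => (hτ' e he).2)).trans_eq ?_
    rw [← hlen, smul_neg, succ_nsmul]; congr 1; abel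
  have hlen' : τ'.length * (n' + N' + 1) ≤ r * (n' + N' + 1) := by gcongr; omega
  have hAMV : A * M ≤ V := (mul_le hs.hAV (hM.trans le_sup_right)).trans h.hV
  have h3 := peel (D := comp Q a ⊔ comp Q (-a)) (U := U) (l := l) h.heavy hVW h.hz h.hz'
    (A := tail x τ') ?_ ?_ [d, d₁] 0 ⊥ ?_ bot_le ?_ ?_
  · rw [le_inf_iff, le_rdiv, le_ldiv]; exact h3
  · exact eq_bot_of_le_oneWords h.nil.pr_zero hPM (mul_le_oneWords hBX hlW le_rfl) (by omega)
      (mul_le_comp' hBd h.hl (by abel))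
  · exact eq_bot_of_le_oneWords h.nil.pr_zero hPM (mul_le_oneWords' hBX hlW le_rfl) (by omega)
      (mul_le_comp' h.hl hBd (by abel))
  · have hdl : d * l ⊔ l * d ≤ U := by
      refine (sup_le (mul_le_oneWords (k := k) hdX hlW (by omega))
        (mul_le_oneWords' (k := k) hdX hlW (by omega))).trans hPM
    refine ⟨fun j hj => ?_, fun j hj => ?_, trivial⟩
    · obtain rfl : j = 0 := by omega
      exact hdl
    · rcases j with _ | j
      · exact hs.ok.1 0 le_rfl
      · obtain rfl : j = 0 := by omega
        rw [bot_sup_eq]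
        refine (mul_le_oneWords' (k := k) hdX (sup_le (mul_le_words hd₁.1 hlW le_rfl)
          (mul_le_words hlW hd₁.1 (k := n' + N' + 0 + 1) (by omega))) (by omega)).trans hPM
  · intro e he
    simp only [List.mem_cons, List.not_mem_nil, or_false] at he
    rcases he with rfl | rfl
    · exact hdd.trans le_sup_left
    · exact hd₁.2.trans le_sup_right
  · refine tail_le_heavy h.heavy (fun e he => (hτ' e he).2.trans le_sup_right) _ ?_
    refine (act_mono ((act_mono hAMV le_rfl _).trans (act_le_self hVY _)) le_rfl _).trans
      (act_anti hVW ?_)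
    have : c * (r + 1) = c * τ'.length + c * 2 := by rw [← hlen]; ring
    simp only [List.length_cons, List.length_nil]
    omega

/-- Only the `P * M` branch recurses, and `(r + ℓ) • a = 0` makes it close up no later than the last
level of the tower. -/
theorem PeelSetting.tail_le {U Y W V l z : Q} {a b : ZMod n} {n' N' c s k : ℕ}
    (h : PeelSetting U Y W V l z a b n' N' c s) {T : ℕ} : ∀ (ℓ r u t : ℕ) (E A : Q) (τ : List Q),
    PeelState U V l a b (n' + N') r E A τ → Tower k U Y a ℓ E → Y ≤ E → W ≤ E → 0 < r → 0 < ℓ →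
    (r + ℓ) • a = 0 → n' * ℓ ≤ u → s + c * (r + ℓ) + N' * ℓ ≤ t → u + t ≤ T →
    (r + ℓ + 2) * (n' + N' + 1) + T + r + ℓ + 4 ≤ k →
    tail (act₂ Y W A u t) τ * l ≤ z ∧ l * tail (act₂ Y W A u t) τ ≤ z := by
  intro ℓ
  induction ℓ with
  | zero => intros; omega
  | succ ℓ ih =>
    rintro r u t E A τ hs ⟨P, M, hP, hM, hY, hPM, hT⟩ hYE hWE hr - hra hu ht hut hk
    rw [Nat.mul_succ] at hu
    have hpos := h.pos
    obtain ⟨u, rfl⟩ : ∃ u', u = u' + 1 := ⟨u - 1, by omega⟩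
    obtain ⟨Z, hZ⟩ := exists_le_iff_tail_le (rdiv z l ⊓ ldiv l z) τ
    have hZ' : ∀ x, x ≤ Z ↔ tail x τ * l ≤ z ∧ l * tail x τ ≤ z := fun x => by
      rw [hZ, le_inf_iff, le_rdiv, le_ldiv]
    rw [← hZ']
    have e1 : act₂ Y W A (u + 1) t = act₂ Y W (A * Y) u t := by rw [act₂, act_succ']; rfl
    rw [e1]
    refine (act₂_mono (mul_le_of_le_sup hY) u t).trans ?_
    rw [act₂_sup]
    have hc1 : c * (r + (ℓ + 1)) = c * (r + 1) + c * ℓ := by ring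
    have hc2 : N' * (ℓ + 1) = N' * ℓ + N' := by ring
    have hk' : (r + 2) * (n' + N' + 1) ≤ (r + (ℓ + 1) + 2) * (n' + N' + 1) := by gcongr; omega
    have hEE : E ≤ E ⊔ P ⊔ M := le_sup_left.trans le_sup_left
    refine sup_le ((hZ' _).2 ?_) ((hZ' _).2 ?_)
    · refine h.plus (T := T) hs hYE hWE hP hM hPM (by omega) (by omega) (by omega)
        fun hne v v' τ' hv hv' h1 h2 hs' => ?_
      have hℓ : 0 < ℓ := by
        rcases Nat.eq_zero_or_pos ℓ with rfl | h
        · exact absurd hra hne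
        · exact h
      refine ih (r + 1) _ _ _ _ τ' hs' hT (hYE.trans hEE) (hWE.trans hEE) (by omega) hℓ ?_
        (by omega) ?_ (by omega) ?_
      · rw [← hra]; congr 1; omega
      · have : c * (r + 1 + ℓ) = c * (r + (ℓ + 1)) := by ring
        omega
      · rw [show r + 1 + ℓ = r + (ℓ + 1) by omega]; omega
    · exact h.minus (T := T) hs hr hYE hWE hP hM hPM (by omega) (by omega) (by omega)

/-- The products of `m * Y ⋯ Y * W ⋯ W` with `l` are products of a heavy element with a generic
element. -/
theorem PeelSetting.act₂_mul_le {U Y W V l z m E : Q} {a b : ZMod n} {n' N' c s k ℓ u t : ℕ}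
    (h : PeelSetting U Y W V l z a b n' N' c s) (hT : Tower k U Y a (ℓ + 1) E) (hYE : Y ≤ E)
    (hWE : W ≤ E) (hmE : m ≤ E) (hlE : l ≤ E) (hm : m ≤ comp Q b) (hmV : m ≤ V) (hℓ : 0 < ℓ)
    (ha : (ℓ + 1) • a = 0) (hu : n' * (ℓ + 1) ≤ u) (ht : s + c * (ℓ + 1) + N' * (ℓ + 1) ≤ t)
    (hk : (ℓ + 3) * (n' + N' + 1) + (u + t) + ℓ + 5 ≤ k) :
    act₂ Y W m u t * l ≤ z ∧ l * act₂ Y W m u t ≤ z := by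
  obtain ⟨P, M, hP, hM, hY, hPM, hT⟩ := hT
  rw [Nat.mul_succ] at hu
  have hpos := h.pos
  obtain ⟨u, rfl⟩ : ∃ u', u = u' + 1 := ⟨u - 1, by omega⟩
  have hZ' : ∀ x, x ≤ rdiv z l ⊓ ldiv l z ↔ tail x [] * l ≤ z ∧ l * tail x [] ≤ z := fun x => by
    rw [le_inf_iff, le_rdiv, le_ldiv]; rfl
  refine (hZ' (act₂ Y W m (u + 1) t)).1 ?_
  have e1 : act₂ Y W m (u + 1) t = act₂ Y W (m * Y) u t := by rw [act₂, act_succ']; rfl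
  refine (e1.le.trans (act₂_mono (mul_le_of_le_sup hY) u t)).trans ?_
  rw [act₂_sup]
  have hc1 : c * (ℓ + 1) = c * (0 + 1) + c * ℓ := by ring
  have hc2 : N' * (ℓ + 1) = N' * ℓ + N' := by ring
  have hk' : (0 + 2) * (n' + N' + 1) ≤ (ℓ + 3) * (n' + N' + 1) := by gcongr; omega
  have hEE : E ≤ E ⊔ P ⊔ M := le_sup_left.trans le_sup_left
  have hs : ∀ a', PeelState U V l a' b (n' + N') 0 E m [] := fun a' =>
    ⟨hlE, hmE, by simpa using hm, hmV, rfl, by simp, trivial⟩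
  have hP' : P ≤ comp Q (- -a) := by rwa [neg_neg]
  have hk2 : (0 + 1 + ℓ + 2) * (n' + N' + 1) = (ℓ + 3) * (n' + N' + 1) := by ring
  have hc3 : c * (0 + 1 + ℓ) = c * (ℓ + 1) := by ring
  refine sup_le ((hZ' _).2 ?_) ((hZ' _).2 ?_)
  · refine h.plus (T := u + 1 + t) (hs a) hYE hWE hP hM hPM (by omega) (by omega) (by omega)
      fun hne v v' τ' hv hv' h1 h2 hs' => ?_
    refine h.tail_le (T := u + 1 + t) ℓ (0 + 1) _ _ _ _ τ' hs' hT (hYE.trans hEE) (hWE.trans hEE)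
      (by omega) hℓ ?_ (by omega) (by omega) (by omega) (by omega)
    rw [← ha]; congr 1; omega
  · refine h.neg.plus (T := u + 1 + t) (hs (-a)) hYE hWE hM hP' (by rwa [sup_comm]) (by omega)
      (by omega) (by omega) fun hne v v' τ' hv hv' h1 h2 hs' => ?_
    refine h.neg.tail_le (T := u + 1 + t) ℓ (0 + 1) _ _ _ _ τ' hs'
      (by rw [sup_right_comm]; exact hT.neg) (hYE.trans (by rw [sup_right_comm]; exact hEE))
      (hWE.trans (by rw [sup_right_comm]; exact hEE))
      (by omega) hℓ ?_ (by omega) (by omega) (by omega) (by omega)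
    rw [smul_neg, neg_eq_zero, ← ha]; congr 1; omega

end LongTower

end LieTypeLattice

/-! ### Generic elements, thin right ideals and stabilization. -/

namespace LieTypeLattice

/-- A Lie type lattice with principal elements (spans of homogeneous elements), a notion of
elements of bounded codimension, and a zero component of length at most `m`. -/
class GenericLattice (n : outParam ℕ) (m : outParam ℕ) (Q : Type*) extends
    LieTypeLattice n Q where
  IsPrin : Q → Prop
  exists_le_comp : ∀ {p}, IsPrin p → ∃ i, p ≤ comp Q i
  prin_mul : ∀ {p q}, IsPrin p → IsPrin q → IsPrin (p * q)
  le_sSup_prin : ∀ x, x ≤ sSup {p | IsPrin p ∧ p ≤ x}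
  Cof : ℕ → Q → Prop
  cof_top : Cof 0 ⊤
  cof_mono : ∀ {g h U V}, Cof g U → g ≤ h → U ≤ V → Cof h V
  cof_inf : ∀ {g h U V}, Cof g U → Cof h V → Cof (g + h) (U ⊓ V)
  cof_rdiv : ∀ {g U p}, Cof g U → IsPrin p → Cof g (rdiv U p)
  cof_ldiv : ∀ {g U p}, Cof g U → IsPrin p → Cof g (ldiv p U)
  exists_cof_pr_zero : ∃ U, Cof m U ∧ pr 0 U = ⊥
  exists_compl : ∀ {g U}, Cof g U →
    ∃ s : Finset Q, s.card ≤ n * g ∧ (∀ p ∈ s, IsPrin p) ∧ U ⊔ s.sup id = ⊤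
  rk : Q → ℕ
  rk_le : ∀ x, rk x ≤ m
  rk_lt : ∀ {x y}, x < y → y ≤ comp Q 0 → rk x < rk y

open GenericLattice

section Generic

variable {n m : ℕ} {Q : Type*} [GenericLattice n m Q]

/-- `E` is generated by at most `e` principal elements. -/
def FG (e : ℕ) (E : Q) : Prop := ∃ s : Finset Q, s.card ≤ e ∧ (∀ p ∈ s, IsPrin p) ∧ E = s.sup id

theorem FG.of_isPrin {p : Q} (h : IsPrin p) : FG 1 p := ⟨{p}, by simp, by simpa using h, by simp⟩

theorem FG.sup {e f : ℕ} {E E' : Q} (h : FG e E) (h' : FG f E') : FG (e + f) (E ⊔ E') := by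
  classical
  obtain ⟨s, hs, hp, rfl⟩ := h
  obtain ⟨t, ht, hp', rfl⟩ := h'
  refine ⟨s ∪ t, (Finset.card_union_le s t).trans (by omega), fun p hp₁ => ?_, by
    rw [Finset.sup_union]⟩
  rcases Finset.mem_union.1 hp₁ with h | h
  · exact hp p h
  · exact hp' p h

theorem finset_sup_mul (s : Finset Q) (x : Q) : s.sup id * x = s.sup fun p => p * x := by
  classical
  induction s using Finset.induction_on with
  | empty => simp
  | insert a s ha ih => rw [Finset.sup_insert, Finset.sup_insert, sup_mul', ih, id]

theorem mul_finset_sup (s : Finset Q) (x : Q) : x * s.sup id = s.sup fun p => x * p := by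
  classical
  induction s using Finset.induction_on with
  | empty => simp
  | insert a s ha ih => rw [Finset.sup_insert, Finset.sup_insert, mul_sup', ih, id]

theorem FG.mul {e f : ℕ} {E E' : Q} (h : FG e E) (h' : FG f E') : FG (e * f) (E * E') := by
  classical
  obtain ⟨s, hs, hp, rfl⟩ := h
  obtain ⟨t, ht, hp', rfl⟩ := h'
  refine ⟨Finset.image₂ (· * ·) s t, ?_, ?_, ?_⟩
  · exact (Finset.card_image₂_le _ s t).trans (Nat.mul_le_mul hs ht)
  · intro p hp₁
    obtain ⟨a, ha, b, hb, rfl⟩ := Finset.mem_image₂.1 hp₁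
    exact prin_mul (hp a ha) (hp' b hb)
  · rw [finset_sup_mul]
    apply le_antisymm
    · refine Finset.sup_le fun p hp₁ => ?_
      rw [mul_finset_sup]
      exact Finset.sup_le fun q hq => Finset.le_sup (f := id) (Finset.mem_image₂_of_mem hp₁ hq)
    · refine Finset.sup_le fun r hr => ?_
      obtain ⟨a, ha, b, hb, rfl⟩ := Finset.mem_image₂.1 hr
      refine le_trans ?_ (Finset.le_sup (f := fun p => p * t.sup id) ha)
      exact mul_le_r (Finset.le_sup (f := id) hb) a

/-- The number of generators of `words E k`. -/
def wordsCard (e : ℕ) : ℕ → ℕ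
  | 0 => e
  | k + 1 => wordsCard e k + wordsCard e k * wordsCard e k

theorem FG.words {e : ℕ} {E : Q} (h : FG e E) (k : ℕ) : FG (wordsCard e k) (words E k) := by
  induction k with
  | zero => exact h
  | succ k ih => exact ih.sup (ih.mul ih)

theorem Cof.rdiv_fg {g e : ℕ} {U E : Q} (hU : Cof g U) (hE : FG e E) :
    Cof (e * g) (rdiv U E) := by
  classical
  obtain ⟨s, hs, hp, rfl⟩ := hE
  refine cof_mono (g := s.card * g) (U := rdiv U (s.sup id)) ?_ (Nat.mul_le_mul hs le_rfl) le_rfl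
  clear hs
  induction s using Finset.induction_on with
  | empty =>
    refine cof_mono cof_top (Nat.zero_le _) (le_rdiv.2 ?_)
    simp
  | insert a s ha ih =>
    rw [Finset.card_insert_of_notMem ha, Nat.succ_mul]
    refine cof_mono (cof_inf (ih fun p h => hp p (by simp [h])) (cof_rdiv hU (hp a (by simp))))
      le_rfl (le_rdiv.2 ?_)
    rw [Finset.sup_insert, mul_sup']
    exact sup_le (le_rdiv.1 inf_le_right) (le_rdiv.1 inf_le_left)

theorem Cof.ldiv_fg {g e : ℕ} {U E : Q} (hU : Cof g U) (hE : FG e E) :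
    Cof (e * g) (ldiv E U) := by
  classical
  obtain ⟨s, hs, hp, rfl⟩ := hE
  refine cof_mono (g := s.card * g) (U := ldiv (s.sup id) U) ?_ (Nat.mul_le_mul hs le_rfl) le_rfl
  clear hs
  induction s using Finset.induction_on with
  | empty =>
    refine cof_mono cof_top (Nat.zero_le _) (le_ldiv.2 ?_)
    simp
  | insert a s ha ih =>
    rw [Finset.card_insert_of_notMem ha, Nat.succ_mul]
    refine cof_mono (cof_inf (ih fun p h => hp p (by simp [h])) (cof_ldiv hU (hp a (by simp))))
      le_rfl (le_ldiv.2 ?_)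
    rw [Finset.sup_insert, sup_mul']
    exact sup_le (le_ldiv.1 inf_le_right) (le_ldiv.1 inf_le_left)

/-- The codimension needed in `exists_generic`. -/
def genBound (e : ℕ) : ℕ → ℕ → ℕ
  | 0, g => g
  | k + 1, g => genBound e k (g + wordsCard e k * g + wordsCard e k * g)

theorem genBound_mono {e k g h : ℕ} (hgh : g ≤ h) : genBound e k g ≤ genBound e k h := by
  induction k generalizing g h with
  | zero => exact hgh
  | succ k ih => exact ih (by gcongr)

theorem oneWords_mono_right (E : Q) {X X' : Q} (h : X ≤ X') (k : ℕ) :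
    oneWords E X k ≤ oneWords E X' k := by
  induction k with
  | zero => exact h
  | succ k ih => exact sup_le_sup (sup_le_sup ih (mul_le_l ih _)) (mul_le_r ih _)

/-- Intersect with residuals: multiplication by each of finitely many generators pulls a subspace of
bounded codimension back to another one. -/
theorem exists_generic {e g : ℕ} {E U : Q} (hE : FG e E) (hU : Cof g U) (k : ℕ) :
    ∃ U', Cof (genBound e k g) U' ∧ oneWords E U' k ≤ U := by
  induction k generalizing g U with
  | zero => exact ⟨U, hU, le_rfl⟩
  | succ k ih =>
    obtain ⟨U', hU', h⟩ := ih (cof_inf (cof_inf hU (Cof.rdiv_fg hU (hE.words k)))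
      (Cof.ldiv_fg hU (hE.words k)))
    refine ⟨U', hU', sup_le (sup_le ?_ ?_) ?_⟩
    · exact h.trans (inf_le_left.trans inf_le_left)
    · exact le_rdiv.1 (h.trans (inf_le_left.trans inf_le_right))
    · exact le_ldiv.1 (h.trans inf_le_right)

theorem le_oneWords (E X : Q) (k : ℕ) : X ≤ oneWords E X k :=
  oneWords_mono E X (Nat.zero_le k)

/-- Compactness of elements of the zero component. -/
theorem exists_finset_sup {y : Q} {S : Set Q} (hS : ∀ x ∈ S, x ≤ comp Q 0) (hy : y ≤ sSup S) :
    ∃ s : Finset Q, s.card ≤ m ∧ ↑s ⊆ S ∧ y ≤ s.sup id := by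
  classical
  by_contra hcon
  push Not at hcon
  have key : ∀ k ≤ m + 1, ∃ s : Finset Q, s.card ≤ k ∧ ↑s ⊆ S ∧ k ≤ rk (s.sup id) := by
    intro k hk
    induction k with
    | zero => exact ⟨∅, by simp, by simp, Nat.zero_le _⟩
    | succ k ih =>
      obtain ⟨s, hs, hsS, hr⟩ := ih (by omega)
      have hny := hcon s (by omega) hsS
      obtain ⟨x, hx, hxs⟩ : ∃ x ∈ S, ¬ x ≤ s.sup id := by
        by_contra h
        push Not at h
        exact hny (hy.trans (sSup_le h))
      refine ⟨insert x s, (Finset.card_insert_le x s).trans (by omega), ?_, ?_⟩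
      · rw [Finset.coe_insert]; exact Set.insert_subset hx hsS
      · refine lt_of_le_of_lt hr (rk_lt ?_ ?_)
        · rw [Finset.sup_insert]
          exact lt_of_le_of_ne le_sup_right fun h => hxs (by rw [h]; exact le_sup_left)
        · refine Finset.sup_le fun z hz => ?_
          rcases Finset.mem_insert.1 hz with rfl | hz
          · exact hS _ hx
          · exact hS z (hsS hz)
  obtain ⟨s, -, -, h⟩ := key (m + 1) le_rfl
  exact absurd (rk_le (s.sup id)) (by omega)

theorem FG.comp_zero : FG m (comp Q 0) := by
  obtain ⟨s, hs, hsS, h⟩ := exists_finset_sup (Q := Q) (S := {p | IsPrin p ∧ p ≤ comp Q 0})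
    (fun x hx => hx.2) (le_sSup_prin (comp Q 0))
  exact ⟨s, hs, fun p hp => (hsS hp).1, le_antisymm h (Finset.sup_le fun p hp => (hsS hp).2)⟩

theorem mul_le_of_prin {x y z : Q} (h : ∀ p q, IsPrin p → IsPrin q → p ≤ x → q ≤ y → p * q ≤ z) :
    x * y ≤ z := by
  rw [← le_rdiv]
  refine (le_sSup_prin x).trans (sSup_le fun p hp => le_rdiv.2 ?_)
  rw [← le_ldiv]
  exact (le_sSup_prin y).trans (sSup_le fun q hq => le_ldiv.2 (h p q hp.1 hq.1 hp.2 hq.2))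

theorem act₂_le_of_prin {Y W x z : Q} {u t : ℕ}
    (h : ∀ p, IsPrin p → p ≤ x → act₂ Y W p u t ≤ z) : act₂ Y W x u t ≤ z := by
  refine (act₂_mono (le_sSup_prin x) u t).trans ?_
  rw [act₂, sSup_eq_iSup', act_iSup, act_iSup]
  exact iSup_le fun p => h p p.2.1 p.2.2

/-- The zero-degree products of `U` in degrees `c` and `-c`, the first factor being multiplied by
`t` factors from `W`. -/
def zeroProd (W : Q) (t : ℕ) (c : ZMod n) (U : Q) : Q :=
  act (U ⊓ comp Q c) W t * (U ⊓ comp Q (-c)) ⊔ (U ⊓ comp Q (-c)) * act (U ⊓ comp Q c) W t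

theorem zeroProd_mono (W : Q) (t : ℕ) (c : ZMod n) {U V : Q} (h : U ≤ V) :
    zeroProd W t c U ≤ zeroProd W t c V := by
  have h1 : ∀ i, U ⊓ comp Q i ≤ V ⊓ comp Q i := fun i => inf_le_inf_right _ h
  exact sup_le_sup (mul_le (act_mono (h1 c) le_rfl t) (h1 _))
    (mul_le (h1 _) (act_mono (h1 c) le_rfl t))

theorem zeroProd_le_comp {W : Q} (hW : W ≤ comp Q 0) (t : ℕ) (c : ZMod n) (U : Q) :
    zeroProd W t c U ≤ comp Q 0 :=
  sup_le (mul_le_comp' (act_le_comp inf_le_right hW t) inf_le_right (by abel))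
    (mul_le_comp' inf_le_right (act_le_comp inf_le_right hW t) (by abel))

/-- `Y` consists of zero-degree products of elements of degrees `a`, `-a` of every subspace of
codimension at most `γ`. -/
def Thin (γ : ℕ) (a : ZMod n) (Y : Q) : Prop := ∀ U, Cof γ U → Y ≤ zeroProd ⊥ 0 a U

theorem Thin.anti {γ γ' : ℕ} {a : ZMod n} {Y : Q} (h : Thin γ a Y) (hγ : γ' ≤ γ) : Thin γ' a Y :=
  fun U hU => h U (cof_mono hU hγ le_rfl)

/-- The codimension needed for towers. -/
def towerBound (m k g : ℕ) : ℕ → ℕ → ℕ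
  | 0, _ => 0
  | ℓ + 1, e => max (genBound e k g) (towerBound m k g ℓ (e + m + m))

/-- The zero component has length at most `m`, so `m` pairs of principal elements suffice. Keeping
`P` and `M` finitely generated is what lets the next level of a tower be generic over them. -/
theorem exists_fg_of_le_zeroProd {Y U : Q} {a : ZMod n} (h : Y ≤ zeroProd ⊥ 0 a U) :
    ∃ P M, FG m P ∧ FG m M ∧ P ≤ U ⊓ comp Q a ∧ M ≤ U ⊓ comp Q (-a) ∧ Y ≤ P * M ⊔ M * P := by
  classical
  let S : Set Q := {x | ∃ p q, IsPrin p ∧ IsPrin q ∧ p ≤ U ⊓ comp Q a ∧ q ≤ U ⊓ comp Q (-a) ∧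
    x ≤ p * q ⊔ q * p}
  have hS : ∀ x ∈ S, x ≤ comp Q 0 := by
    rintro x ⟨p, q, -, -, hp, hq, hx⟩
    have hp' := hp.trans inf_le_right
    have hq' := hq.trans inf_le_right
    exact hx.trans (sup_le (mul_le_comp' hp' hq' (by abel)) (mul_le_comp' hq' hp' (by abel)))
  have hY : Y ≤ sSup S := by
    refine h.trans (sup_le ?_ ?_)
    · exact mul_le_of_prin fun p q hp hq h1 h2 =>
        le_sSup_of_le ⟨p, q, hp, hq, h1, h2, le_sup_left⟩ le_rfl
    · exact mul_le_of_prin fun q p hq hp h1 h2 =>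
        le_sSup_of_le ⟨p, q, hp, hq, h2, h1, le_sup_right⟩ le_rfl
  obtain ⟨s, hs, hsS, hys⟩ := exists_finset_sup hS hY
  choose p q hp hq h1 h2 h3 using fun x : s => hsS x.2
  have key : ∀ f : s → Q, (∀ x, IsPrin (f x)) → FG m (Finset.univ.sup f) := fun f hf => by
    refine ⟨Finset.univ.image f, Finset.card_image_le.trans (by simpa using hs), ?_, ?_⟩
    · intro p hp
      obtain ⟨x, -, rfl⟩ := Finset.mem_image.1 hp
      exact hf x
    · rw [Finset.sup_image]; rfl
  refine ⟨Finset.univ.sup p, Finset.univ.sup q, key p hp, key q hq, Finset.sup_le fun x _ => h1 x,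
    Finset.sup_le fun x _ => h2 x, hys.trans (Finset.sup_le fun x hx => ?_)⟩
  have hpx : p ⟨x, hx⟩ ≤ Finset.univ.sup p := Finset.le_sup (Finset.mem_univ _)
  have hqx : q ⟨x, hx⟩ ≤ Finset.univ.sup q := Finset.le_sup (Finset.mem_univ _)
  exact (h3 ⟨x, hx⟩).trans (sup_le_sup (mul_le hpx hqx) (mul_le hqx hpx))

theorem Thin.tower {γ g k : ℕ} {a : ZMod n} {Y U : Q} (hY : Thin γ a Y) (hU : Cof g U) :
    ∀ (ℓ e : ℕ) (E : Q), FG e E → towerBound m k g ℓ e ≤ γ → Tower k U Y a ℓ E := by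
  intro ℓ
  induction ℓ with
  | zero => intro e E _ _; trivial
  | succ ℓ ih =>
    intro e E hE hγ
    obtain ⟨U', hU', h⟩ := exists_generic hE hU k
    obtain ⟨P, M, hP, hM, hPU, hMU, hPM⟩ :=
      exists_fg_of_le_zeroProd (hY U' (cof_mono hU' ((le_max_left _ _).trans hγ) le_rfl))
    refine ⟨P, M, hPU.trans inf_le_right, hMU.trans inf_le_right, hPM, ?_,
      ih (e + m + m) _ ((hE.sup hP).sup hM) ((le_max_right _ _).trans hγ)⟩
    exact (oneWords_mono_right E (sup_le (hPU.trans inf_le_left) (hMU.trans inf_le_left)) k).trans h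

/-! ### Stabilization -/

/-- The intersection of `f U` over all `U` of codimension at most `g`. -/
def stable (f : Q → Q) (g : ℕ) : Q := ⨅ U : {U : Q // Cof g U}, f U

theorem stable_le {f : Q → Q} {g : ℕ} {U : Q} (hU : Cof g U) : stable f g ≤ f U :=
  iInf_le (fun U : {U : Q // Cof g U} => f U) ⟨U, hU⟩

theorem stable_anti (f : Q → Q) {g h : ℕ} (hgh : g ≤ h) : stable f h ≤ stable f g :=
  le_iInf fun U => stable_le (cof_mono U.2 hgh le_rfl)

/-- As long as some `V` makes `f` drop, intersect with it; the rank falls each time, so this happens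
at most `m` times. -/
theorem exists_le_stable {f : Q → Q} (hf : Monotone f) (hf0 : ∀ U, f U ≤ comp Q 0) (g : ℕ) :
    ∃ U, Cof (m * g) U ∧ f U ≤ stable f g := by
  by_contra hcon
  push Not at hcon
  have key : ∀ k ≤ m + 1, ∃ U : Q, Cof (k * g) U ∧ rk (f U) + k ≤ m := by
    intro k hk
    induction k with
    | zero => exact ⟨⊤, by rw [zero_mul]; exact cof_top, by simpa using rk_le (f (⊤ : Q))⟩
    | succ k ih =>
      obtain ⟨U, hU, hr⟩ := ih (by omega)
      have h1 := hcon U (cof_mono hU (Nat.mul_le_mul (by omega) le_rfl) le_rfl)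
      obtain ⟨V, hV⟩ : ∃ V : {V : Q // Cof g V}, ¬ f U ≤ f V := by
        by_contra h; push Not at h; exact h1 (le_iInf h)
      refine ⟨U ⊓ V, by rw [Nat.succ_mul]; exact cof_inf hU V.2, ?_⟩
      have : rk (f (U ⊓ V)) < rk (f U) := rk_lt (lt_of_le_of_ne (hf inf_le_left) fun h =>
        hV (h ▸ hf inf_le_right)) (hf0 U)
      omega
  obtain ⟨U, -, h⟩ := key (m + 1) le_rfl
  omega

/-- The descending chain `stable f (ω^[i] g)` in the zero component repeats a value within `m`
steps. At such an `i`, the loss of codimension in `hfω` no longer changes the stable value. -/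
theorem exists_stable_isRightIdeal {f : Q → Q} (hf0 : ∀ U, f U ≤ comp Q 0) {ω : ℕ → ℕ}
    (hω : ∀ g, g ≤ ω g) (hfω : ∀ g U, Cof g U → ∃ U', Cof (ω g) U' ∧ f U' * comp Q 0 ≤ f U)
    (g : ℕ) : ∃ g', g ≤ g' ∧ g' ≤ ω^[m] g ∧ IsRightIdeal (stable f g') := by
  have hle : ∀ i j, i ≤ j → ω^[i] g ≤ ω^[j] g := fun i j hij =>
    monotone_nat_of_le_succ (f := fun i => ω^[i] g)
      (fun i => by rw [Function.iterate_succ_apply']; exact hω _) hij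
  have hs0 : ∀ h, stable f h ≤ comp Q 0 := fun h =>
    (stable_le (cof_mono cof_top (Nat.zero_le h) le_rfl)).trans (hf0 _)
  obtain ⟨i, hi, heq⟩ : ∃ i ≤ m, stable f (ω^[i + 1] g) = stable f (ω^[i] g) := by
    by_contra hcon
    push Not at hcon
    have key : ∀ k ≤ m + 1, rk (stable f (ω^[k] g)) + k ≤ m := by
      intro k hk
      induction k with
      | zero => exact rk_le _
      | succ k ih =>
        have h1 := ih (by omega)
        have := rk_lt (lt_of_le_of_ne (stable_anti f (hle k (k + 1) (by omega)))
          (hcon k (by omega))) (hs0 _)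
        omega
    have := key (m + 1) le_rfl
    omega
  refine ⟨ω^[i] g, hle 0 i (by omega), hle i m hi, hs0 _, ?_⟩
  refine le_iInf fun U => ?_
  obtain ⟨U', hU', h⟩ := hfω _ U.1 U.2
  refine le_trans (mul_le_l ?_ _) h
  rw [← heq, Function.iterate_succ_apply']
  exact stable_le hU'

theorem act_mul_comp_zero_le {P W : Q} (hW : IsRightIdeal W) (t : ℕ) :
    act P W t * comp Q 0 ≤ act (P ⊔ P * comp Q 0) W t := by
  induction t with
  | zero => exact le_sup_right
  | succ t ih =>
    refine (mul_mul_le _ _ _).trans (sup_le ?_ (mul_le_l ih W))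
    exact mul_le (act_mono le_sup_left le_rfl t) hW.mul_le

theorem exists_zeroProd_mul_le {W : Q} (hW : IsRightIdeal W) (t : ℕ) (c : ZMod n) (g : ℕ) (U : Q)
    (hU : Cof g U) :
    ∃ U', Cof (g + m * g) U' ∧ zeroProd W t c U' * comp Q 0 ≤ zeroProd W t c U := by
  refine ⟨U ⊓ rdiv U (comp Q 0), cof_inf hU (Cof.rdiv_fg hU FG.comp_zero), ?_⟩
  set U' := U ⊓ rdiv U (comp Q 0)
  have h1 : ∀ i, U' ⊓ comp Q i ≤ U ⊓ comp Q i := fun i => inf_le_inf_right _ inf_le_left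
  have h2 : ∀ i, (U' ⊓ comp Q i) * comp Q 0 ≤ U ⊓ comp Q i := fun i =>
    le_inf (le_rdiv.1 (inf_le_left.trans inf_le_right))
      ((mul_le_l inf_le_right _).trans (comp_mul_comp_zero i))
  have h3 : act (U' ⊓ comp Q c) W t * comp Q 0 ≤ act (U ⊓ comp Q c) W t :=
    (act_mul_comp_zero_le hW t).trans (act_mono (sup_le (h1 c) (h2 c)) le_rfl t)
  have h4 := act_mono (h1 c) (le_refl W) t
  rw [zeroProd, sup_mul']
  refine sup_le ((mul_mul_le _ _ _).trans (sup_le ?_ ?_)) ((mul_mul_le _ _ _).trans (sup_le ?_ ?_))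
  · exact (mul_le h4 (h2 _)).trans le_sup_left
  · exact (mul_le h3 (h1 _)).trans le_sup_left
  · exact (mul_le (h1 _) h3).trans le_sup_right
  · exact (mul_le (h2 _) h4).trans le_sup_right

/-- The bound for the index of a stable right ideal. -/
def stableBound (m g : ℕ) : ℕ := (fun g => g + m * g)^[m] g

/-- Stable zero-degree products: a right ideal which is covered by the products of a subspace of
bounded codimension. -/
theorem exists_stable_zeroProd {W : Q} (hW : IsRightIdeal W) (t : ℕ) (c : ZMod n) (g : ℕ) :
    ∃ Z U : Q, IsRightIdeal Z ∧ (∀ V, Cof g V → Z ≤ zeroProd W t c V) ∧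
      Cof (m * stableBound m g) U ∧ zeroProd W t c U ≤ Z := by
  obtain ⟨g', h1, h2, h3⟩ := exists_stable_isRightIdeal (f := zeroProd W t c)
    (zeroProd_le_comp hW.le t c) (ω := fun g => g + m * g) (fun g => Nat.le_add_right _ _)
    (exists_zeroProd_mul_le hW t c) g
  obtain ⟨U, hU, h4⟩ := exists_le_stable (f := zeroProd W t c)
    (fun _ _ h => zeroProd_mono W t c h) (zeroProd_le_comp hW.le t c) g'
  exact ⟨_, U, h3, fun V hV => stable_le (cof_mono hV h1 le_rfl),
    cof_mono hU (Nat.mul_le_mul le_rfl h2) le_rfl, h4⟩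

/-- A family version of `exists_stable_zeroProd`, with a common covering subspace. -/
theorem exists_stable_family [NeZero n] {W : Q} (hW : IsRightIdeal W) (t : ℕ) (g : ℕ) :
    ∃ (Z : ZMod n → Q) (U : Q), (∀ c, IsRightIdeal (Z c)) ∧
      (∀ c V, Cof g V → Z c ≤ zeroProd W t c V) ∧
      Cof (n * (m * stableBound m g)) U ∧ ∀ c, zeroProd W t c U ≤ Z c := by
  choose Z U h1 h2 h3 h4 using fun c => exists_stable_zeroProd hW t c g
  have key : ∀ s : Finset (ZMod n), Cof (s.card * (m * stableBound m g)) (s.inf U) := by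
    classical
    intro s
    induction s using Finset.induction_on with
    | empty => simpa using cof_top (Q := Q)
    | insert a s ha ih =>
      rw [Finset.card_insert_of_notMem ha, Finset.inf_insert, Nat.succ_mul, add_comm]
      exact cof_inf (h3 a) ih
  refine ⟨Z, Finset.univ.inf U, h1, h2, ?_, fun c =>
    (zeroProd_mono W t c (Finset.inf_le (Finset.mem_univ c))).trans (h4 c)⟩
  have := key Finset.univ
  rwa [Finset.card_univ, ZMod.card] at this

/-- Take `V` generic over the zero component: heavy elements built from `V` then still lie in `U`,
so their products are ordinary products of elements of `U`. -/
theorem thin_of_le_zeroProd {W Z : Q} (hW : W ≤ comp Q 0) {t g γ : ℕ} {c : ZMod n}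
    (h : ∀ V, Cof g V → Z ≤ zeroProd W t c V) (hg : genBound m t γ ≤ g) : Thin γ c Z := by
  intro U hU
  obtain ⟨V, hV, hVU⟩ := exists_generic (Q := Q) FG.comp_zero hU t
  refine (h V (cof_mono hV hg le_rfl)).trans ?_
  have h1 : V ≤ U := (le_oneWords _ _ t).trans hVU
  have h2 : act (V ⊓ comp Q c) W t ≤ U ⊓ comp Q c := by
    refine le_inf ?_ (act_le_comp inf_le_right hW t)
    refine le_trans ?_ hVU
    refine act_le_oneWords (E := comp Q 0) (i := 0) (j := 0) inf_le_left hW (by omega)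
  have h3 : V ⊓ comp Q (-c) ≤ U ⊓ comp Q (-c) := inf_le_inf_right _ h1
  exact sup_le_sup (mul_le h2 h3) (mul_le h3 h2)

/-- Passing to a subspace of bounded codimension, arbitrary factors may be replaced by factors from
a given subspace of bounded codimension. -/
theorem exists_absorbing (T : ℕ) {g : ℕ} {U : Q} (hU : Cof g U) :
    ∃ U', Cof (g + genBound (n * g + m) (T + 1) m) U' ∧ pr 0 U' = ⊥ ∧ U' ≤ U ∧
      ∀ (W : Q) (t : ℕ) (c : ZMod n), W ≤ comp Q 0 → t ≤ T →
        act (U' ⊓ comp Q c) W t * comp Q (-c) ≤ zeroProd W t c U ∧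
        comp Q (-c) * act (U' ⊓ comp Q c) W t ≤ zeroProd W t c U ∧
        act (comp Q c) W t * (U' ⊓ comp Q (-c)) ≤ zeroProd W t c U ∧
        (U' ⊓ comp Q (-c)) * act (comp Q c) W t ≤ zeroProd W t c U := by
  obtain ⟨s, hs, hp, hsup⟩ := exists_compl hU
  set C := s.sup id with hC
  have hCfg : FG (n * g) C := ⟨s, hs, hp, rfl⟩
  obtain ⟨U₀, hU₀, hU₀0⟩ := exists_cof_pr_zero (Q := Q)
  obtain ⟨V, hV, hVU⟩ := exists_generic (hCfg.sup (FG.comp_zero (Q := Q))) hU₀ (T + 1)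
  have hV0 : V ≤ U₀ := (le_oneWords _ _ _).trans hVU
  refine ⟨U ⊓ V, cof_inf hU hV, ?_, inf_le_left, fun W t c hW ht => ?_⟩
  · rw [← le_bot_iff, ← hU₀0]; exact pr_mono 0 (inf_le_right.trans hV0)
  set E := C ⊔ comp Q 0 with hE
  have hWE : W ≤ E := hW.trans le_sup_right
  -- An arbitrary factor splits into a part in `U` and a part in the finitely generated complement
  -- `C`. The `C`-part forms a degree-zero word with one letter generic over `C` and the zero
  -- component, hence contributes nothing.
  have hdec : ∀ i, comp Q i ≤ U ⊓ comp Q i ⊔ C ⊓ comp Q i := fun i => by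
    have : comp Q i = pr i U ⊔ pr i C := by rw [comp, ← hsup, pr_sup]
    rw [this]
    exact sup_le_sup (le_inf (pr_le _ _) (le_sup_left)) (le_inf (pr_le _ _) le_sup_right)
  have hUV : ∀ i, (U ⊓ V) ⊓ comp Q i ≤ U ⊓ comp Q i := fun i => inf_le_inf_right _ inf_le_left
  have hVX : ∀ i, (U ⊓ V) ⊓ comp Q i ≤ oneWords E V 0 := fun i => inf_le_left.trans inf_le_right
  have hCE : ∀ i, C ⊓ comp Q i ≤ words E 0 := fun i => inf_le_left.trans le_sup_left
  have hVt : act ((U ⊓ V) ⊓ comp Q c) W t ≤ oneWords E V t :=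
    act_le_oneWords (j := 0) (hVX c) hWE (by omega)
  have hVtd : act ((U ⊓ V) ⊓ comp Q c) W t ≤ comp Q c := act_le_comp inf_le_right hW t
  have hCt : act (C ⊓ comp Q c) W t ≤ words E t := act_le_words (hCE c) hWE (by omega)
  have hCtd : act (C ⊓ comp Q c) W t ≤ comp Q c := act_le_comp inf_le_right hW t
  have hmono := act_mono (hUV c) (le_refl W) t
  have hdecc : act (comp Q c) W t ≤ act (U ⊓ comp Q c) W t ⊔ act (C ⊓ comp Q c) W t := by
    rw [← act_sup]; exact act_mono (hdec c) le_rfl t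
  refine ⟨?_, ?_, ?_, ?_⟩
  · refine (mul_le_r (hdec (-c)) _).trans ?_
    rw [mul_sup', eq_bot_of_le_oneWords hU₀0 hVU (mul_le_oneWords hVt (hCE (-c)) le_rfl)
      (by omega) (mul_le_comp' hVtd inf_le_right (by abel)), sup_bot_eq]
    exact (mul_le_l hmono _).trans le_sup_left
  · refine (mul_le_l (hdec (-c)) _).trans ?_
    rw [sup_mul', eq_bot_of_le_oneWords hU₀0 hVU (mul_le_oneWords' hVt (hCE (-c)) le_rfl)
      (by omega) (mul_le_comp' inf_le_right hVtd (by abel)), sup_bot_eq]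
    exact (mul_le_r hmono _).trans le_sup_right
  · refine (mul_le_l hdecc _).trans ?_
    rw [sup_mul', eq_bot_of_le_oneWords hU₀0 hVU (mul_le_oneWords' (hVX (-c)) hCt le_rfl)
      (by omega) (mul_le_comp' hCtd inf_le_right (by abel)), sup_bot_eq]
    exact (mul_le_r (hUV _) _).trans le_sup_left
  · refine (mul_le_r hdecc _).trans ?_
    rw [mul_sup', eq_bot_of_le_oneWords hU₀0 hVU (mul_le_oneWords (hVX (-c)) hCt le_rfl)
      (by omega) (mul_le_comp' inf_le_right hCtd (by abel)), sup_bot_eq]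
    exact (mul_le_l (hUV _) _).trans le_sup_right

end Generic

end LieTypeLattice

/-! ### Arithmetic of cyclic groups. -/

/-- Take `k` to be the product of the primes dividing `n` but not `x`: a prime factor of `n` then
divides exactly one of `x` and `k * y`. -/
theorem Nat.exists_coprime_add_mul {x y n : ℕ} (hn : n ≠ 0) (hxy : x.Coprime y) :
    ∃ k : ℕ, (x + k * y).Coprime n := by
  let ps : Finset ℕ := {p ∈ n.primeFactors | ¬p ∣ x}
  refine ⟨ps.prod id, Nat.coprime_of_dvd fun p pp hp hpn => ?_⟩
  by_cases hpx : p ∣ x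
  · rcases pp.dvd_mul.mp ((Nat.dvd_add_right hpx).1 hp) with h | h
    · have ⟨q, hq, hq'⟩ := (pp.prime.dvd_finsetProd_iff id).mp h
      rw [Finset.mem_filter, Nat.mem_primeFactors,
        ← (Nat.prime_dvd_prime_iff_eq pp hq.1.1).mp hq'] at hq
      exact hq.2 hpx
    · exact Nat.Prime.not_coprime_iff_dvd.mpr ⟨p, pp, hpx, h⟩ hxy
  · have pps : p ∈ ps := Finset.mem_filter.mpr ⟨Nat.mem_primeFactors.mpr ⟨pp, hpn, hn⟩, hpx⟩
    exact hpx ((Nat.dvd_add_left ((Finset.dvd_prod_of_mem id pps).mul_right y)).1 hp)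

/-- Write `H = ⟨a⟩` and let `g` be the gcd of `b` and `a`, with coprime cofactors `b'`, `a'`. Some
`b' + k a'` is a unit modulo `n`, so `b + k a` generates the same subgroup as `g`. -/
theorem ZMod.exists_zmultiples_add_eq_sup {n : ℕ} [NeZero n] (H : AddSubgroup (ZMod n))
    (b : ZMod n) : ∃ h ∈ H, AddSubgroup.zmultiples (b + h) = H ⊔ AddSubgroup.zmultiples b := by
  obtain ⟨⟨a, haH⟩, ha⟩ := (inferInstance : IsAddCyclic H).exists_generator
  have hHa : ∀ x ∈ H, x ∈ AddSubgroup.zmultiples a := fun x hx => by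
    obtain ⟨z, hz⟩ := ha ⟨x, hx⟩
    exact ⟨z, congrArg Subtype.val hz⟩
  rcases Nat.eq_zero_or_pos (Nat.gcd b.val a.val) with h0 | hpos
  · obtain ⟨hb, ha0⟩ := Nat.gcd_eq_zero_iff.1 h0
    rw [ZMod.val_eq_zero] at hb ha0
    subst hb ha0
    refine ⟨0, H.zero_mem, ?_⟩
    have : H = ⊥ := by
      rw [eq_bot_iff]; exact fun x hx => by simpa using hHa x hx
    simp [this]
  · obtain ⟨g, b', a', -, hcop, hb, ha'⟩ := Nat.exists_coprime' hpos
    obtain ⟨k, hk⟩ := Nat.exists_coprime_add_mul (NeZero.ne n) hcop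
    refine ⟨k • a, H.nsmul_mem haH k, le_antisymm ?_ ?_⟩
    · rw [AddSubgroup.zmultiples_le]
      exact add_mem ((le_sup_right : _ ≤ H ⊔ AddSubgroup.zmultiples b)
        (AddSubgroup.mem_zmultiples b))
        ((le_sup_left : H ≤ _) (H.nsmul_mem haH k))
    · have hbc : b = (b' : ZMod n) * g := by
        rw [← ZMod.natCast_zmod_val b, hb, Nat.cast_mul]
      have hac : a = (a' : ZMod n) * g := by
        rw [← ZMod.natCast_zmod_val a, ha', Nat.cast_mul]
      set u := ZMod.unitOfCoprime _ hk with hu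
      have huv : (u : ZMod n) = b' + k * a' := by rw [hu]; simp
      have hsum : b + k • a = (u : ZMod n) * g := by
        rw [huv, hbc, hac, nsmul_eq_mul]; ring
      have hg : (g : ZMod n) ∈ AddSubgroup.zmultiples (b + k • a) := by
        refine ⟨((u⁻¹ : (ZMod n)ˣ) : ZMod n).val, ?_⟩
        change ((((u⁻¹ : (ZMod n)ˣ) : ZMod n).val : ℕ) : ℤ) • (b + k • a) = g
        rw [natCast_zsmul, nsmul_eq_mul, ZMod.natCast_zmod_val, hsum, ← mul_assoc, Units.inv_mul,
          one_mul]
      have hmul : ∀ c : ℕ, (c : ZMod n) * g ∈ AddSubgroup.zmultiples (b + k • a) := fun c => by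
        rw [← nsmul_eq_mul]; exact AddSubgroup.nsmul_mem _ hg c
      have haz : a ∈ AddSubgroup.zmultiples (b + k • a) := hac ▸ hmul a'
      refine sup_le (fun x hx => ?_) ?_
      · exact (AddSubgroup.zmultiples_le.2 haz) (hHa x hx)
      · rw [AddSubgroup.zmultiples_le]
        have := hmul b'
        rwa [← hbc] at this

theorem ZMod.exists_nsmul_of_mem_zmultiples {n : ℕ} [NeZero n] {a i j : ZMod n}
    (h : j - i ∈ AddSubgroup.zmultiples a) :
    ∃ κ κ' : ℕ, 0 < κ ∧ 0 < κ' ∧ κ + κ' = 2 * n ∧ i + κ • a = j ∧ i + κ' • (-a) = j := by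
  obtain ⟨z, hz⟩ := h
  have hz' : (z : ZMod n) * a = j - i := by rw [← hz]; simp
  have hn := Nat.pos_of_ne_zero (NeZero.ne n)
  obtain ⟨κ, h0, hκn, hκ⟩ : ∃ κ : ℕ, 0 < κ ∧ κ ≤ n ∧ (κ : ZMod n) = z := by
    by_cases hv : (z : ZMod n).val = 0
    · exact ⟨n, hn, le_rfl, by rw [ZMod.natCast_self, ((ZMod.val_eq_zero _).1 hv)]⟩
    · exact ⟨(z : ZMod n).val, Nat.pos_of_ne_zero hv, (ZMod.val_lt _).le, by simp⟩
  -- As `0 < κ ≤ n`, both counts are positive, and their sum is always `2 * n`, so the height of the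
  -- towers does not depend on the degrees.
  refine ⟨κ, 2 * n - κ, h0, by omega, by omega, ?_, ?_⟩
  · rw [nsmul_eq_mul, hκ, hz']; abel
  · rw [nsmul_eq_mul, Nat.cast_sub (by omega), Nat.cast_mul, ZMod.natCast_self, mul_zero, zero_sub,
      neg_mul_neg, hκ, hz']
    abel

namespace LieTypeLattice

open GenericLattice

universe u

/-! ### Tame and split right ideals; nilpotency. -/

section Tame

variable {n m : ℕ} {Q : Type*} [GenericLattice n m Q]

theorem zeroProd_top (W : Q) (t : ℕ) (c : ZMod n) : zeroProd W t c ⊤ =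
    act (comp Q c) W t * comp Q (-c) ⊔ comp Q (-c) * act (comp Q c) W t := by
  simp [zeroProd]

theorem zeroProd_top_anti {W : Q} (hW : W ≤ comp Q 0) {s t : ℕ} (h : s ≤ t) (c : ZMod n) :
    zeroProd W t c ⊤ ≤ zeroProd W s c ⊤ := by
  rw [zeroProd_top, zeroProd_top]
  have : act (comp Q c) W t ≤ act (comp Q c) W s :=
    act_anti ((mul_le_r hW _).trans (comp_mul_comp_zero c)) h
  exact sup_le_sup (mul_le_l this _) (mul_le_r this _)

/-- `W` is a right ideal acting nilpotently on the components in `H`, and recursively so are the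
right ideals containing the zero-degree products of `W`-heavy elements. -/
def Tame (N : ℕ) : ℕ → Q → AddSubgroup (ZMod n) → Prop
  | 0, W, _ => W = ⊥
  | k + 1, W, H => IsRightIdeal W ∧ (∀ i ∈ H, act (comp Q i) W N = ⊥) ∧
      ∀ b, ∃ W', zeroProd W N b ⊤ ≤ W' ∧ Tame N k W' (H ⊔ AddSubgroup.zmultiples b)

theorem Tame.isRightIdeal {N k : ℕ} {W : Q} {H : AddSubgroup (ZMod n)} (h : Tame N k W H) :
    IsRightIdeal W := by
  cases k with
  | zero => rw [show W = ⊥ from h]; exact IsRightIdeal.bot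
  | succ k => exact h.1

theorem Tame.mono {N N' k : ℕ} {W : Q} {H : AddSubgroup (ZMod n)} (h : Tame N k W H)
    (hN : N ≤ N') : Tame N' k W H := by
  induction k generalizing W H with
  | zero => exact h
  | succ k ih =>
    refine ⟨h.1, fun i hi => act_eq_bot_of_le (h.2.1 i hi) hN, fun b => ?_⟩
    obtain ⟨W', h1, h2⟩ := h.2.2 b
    exact ⟨W', (zeroProd_top_anti h.1.le hN b).trans h1, ih h2⟩

theorem Tame.bot {N : ℕ} (hN : 0 < N) (k : ℕ) (H : AddSubgroup (ZMod n)) :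
    Tame N k (⊥ : Q) H := by
  obtain ⟨N, rfl⟩ : ∃ N', N = N' + 1 := ⟨N - 1, by omega⟩
  induction k generalizing H with
  | zero => rfl
  | succ k ih =>
    refine ⟨IsRightIdeal.bot, fun i _ => act_bot_right _ _, fun b => ⟨⊥, ?_, ih _⟩⟩
    rw [zeroProd_top, act_bot_right]; simp

theorem act_comp_sup_le {W₁ W₂ : Q} (h₁ : IsRightIdeal W₁) (h₂ : IsRightIdeal W₂) (i : ZMod n)
    (N₁ N₂ : ℕ) : act (comp Q i) (W₁ ⊔ W₂) (N₁ + N₂) ≤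
      act (comp Q i) W₁ N₁ ⊔ act (comp Q i) W₂ N₂ :=
  act_sup_right_le (comp_mul_comp_zero i) h₁ h₂ le_rfl

theorem Tame.sup {N₁ N₂ k : ℕ} {W₁ W₂ : Q} {H : AddSubgroup (ZMod n)} (h₁ : Tame N₁ k W₁ H)
    (h₂ : Tame N₂ k W₂ H) : Tame (N₁ + N₂) k (W₁ ⊔ W₂) H := by
  induction k generalizing W₁ W₂ H with
  | zero => rw [show W₁ = ⊥ from h₁, show W₂ = ⊥ from h₂]; exact sup_idem _
  | succ k ih =>
    refine ⟨h₁.1.sup h₂.1, fun i hi => ?_, fun b => ?_⟩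
    · rw [← le_bot_iff]
      refine (act_comp_sup_le h₁.1 h₂.1 i N₁ N₂).trans ?_
      rw [h₁.2.1 i hi, h₂.2.1 i hi, sup_idem]
    · obtain ⟨V₁, hV₁, hT₁⟩ := h₁.2.2 b
      obtain ⟨V₂, hV₂, hT₂⟩ := h₂.2.2 b
      refine ⟨V₁ ⊔ V₂, le_trans ?_ (sup_le_sup hV₁ hV₂), ih hT₁ hT₂⟩
      have h := act_comp_sup_le h₁.1 h₂.1 b N₁ N₂
      simp only [zeroProd_top]
      refine sup_le ((mul_le_l h _).trans ?_) ((mul_le_r h _).trans ?_)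
      · rw [sup_mul']; exact sup_le_sup le_sup_left le_sup_left
      · rw [mul_sup']; exact sup_le_sup le_sup_right le_sup_right

theorem Tame.finset_sup {ι : Type*} (s : Finset ι) {N k : ℕ} (hN : 0 < N) {W : ι → Q}
    {H : AddSubgroup (ZMod n)} (h : ∀ i ∈ s, Tame N k (W i) H) :
    Tame ((s.card + 1) * N) k (s.sup W) H := by
  classical
  induction s using Finset.induction_on with
  | empty => exact Tame.bot (by simpa using hN) k H
  | insert a s ha ih =>
    rw [Finset.sup_insert, Finset.card_insert_of_notMem ha, Nat.succ_mul, add_comm]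
    exact (h a (by simp)).sup (ih fun i hi => h i (by simp [hi]))

/-- The bound for the nilpotency of thin elements. -/
def thinBound (n m : ℕ) : ℕ := towerBound m (2 * n + 3) m n (m + 1)

/-- Thinness supplies a tower over each principal element of degree `±a`, and `Tower.act_eq_bot`
applies to it. -/
theorem Thin.act_eq_bot [NeZero n] {γ : ℕ} {a : ZMod n} {Y : Q} (ha : a ≠ 0) (h : Thin γ a Y)
    (hγ : thinBound n m ≤ γ) : act (comp Q a) Y n = ⊥ ∧ act (comp Q (-a)) Y n = ⊥ := by
  obtain ⟨U, hU, hU0⟩ := exists_cof_pr_zero (Q := Q)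
  have key : ∀ p, IsPrin p → Tower (2 * n + 3) U Y a n (comp Q 0 ⊔ p) := fun p hp =>
    h.tower hU n (m + 1) _ (FG.comp_zero.sup (FG.of_isPrin hp)) hγ
  constructor
  · rw [← le_bot_iff]
    refine act₂_le_of_prin (W := ⊥) (t := 0) fun p hp hpa => ?_
    exact (act_eq_bot_of_le ((key p hp).act_eq_bot hU0 ha le_sup_right hpa le_rfl)
      (Nat.sub_le n 1)).le
  · rw [← le_bot_iff]
    refine act₂_le_of_prin (W := ⊥) (t := 0) fun p hp hpa => ?_
    exact (act_eq_bot_of_le ((key p hp).neg.act_eq_bot hU0 (neg_ne_zero.2 ha) le_sup_right hpa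
      le_rfl) (Nat.sub_le n 1)).le

/-- Only the first `u + q` letters are split between `Y` and `N`; the last `t` remain letters of
`W`. -/
theorem act_split_le {W Y N : Q} (hY : IsRightIdeal Y) (hN : IsRightIdeal N) (h : W ≤ Y ⊔ N)
    (i : ZMod n) (u q t : ℕ) : act (comp Q i) W (u + q + t) ≤
      act₂ Y W (comp Q i) u t ⊔ act (act (comp Q i) N q) W t := by
  rw [act_add, act₂, ← act_sup]
  exact act_mono ((act_mono le_rfl h _).trans (act_comp_sup_le hY hN i u q)) le_rfl t

/-- The codimension needed in `act₂_comp_le_tails`. -/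
def moveBound (n m g N' t₀ : ℕ) : ℕ :=
  towerBound m (n * (2 * n) + (t₀ + N' * (2 * (2 * n))) + 2 * n + n + N' + 2) g (2 * n) (m + 1)

theorem act₂_comp_le_tails [NeZero n] {γ g N' t₀ : ℕ} {a i j : ZMod n} {U Y W : Q}
    (hP : NilPair U Y W a n N') (hU : Cof g U) (hY : Thin γ a Y) (hγ : moveBound n m g N' t₀ ≤ γ)
    (hij : j - i ∈ AddSubgroup.zmultiples a) :
    act₂ Y W (comp Q i) (n * (2 * n)) (t₀ + N' * (2 * (2 * n))) ≤
      tails (act (U ⊓ comp Q j) W t₀) (U ⊓ comp Q a ⊔ U ⊓ comp Q (-a)) := by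
  obtain ⟨κ, κ', h1, h2, h3, h4, h5⟩ := ZMod.exists_nsmul_of_mem_zmultiples hij
  refine act₂_le_of_prin fun p hp hpi => ?_
  exact Tower.act₂_le_tails hP
    (hY.tower hU (2 * n) (m + 1) _ ((FG.comp_zero (Q := Q)).sup (FG.of_isPrin hp)) hγ)
    (hP.leY.trans le_sup_left) (hP.leW.trans le_sup_left) le_sup_right hpi h4 h5 h1 h2 (by omega)
    (Nat.pos_of_ne_zero (NeZero.ne n)) le_rfl le_rfl (by omega)

/-- For every nonzero `a ∈ A`, the right ideal `W` is contained in the sum of a thin and a tame right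
ideal. -/
def Split (γ N₀ k : ℕ) (H : AddSubgroup (ZMod n)) (A : Set (ZMod n)) (W : Q) : Prop :=
  IsRightIdeal W ∧ ∀ a ∈ A, a ≠ 0 → ∃ Y N, IsRightIdeal Y ∧ Thin γ a Y ∧ Tame N₀ k N H ∧ W ≤ Y ⊔ N

theorem Split.anti {γ γ' N₀ k : ℕ} {H : AddSubgroup (ZMod n)} {A : Set (ZMod n)} {W : Q}
    (h : Split γ N₀ k H A W) (hγ : γ' ≤ γ) : Split γ' N₀ k H A W :=
  ⟨h.1, fun a ha ha0 => by
    obtain ⟨Y, N, h1, h2, h3, h4⟩ := h.2 a ha ha0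
    exact ⟨Y, N, h1, h2.anti hγ, h3, h4⟩⟩

theorem act_comp_eq_bot_of_split [NeZero n] {W Y N : Q} {γ N₀ : ℕ} {a : ZMod n} (ha : a ≠ 0)
    (hY : IsRightIdeal Y) (hN : IsRightIdeal N) (h : W ≤ Y ⊔ N) (hT : Thin γ a Y)
    (hγ : thinBound n m ≤ γ) (h1 : act (comp Q a) N N₀ = ⊥) (h2 : act (comp Q (-a)) N N₀ = ⊥) :
    act (comp Q a) W (n + N₀) = ⊥ ∧ act (comp Q (-a)) W (n + N₀) = ⊥ := by
  obtain ⟨h3, h4⟩ := hT.act_eq_bot ha hγ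
  have key : ∀ i, act (comp Q i) Y n = ⊥ → act (comp Q i) N N₀ = ⊥ →
      act (comp Q i) W (n + N₀) = ⊥ := fun i h5 h6 => by
    have := act_split_le hY hN h i n N₀ 0
    rw [act₂, h5, h6] at this
    simpa using this
  exact ⟨key a h3 h1, key (-a) h4 h2⟩

end Tame

/-- Nilpotency spreads from degree `j` to degree `i` when `j - i` is a multiple of some `a ∈ A`: the
`Y`-part moves heavy elements to degree `j`, where they vanish, and the `N`-part is nilpotent
already. The walk starts at degree zero, where generic elements are `0`. -/
theorem exists_act_comp_eq_bot {n : ℕ} [NeZero n] (N₀ : ℕ) (A : Set (ZMod n)) {a₀ : ZMod n}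
    (ha₀ : a₀ ∈ A) (ha₀' : a₀ ≠ 0) {i : ZMod n} (hi : i ∈ AddSubgroup.closure A) :
    ∃ N, ∀ m, ∃ γ, ∀ (Q : Type u) [GenericLattice n m Q] (k : ℕ) (W : Q),
      Split γ N₀ (k + 1) (AddSubgroup.closure A) A W → act (comp Q i) W N = ⊥ := by
  have step : ∀ a ∈ A, a ≠ 0 → ∀ i j : ZMod n, i ∈ AddSubgroup.closure A →
      j - i ∈ AddSubgroup.zmultiples a →
      (j = 0 ∨ ∃ N, ∀ m, ∃ γ, ∀ (Q : Type u) [GenericLattice n m Q] (k : ℕ) (W : Q),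
        Split γ N₀ (k + 1) (AddSubgroup.closure A) A W → act (comp Q j) W N = ⊥) →
      ∃ N, ∀ m, ∃ γ, ∀ (Q : Type u) [GenericLattice n m Q] (k : ℕ) (W : Q),
      Split γ N₀ (k + 1) (AddSubgroup.closure A) A W → act (comp Q i) W N = ⊥ := by
    intro a ha ha0 i j hi hij hj
    have hj' : ∃ N, ∀ m, ∃ γ, ∀ (Q : Type u) [GenericLattice n m Q] (k : ℕ) (W : Q),
        Split γ N₀ (k + 1) (AddSubgroup.closure A) A W → j = 0 ∨ act (comp Q j) W N = ⊥ := by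
      rcases hj with hj | ⟨N, hN⟩
      · exact ⟨0, fun m => ⟨0, fun Q _ k W _ => Or.inl hj⟩⟩
      · refine ⟨N, fun m => ?_⟩
        obtain ⟨γ, hγ⟩ := hN m
        exact ⟨γ, fun Q _ k W h => Or.inr (hγ Q k W h)⟩
    obtain ⟨t₀, ht₀⟩ := hj'
    refine ⟨n * (2 * n) + N₀ + (t₀ + (n + N₀) * (2 * (2 * n))), fun m => ?_⟩
    obtain ⟨γ, hγ⟩ := ht₀ m
    refine ⟨max γ (max (thinBound n m) (moveBound n m m (n + N₀) t₀)), fun Q _ k W hS => ?_⟩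
    have hj := hγ Q k W (hS.anti (le_max_left _ _))
    obtain ⟨Y, N, hY, hT, hN, hW⟩ := hS.2 a ha ha0
    have haH : a ∈ AddSubgroup.closure A := AddSubgroup.subset_closure ha
    have hthin := hT.act_eq_bot ha0 ((le_max_left _ _).trans (le_max_right _ _))
    have hnil := act_comp_eq_bot_of_split ha0 hY hN.isRightIdeal hW hT
      ((le_max_left _ _).trans (le_max_right _ _)) (hN.2.1 a haH) (hN.2.1 (-a) (neg_mem haH))
    obtain ⟨U, hU, hU0⟩ := exists_cof_pr_zero (Q := Q)
    have hP : NilPair U Y W a n (n + N₀) :=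
      ⟨hU0, hY.le, hS.1.le, hthin.1, hthin.2, hnil.1, hnil.2⟩
    rw [← le_bot_iff]
    refine (act_split_le hY hN.isRightIdeal hW i _ _ _).trans ?_
    rw [hN.2.1 i hi, act_bot, sup_bot_eq]
    refine (act₂_comp_le_tails hP hU hT ((le_max_right _ _).trans (le_max_right _ _)) hij).trans ?_
    have : act (U ⊓ comp Q j) W t₀ = ⊥ := by
      rw [← le_bot_iff]
      rcases hj with rfl | hj
      · have : U ⊓ comp Q 0 = ⊥ := by
          rw [← le_bot_iff, ← hU0, ← pr_of_le (inf_le_right : U ⊓ comp Q 0 ≤ comp Q 0)]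
          exact pr_mono 0 inf_le_left
        rw [this, act_bot]
      · exact (act_mono inf_le_right le_rfl t₀).trans hj.le
    rw [this, tails_bot]
  have h0 := step a₀ ha₀ ha₀' 0 0 (zero_mem _) (by simp) (Or.inl rfl)
  induction hi using AddSubgroup.closure_induction_right with
  | zero => exact h0
  | add_right x hx a ha ih =>
    by_cases ha0 : a = 0
    · subst ha0; rwa [add_zero]
    · exact step a ha ha0 (x + a) x (add_mem hx (AddSubgroup.subset_closure ha))
        (by simp) (Or.inr ih)
  | add_neg_cancel x hx a ha ih =>
    by_cases ha0 : a = 0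
    · subst ha0; simpa using ih
    · exact step a ha ha0 (x + -a) x (add_mem hx (neg_mem (AddSubgroup.subset_closure ha)))
        (by simp) (Or.inr ih)

/-- Split right ideals act nilpotently on the components in the subgroup. -/
theorem exists_nilpotent {n : ℕ} [NeZero n] (N₀ : ℕ) (A : Set (ZMod n)) {a₀ : ZMod n}
    (ha₀ : a₀ ∈ A) (ha₀' : a₀ ≠ 0) :
    ∃ N, ∀ m, ∃ γ, ∀ (Q : Type u) [GenericLattice n m Q] (k : ℕ) (W : Q),
      Split γ N₀ (k + 1) (AddSubgroup.closure A) A W →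
      ∀ i ∈ AddSubgroup.closure A, act (comp Q i) W N = ⊥ := by
  classical
  choose N hN using fun i : AddSubgroup.closure A =>
    exists_act_comp_eq_bot.{u} N₀ A ha₀ ha₀' i.2
  choose γ hγ using hN
  refine ⟨Finset.univ.sup N, fun m => ⟨Finset.univ.sup fun i => γ i m, fun Q _ k W h i hi => ?_⟩⟩
  refine act_eq_bot_of_le (hγ ⟨i, hi⟩ m Q k W (h.anti ?_)) (Finset.le_sup (Finset.mem_univ _))
  exact Finset.le_sup (f := fun i => γ i m) (Finset.mem_univ _)

end LieTypeLattice

namespace LieTypeLattice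

open GenericLattice

universe u

/-! ### Zero-degree products of heavy elements. -/

section Pieces

variable {n m : ℕ} {Q : Type*} [GenericLattice n m Q]

theorem pr_mul_left_le (k : ZMod n) {i : ZMod n} {x : Q} (hx : x ≤ comp Q i) (y : Q) :
    pr k (x * y) ≤ x * pr (k - i) y := by
  rw [pr_mul]
  refine iSup_le fun j => ?_
  by_cases h : j = i
  · rw [h]; exact mul_le_l (pr_le _ _) _
  · rw [pr_of_le_ne hx h, bot_mul']; exact bot_le

/-- A zero-degree product of an element of `P` with trailing letters is either a product with `P` or
one ending in a generic letter of degree `±a`. -/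
theorem mul_le_of_le_tails {X P R z : Q} {U : Q} {a c c' : ZMod n}
    (hX : X ≤ tails P (U ⊓ comp Q a ⊔ U ⊓ comp Q (-a)) ⊔ R) (hXc : X ≤ comp Q c)
    (hPc : P ≤ comp Q c') (h1 : P * comp Q (-c') ≤ z) (h2 : comp Q (-c') * P ≤ z)
    (h3 : comp Q (-a) * (U ⊓ comp Q a) ≤ z) (h4 : comp Q a * (U ⊓ comp Q (-a)) ≤ z)
    (h5 : R * comp Q (-c) ≤ z) (h6 : comp Q (-c) * R ≤ z) :
    X * comp Q (-c) ⊔ comp Q (-c) * X ≤ z := by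
  set B := U ⊓ comp Q a ⊔ U ⊓ comp Q (-a)
  have hB : pr 0 (⊤ * B) ≤ z := by
    rw [mul_sup', pr_sup]
    refine sup_le ((pr_mul_right_le 0 ⊤ inf_le_right).trans ?_)
      ((pr_mul_right_le 0 ⊤ inf_le_right).trans ?_)
    · rw [zero_sub]; exact h3
    · rw [zero_sub, neg_neg]; exact h4
  have hP1 : pr 0 (P * ⊤) ≤ z := (pr_mul_left_le 0 hPc ⊤).trans (by rw [zero_sub]; exact h1)
  have hP2 : pr 0 (⊤ * P) ≤ z := (pr_mul_right_le 0 ⊤ hPc).trans (by rw [zero_sub]; exact h2)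
  refine sup_le ?_ ?_
  · rw [← pr_of_le (mul_le_comp' hXc le_rfl (add_neg_cancel c) : X * comp Q (-c) ≤ comp Q 0)]
    refine (pr_mono 0 (mul_le_l hX _)).trans ?_
    rw [sup_mul', pr_sup]
    refine sup_le ?_ ((pr_le _ _).trans h5)
    exact (pr_mono 0 (mul_le_r le_top _)).trans ((pr_zero_tails_mul_le P B).trans (sup_le hP1 hB))
  · rw [← pr_of_le (mul_le_comp' le_rfl hXc (neg_add_cancel c) : comp Q (-c) * X ≤ comp Q 0)]
    refine (pr_mono 0 (mul_le_r hX _)).trans ?_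
    rw [mul_sup', pr_sup]
    refine sup_le ?_ ((pr_le _ _).trans h6)
    exact (pr_mono 0 (mul_le_l le_top _)).trans ((pr_zero_mul_tails_le P B).trans (sup_le hP2 hB))

theorem act_act_le_act {N W : Q} (hN : IsRightIdeal N) (hW : W ≤ comp Q 0) (c : ZMod n) (q t : ℕ) :
    act (act (comp Q c) N q) W t ≤ act (comp Q c) N q :=
  act_le_self ((mul_le_r hW _).trans (act_mul_comp_le (comp_mul_comp_zero c) hN q)) t

/-- The zero-degree products of `W`-heavy elements of degree `c` are contained in the sum of those of
degree `c'`, those of degree `±a`, and those of `N`-heavy elements. -/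
theorem zeroProd_le_of_split [NeZero n] {γ g N' N₀ t₀ : ℕ} {a c c' : ZMod n} {U Y N W z : Q}
    (hP : NilPair U Y W a n N') (hU : Cof g U) (hY : IsRightIdeal Y) (hN : IsRightIdeal N)
    (hWYN : W ≤ Y ⊔ N) (hT : Thin γ a Y) (hγ : moveBound n m g N' t₀ ≤ γ)
    (hc : c' - c ∈ AddSubgroup.zmultiples a)
    (h1 : act (U ⊓ comp Q c') W t₀ * comp Q (-c') ≤ z)
    (h2 : comp Q (-c') * act (U ⊓ comp Q c') W t₀ ≤ z)
    (h3 : comp Q (-a) * (U ⊓ comp Q a) ≤ z) (h4 : comp Q a * (U ⊓ comp Q (-a)) ≤ z)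
    (h5 : zeroProd N N₀ c ⊤ ≤ z) :
    zeroProd W (n * (2 * n) + N₀ + (t₀ + N' * (2 * (2 * n)))) c ⊤ ≤ z := by
  rw [zeroProd_top] at h5 ⊢
  refine mul_le_of_le_tails (P := act (U ⊓ comp Q c') W t₀) (R := act (comp Q c) N N₀) (U := U)
    (a := a) ?_ (act_le_comp le_rfl hP.leW _) (act_le_comp inf_le_right hP.leW _) h1 h2 h3 h4
    (le_sup_left.trans h5) (le_sup_right.trans h5)
  exact (act_split_le hY hN hWYN c _ _ _).trans
    (sup_le_sup (act₂_comp_le_tails hP hU hT hγ hc) (act_act_le_act hN hP.leW c N₀ _))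

/-- The codimension needed in `zeroProd_le_of_peel`. -/
def peelBound (n m g N' t : ℕ) : ℕ :=
  towerBound m ((n + 2) * (n + N' + 1) + (n * n + (t + (N' + N') * n + N' * n)) + n + 5) g n
    (m + 1 + 1)

/-- The partner of a heavy element may be taken generic, at the price of letting the degree of the
heavy element range over the whole coset `b + H`. -/
theorem zeroProd_le_of_peel [NeZero n] {γ g N' N₀ t : ℕ} {a b : ZMod n} {U Y N W z : Q}
    {H : AddSubgroup (ZMod n)} (haH : a ∈ H) (ha : a ≠ 0)
    (hP : NilPair U Y W a n N') (hN' : act (comp Q 0) W N' = ⊥) (hU : Cof g U)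
    (hY : IsRightIdeal Y) (hN : IsRightIdeal N)
    (hWYN : W ≤ Y ⊔ N) (hT : Thin γ a Y) (hγ : peelBound n m g N' t ≤ γ)
    (h1 : ∀ c, c - b ∈ H → act (comp Q c) W t * (U ⊓ comp Q (-c)) ≤ z)
    (h2 : ∀ c, c - b ∈ H → (U ⊓ comp Q (-c)) * act (comp Q c) W t ≤ z)
    (h5 : zeroProd N N₀ b ⊤ ≤ z) :
    zeroProd W (n * n + N₀ + (t + (N' + N') * n + N' * n)) b ⊤ ≤ z := by
  have hn1 : n ≠ 1 := by rintro rfl; exact ha (Subsingleton.elim _ _)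
  have hn0 := NeZero.ne n
  obtain ⟨ℓ, hℓ⟩ : ∃ ℓ, n = ℓ + 1 := ⟨n - 1, by omega⟩
  -- Peeling changes degrees by multiples of `a ∈ H`, so the sum over the coset is stable under all
  -- the factors involved.
  let V : Q := ⨆ c : {c : ZMod n // c - b ∈ H}, comp Q c
  have hVle : ∀ c, c - b ∈ H → comp Q c ≤ V := fun c hc =>
    le_iSup (fun c : {c : ZMod n // c - b ∈ H} => comp Q c) ⟨c, hc⟩
  have hVmul : ∀ d ∈ H, V * comp Q d ≤ V := fun d hd => iSup_mul_le fun c =>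
    (mul_le_comp le_rfl le_rfl).trans (hVle _ (by
      rw [add_sub_right_comm]; exact add_mem c.2 hd))
  have hz0 : pr 0 (act V W t * U ⊔ U * act V W t) ≤ z := by
    rw [act_iSup, iSup_mul', mul_iSup', pr_sup, pr_iSup, pr_iSup]
    refine sup_le (iSup_le fun c => ?_) (iSup_le fun c => ?_)
    · refine (pr_mul_left_le 0 (act_le_comp le_rfl hP.leW t) U).trans ?_
      rw [zero_sub]
      exact (mul_le_r (le_inf (pr_le _ _) (pr_le_comp _ _)) _).trans (h1 c c.2)
    · refine (pr_mul_right_le 0 U (act_le_comp le_rfl hP.leW t)).trans ?_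
      rw [zero_sub]
      exact (mul_le_l (le_inf (pr_le _ _) (pr_le_comp _ _)) _).trans (h2 c c.2)
  set z' := act V W t * U ⊔ U * act V W t with hz'
  have hset : ∀ l ≤ comp Q (-b), PeelSetting U Y W V l z' a b n N' (N' + N') t := fun l hl =>
    { nil := hP
      pos := by omega
      le := by omega
      hl := hl
      heavy := fun s => by
        rw [mul_sup']
        exact sup_le (act_heavy hP.leW hN' hP.nilW (hVmul a haH) (hVmul 0 H.zero_mem) s)
          (act_heavy hP.leW hN' hP.nilW' (hVmul _ (neg_mem haH)) (hVmul 0 H.zero_mem) s)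
      hV := by rw [mul_sup']; exact sup_le (hVmul a haH) (hVmul _ (neg_mem haH))
      hV0 := hVmul 0 H.zero_mem
      hz := le_sup_left
      hz' := le_sup_right }
  have hpl : ∀ p l, IsPrin p → IsPrin l → p ≤ comp Q b → l ≤ comp Q (-b) →
      act₂ Y W p (n * n) (t + (N' + N') * n + N' * n) * l ≤ z' ∧
      l * act₂ Y W p (n * n) (t + (N' + N') * n + N' * n) ≤ z' := fun p l hp hl hpb hlb => by
    have hE : FG (m + 1 + 1) (comp Q 0 ⊔ p ⊔ l) :=
      ((FG.comp_zero (Q := Q)).sup (FG.of_isPrin hp)).sup (FG.of_isPrin hl)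
    refine (hset l hlb).act₂_mul_le (ℓ := ℓ)
      (k := (n + 2) * (n + N' + 1) + (n * n + (t + (N' + N') * n + N' * n)) + n + 5)
      (E := comp Q 0 ⊔ p ⊔ l) ?_ (hP.leY.trans (le_sup_left.trans le_sup_left))
      (hP.leW.trans (le_sup_left.trans le_sup_left)) (le_sup_right.trans le_sup_left) le_sup_right
      hpb (hpb.trans (hVle b (by simp))) (by omega) ?_ ?_ ?_ ?_
    · rw [← hℓ]; exact hT.tower hU n (m + 1 + 1) _ hE hγ
    · rw [← hℓ]; simp
    · rw [← hℓ]
    · rw [← hℓ]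
    · rw [show ℓ + 3 = n + 2 by omega]; omega
  set X := act₂ Y W (comp Q b) (n * n) (t + (N' + N') * n + N' * n) with hX
  have hXb : X ≤ comp Q b := act₂_le_comp le_rfl hP.leY hP.leW _ _
  have hX1 : X * comp Q (-b) ≤ z := by
    rw [← pr_of_le (mul_le_comp' hXb le_rfl (add_neg_cancel b) : X * comp Q (-b) ≤ comp Q 0)]
    refine (pr_mono 0 ?_).trans hz0
    rw [← le_ldiv]
    refine (le_sSup_prin _).trans (sSup_le fun l hl => le_ldiv.2 ?_)
    rw [← le_rdiv]
    exact act₂_le_of_prin fun p hp hpb => le_rdiv.2 (hpl p l hp hl.1 hpb hl.2).1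
  have hX2 : comp Q (-b) * X ≤ z := by
    rw [← pr_of_le (mul_le_comp' le_rfl hXb (neg_add_cancel b) : comp Q (-b) * X ≤ comp Q 0)]
    refine (pr_mono 0 ?_).trans hz0
    rw [← le_rdiv]
    refine (le_sSup_prin _).trans (sSup_le fun l hl => le_rdiv.2 ?_)
    rw [← le_ldiv]
    exact act₂_le_of_prin fun p hp hpb => le_ldiv.2 (hpl p l hp hl.1 hpb hl.2).2
  have hle := (act_split_le hY hN hWYN b (n * n) N₀ (t + (N' + N') * n + N' * n)).trans
    (sup_le_sup le_rfl (act_act_le_act hN hP.leW b N₀ _))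
  rw [zeroProd_top] at h5 ⊢
  refine sup_le ((mul_le_l hle _).trans ?_) ((mul_le_r hle _).trans ?_)
  · rw [sup_mul']; exact sup_le hX1 (le_sup_left.trans h5)
  · rw [mul_sup']; exact sup_le hX2 (le_sup_right.trans h5)

end Pieces

end LieTypeLattice

/-! ### Induction over subgroups: split right ideals are tame. -/

namespace LieTypeLattice

open GenericLattice

universe u

/-- Split right ideals are tame. -/
def SplitTame (n k : ℕ) : Prop :=
  ∀ (A : Set (ZMod n)) (a₀ : ZMod n), a₀ ∈ A → a₀ ≠ 0 → n + 1 ≤ Nat.card (AddSubgroup.closure A) + k →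
    ∀ N₀, 0 < N₀ → ∃ N₁, ∀ m, ∃ γ, ∀ (Q : Type u) [GenericLattice n m Q] (W : Q),
      Split γ N₀ k (AddSubgroup.closure A) A W → Tame N₁ k W (AddSubgroup.closure A)

/-- The pieces of the zero-degree products in degrees `c` with `c - c₀` supported on fewer than `s`
elements of `A`. -/
def Pieces (n k N₀ : ℕ) (A : Set (ZMod n)) (c₀ : ZMod n) (s : ℕ) : Prop :=
  ∃ t N, 0 < N ∧ ∀ m, ∃ γ G, ∀ (Q : Type u) [GenericLattice n m Q] (W : Q),
    Split γ N₀ (k + 1) (AddSubgroup.closure A) A W →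
    ∃ (Z : ZMod n → Q) (U : Q), Cof G U ∧ (∀ c, zeroProd W t c U ≤ Z c) ∧
      ∀ (c : ZMod n) (I : Finset (ZMod n)), ↑I ⊆ A → I.card < s → c - c₀ ∈ AddSubgroup.closure (I : Set (ZMod n)) →
        Tame N k (Z c) (AddSubgroup.closure A ⊔ AddSubgroup.zmultiples c₀)

theorem sup_zmultiples_eq {n : ℕ} {H : AddSubgroup (ZMod n)} {c c₀ : ZMod n} (h : c - c₀ ∈ H) :
    H ⊔ AddSubgroup.zmultiples c = H ⊔ AddSubgroup.zmultiples c₀ := by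
  have key : ∀ {x y : ZMod n}, x - y ∈ H → H ⊔ AddSubgroup.zmultiples x ≤ H ⊔ AddSubgroup.zmultiples y := fun {x y} h => by
    refine sup_le le_sup_left (AddSubgroup.zmultiples_le.2 ?_)
    rw [← sub_add_cancel x y]
    exact add_mem ((le_sup_left : H ≤ H ⊔ AddSubgroup.zmultiples y) h)
      ((le_sup_right : _ ≤ H ⊔ AddSubgroup.zmultiples y) (AddSubgroup.mem_zmultiples y))
  exact le_antisymm (key h) (key (by rw [← neg_sub]; exact neg_mem h))

variable {n : ℕ} [NeZero n]

/-- Induction on the support of `c - c₀`. The stable right ideal `Z' c` is thin in direction `c`.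
For `a ∈ I`, moving along `a` to a degree with smaller support places it in a right ideal thin in
direction `a`, plus a piece already tame, plus the tame part coming from `W`. So it is split for `I
∪ {c}`, and `hk` applies: this set generates the enlarged subgroup because `c₀` alone does. -/
theorem SplitTame.pieces {k N₀ : ℕ} (hk : SplitTame.{u} n k) (hN₀ : 0 < N₀) {A : Set (ZMod n)}
    {a₀ c₀ : ZMod n} (ha₀ : a₀ ∈ A) (ha₀' : a₀ ≠ 0) (hc₀ : c₀ ∉ AddSubgroup.closure A)
    (hgen : AddSubgroup.zmultiples c₀ = AddSubgroup.closure A ⊔ AddSubgroup.zmultiples c₀)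
    (hcard : n + 1 ≤ Nat.card (AddSubgroup.closure A ⊔ AddSubgroup.zmultiples c₀ : AddSubgroup (ZMod n)) + k) (s : ℕ) :
    Pieces.{u} n k N₀ A c₀ s := by
  classical
  obtain ⟨N₂, hN₂⟩ := exists_nilpotent.{u} N₀ A ha₀ ha₀'
  induction s with
  | zero =>
    refine ⟨0, 1, one_pos, fun m => ⟨0, 0, fun Q _ W hW => ⟨fun _ => ⊤, ⊤, cof_top,
      fun _ => le_top, fun c I _ h => absurd h (Nat.not_lt_zero _)⟩⟩⟩
  | succ s ih =>
    obtain ⟨t, N, hN, hst⟩ := ih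
    let P := {p : Finset (ZMod n) × ZMod n //
      ↑p.1 ⊆ A ∧ p.2 - c₀ ∈ AddSubgroup.closure (p.1 : Set (ZMod n))}
    have hcl : ∀ p : P, p.1.2 - c₀ ∈ AddSubgroup.closure A := fun p => AddSubgroup.closure_mono p.2.1 p.2.2
    have hc0 : ∀ p : P, p.1.2 ≠ 0 := fun p h => hc₀ (by
      have := hcl p
      rwa [h, zero_sub, neg_mem_iff] at this)
    have hAp : ∀ p : P, AddSubgroup.closure (insert p.1.2 (p.1.1 : Set (ZMod n))) =
        AddSubgroup.closure A ⊔ AddSubgroup.zmultiples c₀ := fun p => by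
      apply le_antisymm
      · rw [AddSubgroup.closure_le]
        rintro x (rfl | hx)
        · rw [← sup_zmultiples_eq (hcl p)]
          exact (le_sup_right : _ ≤ AddSubgroup.closure A ⊔ AddSubgroup.zmultiples p.1.2) (AddSubgroup.mem_zmultiples _)
        · exact (le_sup_left : AddSubgroup.closure A ≤ _) (AddSubgroup.subset_closure (p.2.1 hx))
      · rw [← hgen, AddSubgroup.zmultiples_le]
        have : p.1.2 - (p.1.2 - c₀) ∈ AddSubgroup.closure (insert p.1.2 (p.1.1 : Set (ZMod n))) :=
          sub_mem (AddSubgroup.subset_closure (Set.mem_insert _ _))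
            (AddSubgroup.closure_mono (Set.subset_insert _ _) p.2.2)
        rwa [sub_sub_cancel] at this
    choose N₁ hN₁ using fun p : P => hk (insert p.1.2 (p.1.1 : Set (ZMod n))) p.1.2
      (Set.mem_insert _ _) (hc0 p) (by rw [hAp p]; exact hcard) (N + N₀) (by omega)
    choose γ₁ hγ₁ using hN₁
    choose γ₂ hγ₂ using hN₂
    choose γ₃ G hG using hst
    let Γ : ℕ → ℕ := fun m => Finset.univ.sup fun p => γ₁ p m
    have hΓ : ∀ p m, γ₁ p m ≤ Γ m := fun p m =>
      Finset.le_sup (f := fun p => γ₁ p m) (Finset.mem_univ p)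
    let t' := n * (2 * n) + N₀ + (t + N₂ * (2 * (2 * n)))
    -- Stability to this codimension makes products of elements with `t'` letters `W` thin to order
    -- `Γ m`, the order required by `hk`.
    let g : ℕ → ℕ := fun m => genBound m t' (Γ m)
    let G₁ : ℕ → ℕ := fun m => G m + n * (m * stableBound m (Γ m))
    let G₂ : ℕ → ℕ := fun m => G₁ m + genBound (n * G₁ m + m) (t + 1) m
    refine ⟨t', max 1 (Finset.univ.sup N₁), by omega, fun m =>
      ⟨max (γ₃ m) (max (γ₂ m) (max (thinBound n m) (moveBound n m (G₂ m) N₂ t))),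
        n * (m * stableBound m (g m)), fun Q _ W hW => ?_⟩⟩
    obtain ⟨Z, U, hU, hZU, hZT⟩ := hG m Q W (hW.anti (le_max_left _ _))
    have hnil := hγ₂ m Q k W (hW.anti ((le_max_left _ _).trans (le_max_right _ _)))
    obtain ⟨Z', U', hZ'R, hZ', hU', hZU'⟩ := exists_stable_family hW.1 t' (g m)
    obtain ⟨Y', V, hY'R, hY', hV, hYV⟩ := exists_stable_family (Q := Q) IsRightIdeal.bot 0 (Γ m)
    obtain ⟨U₁, hU₁, hU₁0, -, hU₁'⟩ := exists_absorbing t (cof_inf hU hV)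
    refine ⟨Z', U', hU', hZU', fun c I hIA hIs hcI => ?_⟩
    let p : P := ⟨(I, c), hIA, hcI⟩
    have hcA : c - c₀ ∈ AddSubgroup.closure A := hcl p
    refine Tame.mono ?_ ((Finset.le_sup (f := N₁) (Finset.mem_univ p)).trans (le_max_right _ _))
    rw [← hAp p]
    refine hγ₁ p m Q (Z' c) ⟨hZ'R c, fun a ha ha0 => ?_⟩
    rw [hAp p]
    by_cases hac : a = c
    · subst hac
      exact ⟨Z' a, ⊥, hZ'R a, thin_of_le_zeroProd hW.1.le (hZ' a) (genBound_mono (hΓ p m)),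
        Tame.bot (by omega) _ _, le_sup_left⟩
    have haI : a ∈ I := by
      rcases ha with h | h
      · exact absurd h hac
      · exact h
    have haA : a ∈ A := hIA haI
    have haH : a ∈ AddSubgroup.closure A := AddSubgroup.subset_closure haA
    obtain ⟨Y, M, hYR, hYT, hM, hWYM⟩ := hW.2 a haA ha0
    obtain ⟨M', hM', hM'T⟩ := hM.2.2 c
    rw [sup_zmultiples_eq hcA] at hM'T
    -- `c₀ + x` is the target degree: it differs from `c` by a multiple of `a`, and its offset from
    -- `c₀` needs only `I.erase a`.
    obtain ⟨x, hx, y, hy, hxy⟩ : ∃ x ∈ AddSubgroup.closure ((I.erase a : Finset (ZMod n)) : Set (ZMod n)),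
        ∃ y ∈ AddSubgroup.zmultiples a, x + y = c - c₀ := by
      have : AddSubgroup.closure (I : Set (ZMod n)) =
          AddSubgroup.closure ((I.erase a : Finset (ZMod n)) : Set (ZMod n)) ⊔ AddSubgroup.zmultiples a := by
        rw [AddSubgroup.zmultiples_eq_closure, ← AddSubgroup.closure_union, Set.union_singleton,
          ← Finset.coe_insert, Finset.insert_erase haI]
      rw [this] at hcI
      exact AddSubgroup.mem_sup.1 hcI
    have hc'x : c₀ + x - c₀ = x := by abel
    have hZc' : Tame N k (Z (c₀ + x)) (AddSubgroup.closure A ⊔ AddSubgroup.zmultiples c₀) := by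
      refine hZT (c₀ + x) (I.erase a) ((Finset.coe_subset.2 (Finset.erase_subset a I)).trans hIA)
        ?_ (by rwa [hc'x])
      have := Finset.card_erase_lt_of_mem haI
      omega
    refine ⟨Y' a, Z (c₀ + x) ⊔ M', hY'R a, fun V hV => hY' a V (cof_mono hV (hΓ p m) le_rfl),
      hZc'.sup hM'T, ?_⟩
    refine (hZ' c ⊤ (cof_mono cof_top (Nat.zero_le _) le_rfl)).trans ?_
    have hthin := hYT.act_eq_bot ha0 ((le_max_left _ _).trans
      ((le_max_right _ _).trans (le_max_right _ _)))
    have hP : NilPair U₁ Y W a n N₂ :=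
      ⟨hU₁0, hYR.le, hW.1.le, hthin.1, hthin.2, hnil a haH, hnil _ (neg_mem haH)⟩
    have hZcov : ∀ c, zeroProd W t c (U ⊓ V) ≤ Z c := fun c =>
      (zeroProd_mono W t c inf_le_left).trans (hZU c)
    have hYcov : ∀ c, zeroProd ⊥ 0 c (U ⊓ V) ≤ Y' c := fun c =>
      (zeroProd_mono ⊥ 0 c inf_le_right).trans (hYV c)
    have hab := hU₁' W t (c₀ + x) hW.1.le le_rfl
    have hab' := hU₁' ⊥ 0 a bot_le (Nat.zero_le _)
    refine zeroProd_le_of_split hP hU₁ hYR hM.isRightIdeal hWYM hYT ((le_max_right _ _).trans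
      ((le_max_right _ _).trans (le_max_right _ _)))
      (c' := c₀ + x) ?_ ?_ ?_ ?_ ?_ ?_
    · rw [show c₀ + x - c = -y by rw [← sub_add_cancel c c₀, ← hxy]; abel]
      exact neg_mem hy
    · exact hab.1.trans ((hZcov _).trans (le_sup_left.trans le_sup_right))
    · exact hab.2.1.trans ((hZcov _).trans (le_sup_left.trans le_sup_right))
    · exact hab'.2.1.trans ((hYcov a).trans le_sup_left)
    · exact hab'.2.2.1.trans ((hYcov a).trans le_sup_left)
    · exact hM'.trans (le_sup_right.trans le_sup_right)

/-- If `b` lies in the subgroup, heavy elements of degree `b` are zero. Otherwise replace `b` by a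
representative `c₀` of its coset generating the enlarged subgroup, and cover the products by all
pieces in that coset, made available by `zeroProd_le_of_peel`. -/
theorem SplitTame.exists_child {k N₀ : ℕ} (hk : SplitTame.{u} n k) (hN₀ : 0 < N₀)
    {A : Set (ZMod n)} {a₀ : ZMod n} (ha₀ : a₀ ∈ A) (ha₀' : a₀ ≠ 0)
    (hcard : n + 1 ≤ Nat.card (AddSubgroup.closure A) + (k + 1)) (b : ZMod n) :
    ∃ N, ∀ m, ∃ γ, ∀ (Q : Type u) [GenericLattice n m Q] (W : Q),
      Split γ N₀ (k + 1) (AddSubgroup.closure A) A W →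
      ∃ W', zeroProd W N b ⊤ ≤ W' ∧ Tame N k W' (AddSubgroup.closure A ⊔ AddSubgroup.zmultiples b) := by
  classical
  obtain ⟨N₂, hN₂⟩ := exists_nilpotent.{u} N₀ A ha₀ ha₀'
  choose γ₂ hγ₂ using hN₂
  by_cases hb : b ∈ AddSubgroup.closure A
  · refine ⟨N₂ + 1, fun m => ⟨γ₂ m, fun Q _ W hW => ⟨⊥, ?_, Tame.bot (by omega) _ _⟩⟩⟩
    rw [zeroProd_top, act_eq_bot_of_le (hγ₂ m Q k W hW b hb) (by omega : N₂ ≤ N₂ + 1)]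
    simp
  obtain ⟨h, hh, hgen⟩ := ZMod.exists_zmultiples_add_eq_sup (AddSubgroup.closure A) b
  set c₀ := b + h with hc₀
  have hbc₀ : b - c₀ ∈ AddSubgroup.closure A := by
    rw [hc₀, sub_add_cancel_left]; exact neg_mem hh
  have hsup : AddSubgroup.closure A ⊔ AddSubgroup.zmultiples b = AddSubgroup.closure A ⊔ AddSubgroup.zmultiples c₀ := sup_zmultiples_eq hbc₀
  have hc₀A : c₀ ∉ AddSubgroup.closure A := fun hc => hb ((AddSubgroup.add_mem_cancel_right _ hh).1 hc)
  rw [hsup] at hgen ⊢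
  have hlt : Nat.card (AddSubgroup.closure A) <
      Nat.card (AddSubgroup.closure A ⊔ AddSubgroup.zmultiples c₀ : AddSubgroup (ZMod n)) := by
    refine Set.Finite.card_lt_card (Set.toFinite _) ?_
    rw [SetLike.coe_ssubset_coe]
    refine lt_of_le_of_ne le_sup_left fun heq => hc₀A ?_
    rw [heq]
    exact (le_sup_right : _ ≤ AddSubgroup.closure A ⊔ AddSubgroup.zmultiples c₀) (AddSubgroup.mem_zmultiples _)
  obtain ⟨t, N, hN, hst⟩ := hk.pieces hN₀ ha₀ ha₀' hc₀A hgen (by omega) (n + 1)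
  choose γ₃ G hG using hst
  let G₂ : ℕ → ℕ := fun m => G m + genBound (n * G m + m) (t + 1) m
  let N₃ := n * n + N₀ + (t + (N₂ + N₂) * n + N₂ * n)
  refine ⟨max N₃ ((n + 1) * N + N₀), fun m => ⟨max (γ₃ m) (max (γ₂ m) (max (thinBound n m)
    (peelBound n m (G₂ m) N₂ t))), fun Q _ W hW => ?_⟩⟩
  obtain ⟨Z, U, hU, hZU, hZT⟩ := hG m Q W (hW.anti (le_max_left _ _))
  have hnil := hγ₂ m Q k W (hW.anti ((le_max_left _ _).trans (le_max_right _ _)))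
  obtain ⟨U₁, hU₁, hU₁0, -, hU₁'⟩ := exists_absorbing t hU
  obtain ⟨Y, M, hYR, hYT, hM, hWYM⟩ := hW.2 a₀ ha₀ ha₀'
  obtain ⟨M', hM', hM'T⟩ := hM.2.2 b
  rw [hsup] at hM'T
  have haH : a₀ ∈ AddSubgroup.closure A := AddSubgroup.subset_closure ha₀
  have hthin := hYT.act_eq_bot ha₀' ((le_max_left _ _).trans
      ((le_max_right _ _).trans (le_max_right _ _)))
  have hP : NilPair U₁ Y W a₀ n N₂ :=
    ⟨hU₁0, hYR.le, hW.1.le, hthin.1, hthin.2, hnil a₀ haH, hnil _ (neg_mem haH)⟩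
  let s : Finset (ZMod n) := Finset.univ.filter fun c => c - b ∈ AddSubgroup.closure A
  refine ⟨s.sup Z ⊔ M', (zeroProd_top_anti hW.1.le (le_max_left _ _) b).trans ?_, ?_⟩
  · have hZs : ∀ c, c - b ∈ AddSubgroup.closure A → Z c ≤ s.sup Z ⊔ M' := fun c hc =>
      (Finset.le_sup (f := Z) (by simp [s, hc])).trans le_sup_left
    refine zeroProd_le_of_peel haH ha₀' hP (hnil 0 (zero_mem _)) hU₁ hYR hM.isRightIdeal hWYM hYT
      ((le_max_right _ _).trans
      ((le_max_right _ _).trans (le_max_right _ _))) (fun c hc => ?_) (fun c hc => ?_) (hM'.trans le_sup_right)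
    · exact (hU₁' W t c hW.1.le le_rfl).2.2.1.trans ((hZU c).trans (hZs c hc))
    · exact (hU₁' W t c hW.1.le le_rfl).2.2.2.trans ((hZU c).trans (hZs c hc))
  · refine Tame.mono ?_ (le_max_right _ _)
    refine Tame.sup (Tame.mono (Tame.finset_sup s hN fun c hc => ?_) ?_) hM'T
    · have hc' : c - b ∈ AddSubgroup.closure A := by simpa [s] using hc
      refine hZT c (Finset.univ.filter fun a => a ∈ A) (by simp) ?_ ?_
      · have := Finset.card_le_univ (Finset.univ.filter fun a => a ∈ A)
        rw [ZMod.card] at this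
        omega
      · have : ((Finset.univ.filter fun a => a ∈ A : Finset (ZMod n)) : Set (ZMod n)) = A := by
          ext; simp
        rw [this, ← sub_add_sub_cancel c b c₀]
        exact add_mem hc' hbc₀
    · have := Finset.card_le_univ s
      rw [ZMod.card] at this
      exact Nat.mul_le_mul (by omega) le_rfl

/-- The depth `k` compensates for the order of the subgroup, which grows at each descent outside it;
at `k = 0` the subgroup would have more than `n` elements. -/
theorem splitTame (k : ℕ) : SplitTame.{u} n k := by
  classical
  induction k with
  | zero =>
    intro A a₀ _ _ hcard
    exfalso
    have : Nat.card (AddSubgroup.closure A) ≤ Nat.card (ZMod n) :=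
      Nat.card_le_card_of_injective _ Subtype.val_injective
    rw [Nat.card_zmod] at this
    omega
  | succ k ih =>
    intro A a₀ ha₀ ha₀' hcard N₀ hN₀
    obtain ⟨N₂, hN₂⟩ := exists_nilpotent.{u} N₀ A ha₀ ha₀'
    choose γ₂ hγ₂ using hN₂
    choose N hN using ih.exists_child hN₀ ha₀ ha₀' hcard
    choose γ hγ using hN
    refine ⟨max N₂ (Finset.univ.sup N), fun m => ⟨max (γ₂ m) (Finset.univ.sup fun b => γ b m),
      fun Q _ W hW => ⟨hW.1, fun i hi => ?_, fun b => ?_⟩⟩⟩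
    · exact act_eq_bot_of_le (hγ₂ m Q k W (hW.anti (le_max_left _ _)) i hi) (le_max_left _ _)
    · obtain ⟨W', h1, h2⟩ := hγ b m Q W (hW.anti
        ((Finset.le_sup (f := fun b => γ b m) (Finset.mem_univ b)).trans (le_max_right _ _)))
      have hle : N b ≤ max N₂ (Finset.univ.sup N) :=
        (Finset.le_sup (f := N) (Finset.mem_univ b)).trans (le_max_right _ _)
      exact ⟨W', (zeroProd_top_anti hW.1.le hle b).trans h1, h2.mono hle⟩

/-- Thin right ideals are tame. -/
theorem exists_tame_of_thin (n : ℕ) [NeZero n] : ∃ N, 0 < N ∧ ∀ m, ∃ γ, ∀ (Q : Type u)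
    [GenericLattice n m Q] (a : ZMod n) (Y : Q), a ≠ 0 → IsRightIdeal Y → Thin γ a Y →
      Tame N n Y (AddSubgroup.zmultiples a) := by
  classical
  have key : ∀ a : ZMod n, ∃ N, ∀ m, ∃ γ, ∀ (Q : Type u)
    [GenericLattice n m Q] (Y : Q), a ≠ 0 → IsRightIdeal Y → Thin γ a Y →
      Tame N n Y (AddSubgroup.zmultiples a) := fun a => by
    by_cases ha : a = 0
    · exact ⟨0, fun m => ⟨0, fun Q _ Y h => absurd ha h⟩⟩
    have hcl : AddSubgroup.zmultiples a = AddSubgroup.closure {a} := AddSubgroup.zmultiples_eq_closure a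
    obtain ⟨N, hN⟩ := splitTame.{u} (n := n) n {a} a rfl ha
      (by have := Nat.card_pos (α := AddSubgroup.closure {a}); omega) 1 one_pos
    refine ⟨N, fun m => ?_⟩
    obtain ⟨γ, hγ⟩ := hN m
    refine ⟨γ, fun Q _ Y _ hY hT => ?_⟩
    rw [hcl]
    refine hγ Q Y ⟨hY, ?_⟩
    rintro b rfl -
    exact ⟨Y, ⊥, hY, hT, Tame.bot one_pos _ _, le_sup_left⟩
  choose N hN using key
  choose γ hγ using hN
  refine ⟨max 1 (Finset.univ.sup N), by omega, fun m => ⟨Finset.univ.sup fun a => γ a m,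
    fun Q _ a Y ha hY hT => ?_⟩⟩
  refine Tame.mono (hγ a m Q Y ha hY (hT.anti ?_))
    ((Finset.le_sup (f := N) (Finset.mem_univ a)).trans (le_max_right _ _))
  exact Finset.le_sup (f := fun a => γ a m) (Finset.mem_univ a)

end LieTypeLattice

/-- Choose `p` shortest. If it had more than `n` letters, two of its partial sums would agree, and
the zero-sum block between them could be moved to `q`. -/
theorem List.exists_perm_append_sum_eq_zero {α : Type*} {n : ℕ} [NeZero n] (w : α → ZMod n)
    (i : ZMod n) (l : List α) (h : i + (l.map w).sum = 0) :
    ∃ q p : List α, l.Perm (q ++ p) ∧ i + (p.map w).sum = 0 ∧ p.length ≤ n := by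
  classical
  have hex : ∃ k, ∃ q p : List α, l.Perm (q ++ p) ∧ i + (p.map w).sum = 0 ∧ p.length = k :=
    ⟨_, [], l, by simp, h, rfl⟩
  obtain ⟨q, p, hl, hp, hk⟩ := Nat.find_spec hex
  refine ⟨q, p, hl, hp, ?_⟩
  by_contra hlt
  push Not at hlt
  obtain ⟨x, y, hxy, heq⟩ := Fintype.exists_ne_map_eq_of_card_lt
    (fun x : Fin (n + 1) => ((p.take x).map w).sum) (by rw [ZMod.card, Fintype.card_fin]; omega)
  wlog hlt' : x < y generalizing x y
  · exact this y x hxy.symm heq.symm (lt_of_le_of_ne (not_lt.1 hlt') hxy.symm)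
  have hx : (x : ℕ) < y := hlt'
  have hy : (y : ℕ) ≤ n := by omega
  have hsplit : p = p.take x ++ ((p.take y).drop x ++ p.drop y) := by
    rw [← List.append_assoc]
    conv_lhs => rw [← List.take_append_drop y p]
    congr 1
    conv_lhs => rw [← List.take_append_drop x (p.take y)]
    rw [List.take_take, min_eq_left hx.le]
  have hmid : (((p.take y).drop x).map w).sum = 0 := by
    have h1 : ((p.take y).map w).sum =
        ((p.take x).map w).sum + (((p.take y).drop x).map w).sum := by
      rw [← List.sum_append, ← List.map_append]
      conv_lhs => rw [← List.take_append_drop x (p.take y)]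
      rw [List.take_take, min_eq_left hx.le]
    rw [← show ((p.take x).map w).sum = ((p.take y).map w).sum from heq] at h1
    simpa using h1
  refine Nat.find_min hex (m := (p.take x ++ p.drop y).length) ?_
    ⟨q ++ (p.take y).drop x, p.take x ++ p.drop y, ?_, ?_, rfl⟩
  · rw [← hk, List.length_append, List.length_take, List.length_drop]; omega
  · refine hl.trans ?_
    rw [List.append_assoc]
    refine List.Perm.append_left q ?_
    conv_lhs => rw [hsplit]
    rw [← List.append_assoc, ← List.append_assoc]
    exact List.Perm.append_right _ List.perm_append_comm
  · rw [← hp]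
    conv_rhs => rw [hsplit]
    simp only [List.map_append, List.sum_append, hmid, zero_add]

namespace LieTypeLattice

open GenericLattice

universe u

/-! ### The ideal of bounded codimension. -/

section Ideal

variable {n m : ℕ} {Q : Type*} [GenericLattice n m Q]

/-- Right multiples of `V` with fewer than `r` factors. -/
def low (V : Q) (r : ℕ) : Q := ⨆ j : Fin r, act V ⊤ j

theorem le_low (V : Q) {j r : ℕ} (h : j < r) : act V ⊤ j ≤ low V r :=
  le_iSup (fun j : Fin r => act V ⊤ j) ⟨j, h⟩

theorem low_mul_le (V : Q) (r : ℕ) : low V r * ⊤ ≤ low V (r + 1) :=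
  iSup_mul_le fun j => by rw [← act_succ]; exact le_low V (by omega)

theorem low_mono (V : Q) {r s : ℕ} (h : r ≤ s) : low V r ≤ low V s :=
  iSup_le fun j => le_low V (by omega)

theorem top_mul_low_mul_le (V : Q) (r : ℕ) : ⊤ * low V r * ⊤ ≤ ⊤ * low V (r + 1) := by
  refine (mul_mul_le _ _ _).trans (sup_le (mul_le_r (low_mul_le V r) _) ?_)
  exact mul_le le_top (low_mono V (Nat.le_succ r))

theorem tail_le_act {x V : Q} {k : ℕ} (hx : x ≤ act V ⊤ k) (l : List Q) :
    tail x l ≤ act V ⊤ (k + l.length) := by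
  induction l with
  | nil => exact hx
  | cons d l ih => exact mul_le ih le_top

theorem tail_bot (l : List Q) : tail (⊥ : Q) l = ⊥ := by
  induction l with
  | nil => rfl
  | cons d l ih => rw [tail, ih, bot_mul']

theorem tail_append' (x : Q) (q p : List Q) : tail x (q ++ p) = tail (tail x p) q := by
  induction q with
  | nil => rfl
  | cons d q ih => rw [List.cons_append, tail, ih, tail]

/-- Swapping adjacent letters costs the term `x(ab)`, which has one factor fewer. -/
theorem tail_le_of_perm {x V : Q} (hx : x ≤ V) {l l' : List Q} (h : l.Perm l') :
    tail x l ≤ tail x l' ⊔ low V l.length := by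
  induction h with
  | nil => exact le_sup_left
  | cons d h ih =>
    refine (mul_le_l ih d).trans ?_
    rw [sup_mul']
    exact sup_le_sup le_rfl ((mul_le_r le_top _).trans (low_mul_le _ _))
  | swap a b l =>
    refine (mul_mul_le _ _ _).trans (sup_le ?_ le_sup_left)
    refine (mul_le (tail_le_act (k := 0) hx l) le_top).trans ?_
    rw [← act_succ]
    exact (le_low V (by simp)).trans le_sup_right
  | trans h₁ h₂ ih₁ ih₂ =>
    refine ih₁.trans (sup_le (ih₂.trans (sup_le le_sup_left ?_)) le_sup_right)
    rw [h₁.length_eq]; exact le_sup_right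

theorem act_top_le_of_tail {V z : Q} {Λ : Set Q} (hΛ : sSup Λ = ⊤) (r : ℕ)
    (h : ∀ l : List Q, l.length = r → (∀ x ∈ l, x ∈ Λ) → tail V l ≤ z) : act V ⊤ r ≤ z := by
  induction r generalizing z with
  | zero => exact h [] rfl (by simp)
  | succ r ih =>
    rw [act_succ, ← hΛ, mul_sSup', hΛ]
    refine iSup₂_le fun d hd => ?_
    rw [← le_rdiv]
    refine ih fun l hl hlΛ => le_rdiv.2 (h (d :: l) (by simp [hl]) ?_)
    rintro x (_ | ⟨_, hx⟩)
    · exact hd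
    · exact hlΛ x hx

theorem act_top_le_of_tail_pr {V z : Q} {Λ : Set Q} (hΛ : sSup Λ = ⊤) (r : ℕ)
    (h : ∀ (i : ZMod n) (l : List Q), l.length = r → (∀ x ∈ l, x ∈ Λ) → tail (pr i V) l ≤ z) :
    act V ⊤ r ≤ z := by
  refine act_top_le_of_tail hΛ r fun l hl hlΛ => ?_
  obtain ⟨Z, hZ⟩ := exists_le_iff_tail_le z l
  rw [← hZ]
  exact le_of_pr_le fun i => (hZ _).2 (h i l hl hlΛ)

theorem mul_tail_le {c x V : Q} {j : ℕ} (hx : x ≤ act V ⊤ j) (q : List Q) :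
    c * tail x q ≤ tail (c * x) q ⊔ ⊤ * low V (j + q.length) := by
  induction q with
  | nil => exact le_sup_left
  | cons d q ih =>
    refine (mul_mul_le' _ _ _).trans (sup_le ((mul_le_l ih d).trans ?_) ?_)
    · rw [sup_mul']
      exact sup_le_sup le_rfl ((mul_le_r le_top _).trans (top_mul_low_mul_le _ _))
    · refine le_sup_of_le_right (mul_le le_top ?_)
      exact (tail_le_act hx q).trans (le_low V (by simp))

theorem tail_le_comp_sum {x : Q} {i : ZMod n} (hx : x ≤ comp Q i) {w : Q → ZMod n} {l : List Q}
    (h : ∀ d ∈ l, d ≤ comp Q (w d)) : tail x l ≤ comp Q (i + (l.map w).sum) := by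
  induction l with
  | nil => simpa [tail] using hx
  | cons d l ih =>
    refine mul_le_comp' (ih fun e he => h e (by simp [he])) (h d (by simp)) ?_
    rw [List.map_cons, List.sum_cons]; abel

/-- The data for the construction of the ideal: words in `s` with one factor from `V` vanish in
degree zero. -/
structure IdealData (U V z : Q) (s : Finset Q) : Prop where
  right : pr 0 (U * ⊤) ≤ z
  left : pr 0 (⊤ * U) ≤ z
  prin : ∀ p ∈ s, IsPrin p
  sup : U ⊔ s.sup id = ⊤
  pr_zero : pr 0 U = ⊥
  words : oneWords (s.sup id) V (n + 1) ≤ U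

variable {U V z : Q} {s : Finset Q}

theorem IdealData.sSup_insert (h : IdealData U V z s) : sSup (insert U (s : Set Q)) = ⊤ := by
  rw [_root_.sSup_insert, ← h.sup, Finset.sup_id_eq_sSup]

/-- Take letters from `U` and the finite complement `s`; modulo shorter words they may be reordered.
A letter `U` is moved to the end, giving `⊤ * U`. If all letters lie in `s` and the degree is zero,
some at most `n` of them can be moved next to `V` to form a zero-degree word, which vanishes because
`V` is generic. -/
theorem IdealData.pr_act_le [NeZero n] (h : IdealData U V z s) (r : ℕ) :
    pr 0 (act V ⊤ r) ≤ z := by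
  classical
  induction r using Nat.strong_induction_on with
  | _ r ih =>
  have hlow : pr 0 (low V r) ≤ z := by
    rw [low, pr_iSup]; exact iSup_le fun j => ih j j.2
  have hdeg : ∀ d : Q, ∃ i : ZMod n, IsPrin d → d ≤ comp Q i := fun d => by
    by_cases hd : IsPrin d
    · obtain ⟨i, hi⟩ := exists_le_comp hd
      exact ⟨i, fun _ => hi⟩
    · exact ⟨0, fun h => absurd h hd⟩
  choose w hw using hdeg
  obtain ⟨Z, hZ⟩ : ∃ Z : Q, ∀ x, pr 0 x ≤ z ↔ x ≤ Z := by
    refine ⟨sSup {x | pr 0 x ≤ z}, fun x => ⟨fun hx => le_sSup hx, fun hx => ?_⟩⟩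
    refine (pr_mono 0 hx).trans ?_
    rw [pr_sSup]
    exact iSup₂_le fun y hy => hy
  rw [hZ]
  refine act_top_le_of_tail_pr h.sSup_insert r fun i l hl hlΛ => ?_
  rw [← hZ]
  by_cases hU : U ∈ l
  · refine (pr_mono 0 (tail_le_of_perm (pr_le i V) (List.perm_cons_erase hU))).trans ?_
    rw [pr_sup, hl]
    exact sup_le ((pr_mono 0 (mul_le_l le_top U)).trans h.left) hlow
  have hls : ∀ d ∈ l, d ∈ s := fun d hd => by
    rcases hlΛ d hd with rfl | h'
    · exact absurd hd hU
    · exact h'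
  have hlw : ∀ d ∈ l, d ≤ comp Q (w d) := fun d hd => hw d (h.prin d (hls d hd))
  by_cases hsum : i + (l.map w).sum = 0
  · obtain ⟨q, p, hqp, hp, hpn⟩ := List.exists_perm_append_sum_eq_zero w i l hsum
    have hpl : ∀ d ∈ p, d ∈ l := fun d hd => hqp.symm.subset (by simp [hd])
    refine (pr_mono 0 (tail_le_of_perm (pr_le i V) hqp)).trans ?_
    rw [pr_sup, hl]
    refine sup_le ?_ hlow
    have h1 := tail_le_oneWords (E := s.sup id) (X := V) (i := 0) (j := 0) (x := pr i V) (τ := p)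
      (pr_le i V) (fun d hd => Finset.le_sup (f := id) (hls d (hpl d hd)))
    have h2 := tail_le_comp_sum (pr_le_comp i V) (fun d hd => hlw d (hpl d hd))
    rw [hp] at h2
    rw [tail_append', eq_bot_of_le_oneWords h.pr_zero h.words h1 (by omega) h2, tail_bot, pr_bot]
    exact bot_le
  · rw [pr_of_le_ne (tail_le_comp_sum (pr_le_comp i V) hlw) (Ne.symm hsum)]
    exact bot_le

/-- The same argument with an extra left letter `c`: its degree is included in the zero-sum
selection, and it counts as one more letter of the vanishing word, hence the bound `n + 1` in
`IdealData.words`. -/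
theorem IdealData.pr_mul_act_le [NeZero n] (h : IdealData U V z s) (r : ℕ) :
    pr 0 (⊤ * act V ⊤ r) ≤ z := by
  classical
  induction r using Nat.strong_induction_on with
  | _ r ih =>
  have hlow : pr 0 (⊤ * low V r) ≤ z := by
    rw [low, mul_iSup', pr_iSup]; exact iSup_le fun j => ih j j.2
  have hdeg : ∀ d : Q, ∃ i : ZMod n, IsPrin d → d ≤ comp Q i := fun d => by
    by_cases hd : IsPrin d
    · obtain ⟨i, hi⟩ := exists_le_comp hd
      exact ⟨i, fun _ => hi⟩
    · exact ⟨0, fun h => absurd h hd⟩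
  choose w hw using hdeg
  obtain ⟨Z, hZ⟩ : ∃ Z : Q, ∀ x, pr 0 x ≤ z ↔ x ≤ Z := by
    refine ⟨sSup {x | pr 0 x ≤ z}, fun x => ⟨fun hx => le_sSup hx, fun hx => ?_⟩⟩
    refine (pr_mono 0 hx).trans ?_
    rw [pr_sSup]
    exact iSup₂_le fun y hy => hy
  conv_lhs => rw [← h.sSup_insert]
  rw [sSup_mul', pr_iSup]
  refine iSup_le fun c => ?_
  rw [pr_iSup]
  refine iSup_le fun hc => ?_
  rw [h.sSup_insert]
  rcases hc with rfl | hc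
  · exact (pr_mono 0 (mul_le_r le_top _)).trans h.right
  have hcs : c ∈ s := hc
  rw [hZ, ← le_ldiv]
  refine act_top_le_of_tail_pr h.sSup_insert r fun i l hl hlΛ => ?_
  rw [le_ldiv, ← hZ]
  have hVi : pr i V ≤ act V ⊤ 0 := pr_le i V
  have hperm : ∀ l', l.Perm l' → pr 0 (c * tail (pr i V) l') ≤ z →
      pr 0 (c * tail (pr i V) l) ≤ z := fun l' hl' h' => by
    refine (pr_mono 0 (mul_le_r (tail_le_of_perm (pr_le i V) hl') c)).trans ?_
    rw [mul_sup', pr_sup, hl]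
    exact sup_le h' ((pr_mono 0 (mul_le_l le_top _)).trans hlow)
  by_cases hU : U ∈ l
  · refine hperm _ (List.perm_cons_erase hU) ?_
    refine (pr_mono 0 (mul_mul_le' _ _ _)).trans ?_
    rw [pr_sup]
    refine sup_le ((pr_mono 0 (mul_le_l le_top U)).trans h.left) ?_
    have h1 := tail_le_act hVi (l.erase U)
    have hlen := List.length_erase_of_mem hU
    have hpos := List.length_pos_of_mem hU
    exact (pr_mono 0 (mul_le le_top h1)).trans (ih _ (by omega))
  have hls : ∀ d ∈ l, d ∈ s := fun d hd => by
    rcases hlΛ d hd with rfl | h'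
    · exact absurd hd hU
    · exact h'
  have hlw : ∀ d ∈ l, d ≤ comp Q (w d) := fun d hd => hw d (h.prin d (hls d hd))
  have hcw : c ≤ comp Q (w c) := hw c (h.prin c hcs)
  by_cases hsum : w c + i + (l.map w).sum = 0
  · obtain ⟨q, p, hqp, hp, hpn⟩ := List.exists_perm_append_sum_eq_zero w (w c + i) l hsum
    have hpl : ∀ d ∈ p, d ∈ l := fun d hd => hqp.symm.subset (by simp [hd])
    refine hperm _ hqp ?_
    have h1 := tail_le_oneWords (E := s.sup id) (X := V) (i := 0) (j := 0) (x := pr i V) (τ := p)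
      (pr_le i V) (fun d hd => Finset.le_sup (f := id) (hls d (hpl d hd)))
    have h2 := tail_le_comp_sum (pr_le_comp i V) (fun d hd => hlw d (hpl d hd))
    have h3 : c * tail (pr i V) p = ⊥ := by
      refine eq_bot_of_le_oneWords h.pr_zero h.words
        (mul_le_oneWords' (j := 0) h1 (Finset.le_sup (f := id) hcs) le_rfl) (by omega) ?_
      refine mul_le_comp' hcw h2 ?_
      rw [← hp]; abel
    rw [tail_append']
    refine (pr_mono 0 (mul_tail_le (tail_le_act hVi p) q)).trans ?_
    rw [h3, tail_bot, bot_sup_eq]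
    refine le_trans (pr_mono 0 (mul_le_r (low_mono V ?_) _)) hlow
    have := hqp.length_eq
    rw [List.length_append] at this
    omega
  · rw [pr_of_le_ne (mul_le_comp' hcw (tail_le_comp_sum (pr_le_comp i V) hlw) rfl)
      (by rw [← add_assoc]; exact Ne.symm hsum)]
    exact bot_le

/-- The ideal generated by `V`. -/
def ideal (V : Q) : Q := (⨆ r, act V ⊤ r) ⊔ ⊤ * ⨆ r, act V ⊤ r

theorem le_ideal (V : Q) : V ≤ ideal V := le_sup_of_le_left (le_iSup (fun r => act V ⊤ r) 0)

theorem ideal_mul_le (V : Q) : ideal V * ⊤ ≤ ideal V := by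
  have h : (⨆ r, act V ⊤ r) * ⊤ ≤ ⨆ r, act V ⊤ r :=
    iSup_mul_le fun r => le_iSup (fun r => act V ⊤ r) (r + 1)
  rw [ideal, sup_mul']
  refine sup_le (h.trans le_sup_left) ((mul_mul_le _ _ _).trans (sup_le ?_ ?_))
  · exact (mul_le_r h _).trans le_sup_right
  · exact (mul_le_l le_top _).trans le_sup_right

theorem mul_ideal_le (V : Q) : ⊤ * ideal V ≤ ideal V := by
  rw [ideal, mul_sup']
  refine sup_le le_sup_right ((mul_mul_le' _ _ _).trans (sup_le ?_ ?_))
  · exact (mul_le_l le_top _).trans le_sup_right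
  · exact (mul_le_r le_top _).trans ((mul_le_l le_sup_right _).trans (ideal_mul_le V))

theorem IdealData.pr_ideal_le [NeZero n] (h : IdealData U V z s) : pr 0 (ideal V) ≤ z := by
  rw [ideal, mul_iSup', pr_sup, pr_iSup, pr_iSup]
  exact sup_le (iSup_le h.pr_act_le) (iSup_le h.pr_mul_act_le)

end Ideal

/-- An ideal of bounded codimension whose zero component is covered by thin right ideals. -/
theorem exists_ideal (n m : ℕ) [NeZero n] (γ : ℕ) : ∃ c, ∀ (Q : Type u) [GenericLattice n m Q],
    ∃ (I C : Q) (Y : ZMod n → Q), I * ⊤ ≤ I ∧ ⊤ * I ≤ I ∧ FG c C ∧ I ⊔ C = ⊤ ∧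
      (∀ a, IsRightIdeal (Y a)) ∧ (∀ a, Thin γ a (Y a)) ∧ Y 0 = ⊥ ∧ pr 0 I ≤ ⨆ a, Y a := by
  classical
  let g₁ := n * (m * stableBound m γ)
  let g₂ := g₁ + genBound (n * g₁ + m) (0 + 1) m
  refine ⟨n * genBound (n * g₂) (n + 1) g₂, fun Q _ => ?_⟩
  obtain ⟨Y, U₁, hYR, hY, hU₁, hYU⟩ := exists_stable_family (Q := Q) IsRightIdeal.bot 0 γ
  obtain ⟨U, hU, hU0, -, hUab⟩ := exists_absorbing 0 hU₁
  obtain ⟨s, hs, hp, hsup⟩ := exists_compl hU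
  obtain ⟨V, hV, hVU⟩ := exists_generic (E := s.sup id) ⟨s, hs, hp, rfl⟩ hU (n + 1)
  obtain ⟨s', hs', hp', hsup'⟩ := exists_compl hV
  -- Direction zero can be dropped, since `U` has no zero component; thinness gives nilpotency only
  -- for `a ≠ 0`.
  let Y' : ZMod n → Q := fun a => if a = 0 then ⊥ else Y a
  have hUc0 : U ⊓ comp Q 0 = ⊥ := by
    rw [← le_bot_iff, ← hU0, ← pr_of_le (inf_le_right : U ⊓ comp Q 0 ≤ comp Q 0)]
    exact pr_mono 0 inf_le_left
  have hY'le : ∀ a, a ≠ 0 → zeroProd ⊥ 0 a U₁ ≤ ⨆ a, Y' a := fun a ha =>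
    (hYU a).trans (le_iSup_of_le a (by simp [Y', ha]))
  have hpr : ∀ i, pr i U ≤ U ⊓ comp Q i := fun i => le_inf (pr_le _ _) (pr_le_comp _ _)
  have hdata : IdealData U V (⨆ a, Y' a) s := by
    refine ⟨?_, ?_, hp, hsup, hU0, hVU⟩
    · rw [pr_mul]
      refine iSup_le fun a => ?_
      rw [zero_sub]
      by_cases ha : a = 0
      · subst ha
        refine (mul_le_l (hpr 0) _).trans ?_
        rw [hUc0, bot_mul']; exact bot_le
      · exact (mul_le_l (hpr a) _).trans
          ((hUab ⊥ 0 a bot_le le_rfl).1.trans (hY'le a ha))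
    · rw [pr_mul]
      refine iSup_le fun a => ?_
      rw [zero_sub]
      by_cases ha : a = 0
      · subst ha
        refine (mul_le_r (hpr _) _).trans ?_
        rw [neg_zero, hUc0, mul_bot']; exact bot_le
      · exact (mul_le_r (hpr (-a)) _).trans
          ((hUab ⊥ 0 a bot_le le_rfl).2.2.1.trans (hY'le a ha))
  refine ⟨ideal V, s'.sup id, Y', ideal_mul_le V, mul_ideal_le V, ⟨s', hs', hp', rfl⟩, ?_, ?_, ?_,
    by simp [Y'], hdata.pr_ideal_le⟩
  · rw [eq_top_iff, ← hsup']
    exact sup_le_sup (le_ideal V) le_rfl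
  · intro a
    by_cases ha : a = 0
    · simp only [Y', ha, if_true]; exact IsRightIdeal.bot
    · simp only [Y', ha, if_false]; exact hYR a
  · intro a
    by_cases ha : a = 0
    · simp only [Y', ha, if_true]; exact fun _ _ => bot_le
    · simp only [Y', ha, if_false]; exact hY a

/-! ### Solubility. -/

theorem pr_act_top_le {n m : ℕ} {Q : Type*} [GenericLattice n m Q] {W : Q} (hW : W ≤ comp Q 0)
    (N : ℕ) (k : ZMod n) : pr k (act ⊤ W N) ≤ act (comp Q k) W N := by
  have h : (⊤ : Q) = ⨆ i, comp Q i := (iSup_pr ⊤).symm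
  rw [h, act_iSup, pr_iSup]
  refine iSup_le fun i => ?_
  by_cases hi : k = i
  · rw [hi]; exact pr_le _ _
  · rw [pr_of_le_ne (act_le_comp le_rfl hW N) hi]; exact bot_le

/-- A closed element whose zero component is covered by tame right ideals is soluble. -/
theorem exists_iterate_der_eq_bot (n : ℕ) [NeZero n] (N k M : ℕ) : ∃ d, ∀ (m : ℕ) (Q : Type u)
    [GenericLattice n m Q] (ι : Type) [Fintype ι] (W : ι → Q) (H : ι → AddSubgroup (ZMod n))
    (J : Q), Fintype.card ι = M → (∀ j, Tame N k (W j) (H j)) → J * J ≤ J →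
      pr 0 J ≤ ⨆ j, W j → der^[d] J = ⊥ := by
  classical
  induction k generalizing M with
  | zero =>
    obtain ⟨d, hd⟩ := exists_iterate_der_le.{u} (n := n) 1 1
    refine ⟨d, fun m Q _ ι _ W H J _ hW hJ hJ0 => ?_⟩
    have hW' : ⨆ j, W j = ⊥ := by
      rw [iSup_eq_bot]; exact fun j => hW j
    rw [hW'] at hJ0
    rw [← le_bot_iff]
    refine (hd Q ⊥ J ⟨bot_le, act_bot_right _ 0, hJ, hJ0⟩).trans ?_
    rw [act_bot_right]
    simp [mulCl]
  | succ k ih =>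
    -- One application of the Kreknin bound replaces each `W j` by its `n` children, one for each
    -- degree `b`, with one level of depth fewer.
    obtain ⟨d₁, hd₁⟩ := ih (M * n)
    obtain ⟨d, hd⟩ := exists_iterate_der_le.{u} (n := n) (M * N + 1) (M * N + 1)
    refine ⟨d₁ + d, fun m Q _ ι _ W H J hM hW hJ hJ0 => ?_⟩
    have hWR : ∀ j ∈ (Finset.univ : Finset ι), IsRightIdeal (W j) := fun j _ => (hW j).1
    have hsup : ⨆ j, W j = Finset.univ.sup W := Finset.sup_univ_eq_iSup W |>.symm
    set W₀ := Finset.univ.sup W with hW₀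
    rw [hsup] at hJ0
    have hW₀0 : W₀ ≤ comp Q 0 := Finset.sup_le fun j _ => (hW j).1.le
    have hact : ∀ P : Q, P * comp Q 0 ≤ P →
        act P W₀ (M * N + 1) ≤ Finset.univ.sup fun j => act P (W j) N := fun P hP => by
      have := act_finset_sup_le Finset.univ hP hWR N
      rwa [Finset.card_univ, hM] at this
    have hnil : act (comp Q 0) W₀ (M * N + 1) = ⊥ := by
      rw [← le_bot_iff]
      refine (hact _ (comp_mul_comp_zero 0)).trans (Finset.sup_le fun j _ => ?_)
      exact ((hW j).2.1 0 (zero_mem _)).le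
    have hdJ := hd Q W₀ J ⟨hW₀0, hnil, hJ, hJ0⟩
    choose W' hW' hT using fun j => (hW j).2.2
    rw [Function.iterate_add_apply]
    refine hd₁ m Q (ι × ZMod n) (fun p => W' p.1 p.2) (fun p => H p.1 ⊔ AddSubgroup.zmultiples p.2)
      _ (by rw [Fintype.card_prod, hM, ZMod.card]) (fun p => hT p.1 p.2)
      (iterate_der_mul_self hJ d) ?_
    refine (pr_mono 0 (hdJ.trans (mulCl_mono (hact ⊤ le_top) le_rfl))).trans ?_
    have hz : ∀ j b, zeroProd (W j) N b ⊤ ≤ ⨆ p : ι × ZMod n, W' p.1 p.2 := fun j b =>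
      (hW' j b).trans (le_iSup (fun p : ι × ZMod n => W' p.1 p.2) (j, b))
    set z := ⨆ p : ι × ZMod n, W' p.1 p.2
    -- In degree zero the heavy elements themselves vanish by nilpotency, and their products with
    -- one element are covered by the children.
    have hT0 : ∀ j, pr 0 (mulCl (act ⊤ (W j) N) 1) ≤ z := fun j => by
      have hj0 := (hW j).1.le
      have h1 : ∀ k, pr k (act ⊤ (W j) N) ≤ act (comp Q k) (W j) N := pr_act_top_le hj0 N
      change pr 0 (act ⊤ (W j) N ⊔ act ⊤ (W j) N * ⊤ ⊔ ⊤ * act ⊤ (W j) N) ≤ z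
      rw [pr_sup, pr_sup]
      refine sup_le (sup_le ?_ ?_) ?_
      · refine (h1 0).trans ?_
        rw [(hW j).2.1 0 (zero_mem _)]; exact bot_le
      · rw [pr_mul]
        refine iSup_le fun b => le_trans ?_ (hz j b)
        rw [zero_sub, zeroProd_top]
        exact (mul_le (h1 b) (pr_le_comp _ _)).trans le_sup_left
      · rw [pr_mul]
        refine iSup_le fun b => le_trans ?_ (hz j (-b))
        rw [zero_sub, zeroProd_top, neg_neg]
        exact (mul_le (pr_le_comp _ _) (h1 (-b))).trans le_sup_right
    have hfin : mulCl (Finset.univ.sup fun j => act ⊤ (W j) N) 1 ≤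
        ⨆ j, mulCl (act ⊤ (W j) N) 1 := by
      rw [Finset.sup_univ_eq_iSup]
      exact mulCl_iSup_le fun j => le_iSup (fun j => mulCl (act ⊤ (W j) N) 1) j
    refine (pr_mono 0 hfin).trans ?_
    rw [pr_iSup]
    exact iSup_le hT0

/-- The main theorem in lattice form. -/
theorem exists_soluble_ideal (n : ℕ) [NeZero n] : ∃ d, ∀ m, ∃ c, ∀ (Q : Type u)
    [GenericLattice n m Q], ∃ I C : Q, I * ⊤ ≤ I ∧ ⊤ * I ≤ I ∧ FG c C ∧ I ⊔ C = ⊤ ∧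
      der^[d] I = ⊥ := by
  obtain ⟨N, hN, hT⟩ := exists_tame_of_thin.{u} n
  obtain ⟨d, hd⟩ := exists_iterate_der_eq_bot.{u} n N n n
  refine ⟨d, fun m => ?_⟩
  obtain ⟨γ, hγ⟩ := hT m
  obtain ⟨c, hc⟩ := exists_ideal.{u} n m γ
  refine ⟨c, fun Q _ => ?_⟩
  obtain ⟨I, C, Y, h1, h2, h3, h4, h5, h6, h7, h8⟩ := hc Q
  refine ⟨I, C, h1, h2, h3, h4, ?_⟩
  refine hd m Q (ZMod n) Y AddSubgroup.zmultiples I (ZMod.card n) (fun a => ?_)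
    ((mul_le_r le_top I).trans h1) h8
  by_cases ha : a = 0
  · subst ha; rw [h7]; exact Tame.bot hN _ _
  · exact hγ Q a (Y a) ha (h5 a) (h6 a)

end LieTypeLattice

/-! ### Graded subspaces as a model of the lattice axioms. -/

namespace LieTypeAlgebra

open LieTypeLattice

universe u v

variable {F : Type u} {L : Type v} [Field F] [NonUnitalNonAssocRing L] [Module F L]
  {n m : ℕ} {𝒜 : ZMod n → Submodule F L}

/-- Families of subspaces of the components of a graded Lie type algebra, i.e. its homogeneous
subspaces. -/
def GradedSub (_ : IsGradedLieType 𝒜) (_ : Module.rank F (𝒜 0) = m) : Type v := Set.Iic 𝒜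

namespace GradedSub

variable {h : IsGradedLieType 𝒜} {hm : Module.rank F (𝒜 0) = m}

instance : CompleteLattice (GradedSub h hm) := inferInstanceAs (CompleteLattice (Set.Iic 𝒜))

/-- The component of degree `i`. -/
def fam (P : GradedSub h hm) (i : ZMod n) : Submodule F L := P.1 i

/-- A family of subspaces of the components. -/
def mk (f : ZMod n → Submodule F L) (hf : ∀ i, f i ≤ 𝒜 i) : GradedSub h hm := ⟨f, hf⟩

@[simp] theorem fam_mk (f : ZMod n → Submodule F L) (hf : ∀ i, f i ≤ 𝒜 i) (i : ZMod n) :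
    (mk f hf : GradedSub h hm).fam i = f i := rfl

theorem fam_le (P : GradedSub h hm) (i : ZMod n) : P.fam i ≤ 𝒜 i := P.2 i

theorem le_iff {P R : GradedSub h hm} : P ≤ R ↔ ∀ i, P.fam i ≤ R.fam i := Iff.rfl

theorem fam_injective {P R : GradedSub h hm} (hPR : ∀ i, P.fam i = R.fam i) : P = R :=
  le_antisymm (le_iff.2 fun i => (hPR i).le) (le_iff.2 fun i => (hPR i).ge)

theorem fam_sSup (S : Set (GradedSub h hm)) (i : ZMod n) :
    (sSup S).fam i = ⨆ P ∈ S, fam P i := by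
  apply le_antisymm
  · have : sSup S ≤ mk (fun i => ⨆ P ∈ S, fam P i) (fun i => iSup₂_le fun P _ => P.fam_le i) :=
      sSup_le fun P hP => le_iff.2 fun i => le_iSup₂_of_le P hP le_rfl
    exact le_iff.1 this i
  · exact iSup₂_le fun P hP => le_iff.1 (le_sSup hP) i

theorem fam_iSup {ι : Sort*} (f : ι → GradedSub h hm) (i : ZMod n) :
    (⨆ j, f j).fam i = ⨆ j, (f j).fam i := by
  rw [iSup, fam_sSup, iSup_range]

theorem fam_sup (P R : GradedSub h hm) (i : ZMod n) : (P ⊔ R).fam i = P.fam i ⊔ R.fam i := by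
  rw [← sSup_pair, fam_sSup, iSup_pair]

theorem fam_top (i : ZMod n) : (⊤ : GradedSub h hm).fam i = 𝒜 i :=
  le_antisymm (fam_le _ i) (le_iff.1 (le_top : mk 𝒜 (fun _ => le_rfl) ≤ (⊤ : GradedSub h hm)) i)

theorem fam_bot (i : ZMod n) : (⊥ : GradedSub h hm).fam i = ⊥ :=
  le_bot_iff.1 (le_iff.1 (bot_le : (⊥ : GradedSub h hm) ≤ mk (fun _ => ⊥) (fun _ => bot_le)) i)

theorem fam_inf (P R : GradedSub h hm) (i : ZMod n) : (P ⊓ R).fam i = P.fam i ⊓ R.fam i := by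
  apply le_antisymm
  · exact le_inf (le_iff.1 inf_le_left i) (le_iff.1 inf_le_right i)
  · have : mk (fun i => P.fam i ⊓ R.fam i) (fun i => inf_le_left.trans (P.fam_le i)) ≤ P ⊓ R :=
      le_inf (le_iff.2 fun i => inf_le_left) (le_iff.2 fun i => inf_le_right)
    exact le_iff.1 this i

variable [IsScalarTower F L L] [SMulCommClass F L L]

instance : Mul (GradedSub h hm) where
  mul P R := mk (fun k => ⨆ i, Submodule.map₂ (LinearMap.mul F L) (P.fam i) (R.fam (k - i)))
    fun k => iSup_le fun i => Submodule.map₂_le.2 fun x hx y hy => by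
      have := h.mul_mem i (k - i) x y (P.fam_le i hx) (R.fam_le _ hy)
      rwa [add_sub_cancel] at this

theorem fam_mul (P R : GradedSub h hm) (k : ZMod n) : (P * R).fam k =
    ⨆ i, Submodule.map₂ (LinearMap.mul F L) (P.fam i) (R.fam (k - i)) := rfl

theorem mul_mem_fam {P R : GradedSub h hm} {i j : ZMod n} {x y : L} (hx : x ∈ P.fam i)
    (hy : y ∈ R.fam j) : x * y ∈ (P * R).fam (i + j) := by
  have h1 : j = i + j - i := by abel
  rw [h1] at hy
  exact (le_iSup (fun l => Submodule.map₂ (LinearMap.mul F L) (P.fam l) (R.fam (i + j - l))) i)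
    (Submodule.apply_mem_map₂ (LinearMap.mul F L) hx hy)

theorem fam_mul_le {P R : GradedSub h hm} {k : ZMod n} {S : Submodule F L} :
    (P * R).fam k ≤ S ↔ ∀ i j, i + j = k → ∀ x ∈ P.fam i, ∀ y ∈ R.fam j, x * y ∈ S := by
  constructor
  · rintro hS i j rfl x hx y hy
    exact hS (mul_mem_fam hx hy)
  · intro hS
    exact iSup_le fun i => Submodule.map₂_le.2 fun x hx y hy =>
      hS i (k - i) (by abel) x hx y hy

theorem mul_le_iff {P R S : GradedSub h hm} :
    P * R ≤ S ↔ ∀ i j, ∀ x ∈ P.fam i, ∀ y ∈ R.fam j, x * y ∈ S.fam (i + j) := by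
  rw [le_iff]
  constructor
  · intro hS i j x hx y hy
    exact hS _ (mul_mem_fam hx hy)
  · intro hS k
    refine fam_mul_le.2 ?_
    rintro i j rfl x hx y hy
    exact hS i j x hx y hy

/-- The second membership solves the identity for `x * (y * z)`, which is where `α ≠ 0` is used. -/
theorem mul_mul_mem {a b c : GradedSub h hm} {i j l : ZMod n} {x y z : L} (hx : x ∈ a.fam i)
    (hy : y ∈ b.fam j) (hz : z ∈ c.fam l) :
    x * y * z ∈ (a * (b * c) ⊔ a * c * b).fam (i + j + l) ∧
    x * (y * z) ∈ (a * b * c ⊔ a * c * b).fam (i + j + l) := by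
  obtain ⟨α, β, hα, he⟩ := h.lie_type x y z ⟨i, a.fam_le i hx⟩ ⟨j, b.fam_le j hy⟩ ⟨l, c.fam_le l hz⟩
  have h1 : x * (y * z) ∈ (a * (b * c)).fam (i + j + l) := by
    rw [add_assoc]; exact mul_mem_fam hx (mul_mem_fam hy hz)
  have h2 : x * z * y ∈ (a * c * b).fam (i + j + l) := by
    rw [add_right_comm]; exact mul_mem_fam (mul_mem_fam hx hz) hy
  have h3 : x * y * z ∈ (a * b * c).fam (i + j + l) := mul_mem_fam (mul_mem_fam hx hy) hz
  rw [fam_sup, fam_sup]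
  constructor
  · rw [he]
    exact add_mem (Submodule.smul_mem _ _ (Submodule.mem_sup_left h1))
      (Submodule.smul_mem _ _ (Submodule.mem_sup_right h2))
  · have he' : x * (y * z) = α⁻¹ • (x * y * z - β • (x * z * y)) := by
      rw [he, add_sub_cancel_right, smul_smul, inv_mul_cancel₀ hα, one_smul]
    rw [he']
    exact Submodule.smul_mem _ _ (sub_mem (Submodule.mem_sup_left h3)
      (Submodule.smul_mem _ _ (Submodule.mem_sup_right h2)))

/-- The projection to degree `i`. -/
def proj (i : ZMod n) (P : GradedSub h hm) : GradedSub h hm :=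
  mk (fun j => ⨆ _ : j = i, P.fam j) fun j => iSup_le fun _ => P.fam_le j

theorem fam_proj (i j : ZMod n) (P : GradedSub h hm) : (proj i P).fam j = ⨆ _ : j = i, P.fam j :=
  rfl

theorem fam_proj_same (i : ZMod n) (P : GradedSub h hm) : (proj i P).fam i = P.fam i := by
  simp [fam_proj]

theorem fam_proj_ne {i j : ZMod n} (hij : j ≠ i) (P : GradedSub h hm) : (proj i P).fam j = ⊥ := by
  simp [fam_proj, hij]

instance : LieTypeLattice n (GradedSub h hm) where
  sSup_mul' s b := fam_injective fun k => by
    simp only [fam_mul, fam_sSup, fam_iSup, Submodule.map₂_iSup_left]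
    rw [iSup_comm]
    exact iSup_congr fun a => by rw [iSup_comm]
  mul_sSup' b s := fam_injective fun k => by
    simp only [fam_mul, fam_sSup, fam_iSup, Submodule.map₂_iSup_right]
    rw [iSup_comm]
    exact iSup_congr fun a => by rw [iSup_comm]
  mul_mul_le' a b c := mul_le_iff.2 fun i j' x hx w hw => by
    have key : (b * c).fam j' ≤
        ((a * b * c ⊔ a * c * b).fam (i + j')).comap (LinearMap.mulLeft F x) := by
      refine fam_mul_le.2 ?_
      rintro j l rfl y hy z hz
      rw [Submodule.mem_comap, LinearMap.mulLeft_apply, ← add_assoc]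
      exact (mul_mul_mem hx hy hz).2
    exact key hw
  mul_mul_le a b c := mul_le_iff.2 fun i' l w hw z hz => by
    have key : (a * b).fam i' ≤
        ((a * (b * c) ⊔ a * c * b).fam (i' + l)).comap (LinearMap.mulRight F z) := by
      refine fam_mul_le.2 ?_
      rintro i j rfl x hx y hy
      rw [Submodule.mem_comap, LinearMap.mulRight_apply]
      exact (mul_mul_mem hx hy hz).1
    exact key hw
  pr := proj
  pr_sSup i s := fam_injective fun j => by
    simp only [fam_proj, fam_sSup, fam_iSup]
    rw [iSup_comm]
    exact iSup_congr fun a => by rw [iSup_comm]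
  iSup_pr P := fam_injective fun j => by
    simp only [fam_iSup, fam_proj]
    simp
  pr_pr_same i P := fam_injective fun j => by
    by_cases hij : j = i
    · subst hij; rw [fam_proj_same]
    · rw [fam_proj_ne hij, fam_proj_ne hij]
  pr_pr_ne i j P hij := fam_injective fun l => by
    rw [fam_bot]
    by_cases hl : l = i
    · subst hl; rw [fam_proj_same, fam_proj_ne hij]
    · rw [fam_proj_ne hl]
  pr_mul_pr_le i j P R := mul_le_iff.2 fun i' j' x hx y hy => by
    by_cases hi : i' = i
    · by_cases hj : j' = j
      · subst hi hj
        rw [fam_proj_same, fam_top]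
        exact h.mul_mem i' j' x y (fam_le _ _ hx) (fam_le _ _ hy)
      · rw [fam_proj_ne hj, Submodule.mem_bot] at hy
        rw [hy, mul_zero]; exact zero_mem _
    · rw [fam_proj_ne hi, Submodule.mem_bot] at hx
      rw [hx, zero_mul]; exact zero_mem _

theorem fam_comp (i j : ZMod n) : (comp (GradedSub h hm) i).fam j = ⨆ _ : j = i, 𝒜 j := by
  rw [← fam_top (h := h) (hm := hm) j]; rfl

/-- The span of a homogeneous element. -/
def single (i : ZMod n) (x : L) (hx : x ∈ 𝒜 i) : GradedSub h hm :=
  mk (fun j => ⨆ _ : j = i, F ∙ x) fun j => iSup_le fun hj => by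
    rw [Submodule.span_singleton_le_iff_mem, hj]; exact hx

theorem fam_single_same (i : ZMod n) (x : L) (hx : x ∈ 𝒜 i) :
    (single i x hx : GradedSub h hm).fam i = F ∙ x := by
  simp [single]

theorem fam_single_ne {i j : ZMod n} (hij : j ≠ i) (x : L) (hx : x ∈ 𝒜 i) :
    (single i x hx : GradedSub h hm).fam j = ⊥ := by
  simp [single, hij]

theorem single_le_iff {i : ZMod n} {x : L} {hx : x ∈ 𝒜 i} {P : GradedSub h hm} :
    single i x hx ≤ P ↔ x ∈ P.fam i := by
  rw [le_iff]
  constructor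
  · intro hP
    have := hP i
    rw [fam_single_same, Submodule.span_singleton_le_iff_mem] at this
    exact this
  · intro hP j
    by_cases hj : j = i
    · subst hj; rw [fam_single_same, Submodule.span_singleton_le_iff_mem]; exact hP
    · rw [fam_single_ne hj]; exact bot_le

theorem single_mul_single_le_iff {i j : ZMod n} {x y : L} {hx : x ∈ 𝒜 i} {hy : y ∈ 𝒜 j}
    {P : GradedSub h hm} : single i x hx * single j y hy ≤ P ↔ x * y ∈ P.fam (i + j) := by
  have hx' : x ∈ (single i x hx : GradedSub h hm).fam i := single_le_iff.1 le_rfl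
  have hy' : y ∈ (single j y hy : GradedSub h hm).fam j := single_le_iff.1 le_rfl
  rw [mul_le_iff]
  refine ⟨fun hP => hP i j x hx' y hy', fun hP i' j' x' hx' y' hy' => ?_⟩
  by_cases hi : i' = i
  · by_cases hj : j' = j
    · subst hi hj
      rw [fam_single_same, Submodule.mem_span_singleton] at hx' hy'
      obtain ⟨r, rfl⟩ := hx'
      obtain ⟨s, rfl⟩ := hy'
      rw [smul_mul_smul_comm]
      exact Submodule.smul_mem _ _ hP
    · rw [fam_single_ne hj, Submodule.mem_bot] at hy'
      rw [hy', mul_zero]; exact zero_mem _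
  · rw [fam_single_ne hi, Submodule.mem_bot] at hx'
    rw [hx', zero_mul]; exact zero_mem _

theorem single_mul_single {i j : ZMod n} {x y : L} (hx : x ∈ 𝒜 i) (hy : y ∈ 𝒜 j) :
    (single i x hx * single j y hy : GradedSub h hm) =
      single (i + j) (x * y) (h.mul_mem i j x y hx hy) := by
  refine eq_of_forall_ge_iff fun P => ?_
  rw [single_mul_single_le_iff, single_le_iff]

/-- Families containing the homogeneous elements of the kernel of a map to `F ^ g`. -/
def IsCof (g : ℕ) (U : GradedSub h hm) : Prop :=
  ∃ Φ : L →ₗ[F] (Fin g → F), ∀ i, ∀ x ∈ 𝒜 i, Φ x = 0 → x ∈ U.fam i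

theorem IsCof.mono {g g' : ℕ} {U V : GradedSub h hm} (hU : IsCof g U) (hg : g ≤ g')
    (hUV : U ≤ V) : IsCof g' V := by
  obtain ⟨Φ, hΦ⟩ := hU
  refine ⟨LinearMap.pi fun k => if hk : (k : ℕ) < g then LinearMap.proj ⟨k, hk⟩ ∘ₗ Φ else 0,
    fun i x hx h0 => le_iff.1 hUV i (hΦ i x hx ?_)⟩
  ext k
  have := congrFun h0 ⟨k, by omega⟩
  simpa using this

theorem IsCof.inf {g g' : ℕ} {U V : GradedSub h hm} (hU : IsCof g U) (hV : IsCof g' V) :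
    IsCof (g + g') (U ⊓ V) := by
  obtain ⟨Φ, hΦ⟩ := hU
  obtain ⟨Ψ, hΨ⟩ := hV
  refine ⟨LinearMap.pi (Fin.addCases (fun k => LinearMap.proj k ∘ₗ Φ)
    (fun k => LinearMap.proj k ∘ₗ Ψ)), fun i x hx h0 => ?_⟩
  rw [fam_inf]
  refine ⟨hΦ i x hx ?_, hΨ i x hx ?_⟩
  · ext k
    have := congrFun h0 (Fin.castAdd g' k)
    simpa using this
  · ext k
    have := congrFun h0 (Fin.natAdd g k)
    simpa using this

/-- Extend an isomorphism `𝒜 0 ≃ F ^ m` to all of `L` and take the homogeneous elements of its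
kernel. -/
theorem exists_isCof_proj_zero : ∃ U : GradedSub h hm, IsCof m U ∧ proj 0 U = ⊥ := by
  have := Module.finite_of_rank_eq_nat hm
  have hfr : Module.finrank F (𝒜 0) = Module.finrank F (Fin m → F) := by
    rw [Module.finrank_eq_of_rank_eq hm, Module.finrank_fin_fun]
  let e := LinearEquiv.ofFinrankEq (𝒜 0) (Fin m → F) hfr
  obtain ⟨Φ, hΦ⟩ := LinearMap.exists_extend (e : 𝒜 0 →ₗ[F] (Fin m → F))
  refine ⟨mk (fun i => 𝒜 i ⊓ LinearMap.ker Φ) (fun i => inf_le_left),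
    ⟨Φ, fun i x hx h0 => ⟨hx, h0⟩⟩, fam_injective fun j => ?_⟩
  rw [fam_bot]
  by_cases hj : j = 0
  · subst hj
    rw [fam_proj_same, fam_mk, eq_bot_iff]
    rintro x ⟨hx, h0⟩
    have h1 : e ⟨x, hx⟩ = Φ x := by rw [← LinearEquiv.coe_coe, ← hΦ]; rfl
    rw [LinearMap.mem_ker.1 h0] at h1
    have h2 := (LinearEquiv.map_eq_zero_iff e).1 h1
    rw [Submodule.mem_bot]
    exact congrArg Subtype.val h2
  · rw [fam_proj_ne hj]

/-- In each of the `n` degrees, lift a basis of the image of `𝒜 i` under `Φ`, which has at most `g`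
elements. -/
theorem IsCof.exists_compl [NeZero n] {g : ℕ} {U : GradedSub h hm} (hU : IsCof g U) :
    ∃ s : Finset (GradedSub h hm), s.card ≤ n * g ∧
      (∀ p ∈ s, ∃ i x, ∃ hx : x ∈ 𝒜 i, p = single i x hx) ∧ U ⊔ s.sup id = ⊤ := by
  classical
  obtain ⟨Φ, hΦ⟩ := hU
  have key : ∀ i, ∃ t : Finset (GradedSub h hm), t.card ≤ g ∧
      (∀ p ∈ t, ∃ x, ∃ hx : x ∈ 𝒜 i, p = single i x hx) ∧
      𝒜 i ≤ U.fam i ⊔ (t.sup id).fam i := by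
    intro i
    let S := (𝒜 i).map Φ
    let B := Module.finBasis F S
    choose v hv hvB using fun k => (Submodule.mem_map.1 (B k).2)
    let f : Fin (Module.finrank F S) → GradedSub h hm := fun k => single i (v k) (hv k)
    refine ⟨Finset.univ.image f, ?_, ?_, fun x hx => ?_⟩
    · refine Finset.card_image_le.trans ?_
      rw [Finset.card_univ, Fintype.card_fin]
      simpa using Submodule.finrank_le S
    · intro p hp
      obtain ⟨k, -, rfl⟩ := Finset.mem_image.1 hp
      exact ⟨v k, hv k, rfl⟩
    · have hxS : Φ x ∈ S := Submodule.mem_map_of_mem hx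
      set y := ∑ k, B.repr ⟨Φ x, hxS⟩ k • v k with hy
      have hyx : Φ y = Φ x := by
        have := congrArg Subtype.val (B.sum_repr ⟨Φ x, hxS⟩)
        rw [hy, map_sum]
        simp only [map_smul, hvB]
        refine Eq.trans ?_ this
        simp only [Submodule.coe_sum, Submodule.coe_smul]
      have hyA : y ∈ 𝒜 i := Submodule.sum_mem _ fun k _ => Submodule.smul_mem _ _ (hv k)
      have hys : y ∈ ((Finset.univ.image f).sup id).fam i := by
        refine Submodule.sum_mem _ fun k _ => Submodule.smul_mem _ _ ?_
        rw [← single_le_iff (hx := hv k)]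
        exact Finset.le_sup (f := id) (Finset.mem_image_of_mem f (Finset.mem_univ k))
      rw [← sub_add_cancel x y]
      refine add_mem (Submodule.mem_sup_left (hΦ i _ (sub_mem hx hyA) ?_))
        (Submodule.mem_sup_right hys)
      rw [map_sub, hyx, sub_self]
  choose t ht htp htA using key
  refine ⟨Finset.univ.biUnion t, ?_, ?_, ?_⟩
  · refine (Finset.card_biUnion_le_card_mul _ _ g fun i _ => ht i).trans ?_
    rw [Finset.card_univ, ZMod.card]
  · intro p hp
    obtain ⟨i, -, hi⟩ := Finset.mem_biUnion.1 hp
    exact ⟨i, htp i p hi⟩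
  · rw [eq_top_iff, le_iff]
    intro i
    rw [fam_top, fam_sup]
    refine (htA i).trans (sup_le_sup le_rfl ?_)
    exact le_iff.1 (Finset.sup_mono (Finset.subset_biUnion_of_mem t (Finset.mem_univ i))) i

noncomputable instance [NeZero n] : GenericLattice n m (GradedSub h hm) where
  IsPrin p := ∃ i x, ∃ hx : x ∈ 𝒜 i, p = single i x hx
  exists_le_comp := by
    rintro _ ⟨i, x, hx, rfl⟩
    refine ⟨i, single_le_iff.2 ?_⟩
    rw [fam_comp]; simpa using hx
  prin_mul := by
    rintro _ _ ⟨i, x, hx, rfl⟩ ⟨j, y, hy, rfl⟩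
    exact ⟨i + j, x * y, h.mul_mem i j x y hx hy, single_mul_single hx hy⟩
  le_sSup_prin P := le_iff.2 fun i x hx => by
    rw [← single_le_iff (hx := P.fam_le i hx)]
    exact le_sSup ⟨⟨i, x, P.fam_le i hx, rfl⟩, single_le_iff.2 hx⟩
  Cof := IsCof
  cof_top := ⟨0, fun i x hx _ => by rw [fam_top]; exact hx⟩
  cof_mono := IsCof.mono
  cof_inf := IsCof.inf
  cof_rdiv := by
    rintro g U _ ⟨Φ, hΦ⟩ ⟨j, y, hy, rfl⟩
    refine ⟨Φ ∘ₗ LinearMap.mulRight F y, fun i x hx h0 => ?_⟩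
    rw [← single_le_iff (hx := hx), le_rdiv, single_mul_single_le_iff]
    exact hΦ _ _ (h.mul_mem i j x y hx hy) h0
  cof_ldiv := by
    rintro g U _ ⟨Φ, hΦ⟩ ⟨j, y, hy, rfl⟩
    refine ⟨Φ ∘ₗ LinearMap.mulLeft F y, fun i x hx h0 => ?_⟩
    rw [← single_le_iff (hx := hx), le_ldiv, single_mul_single_le_iff]
    exact hΦ _ _ (h.mul_mem j i y x hy hx) h0
  exists_cof_pr_zero := exists_isCof_proj_zero
  exists_compl := IsCof.exists_compl
  rk P := Module.finrank F (P.fam 0)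
  rk_le P := by
    have := Module.finite_of_rank_eq_nat hm
    exact (Submodule.finrank_mono (P.fam_le 0)).trans (Module.finrank_eq_of_rank_eq hm).le
  rk_lt := by
    intro P R hPR hR
    have := Module.finite_of_rank_eq_nat hm
    have : Module.Finite F (R.fam 0) := Submodule.finiteDimensional_of_le (R.fam_le 0)
    refine Submodule.finrank_lt_finrank_of_lt (lt_of_le_of_ne (le_iff.1 hPR.le 0) fun heq => ?_)
    refine hPR.ne (fam_injective fun j => ?_)
    by_cases hj : j = 0
    · subst hj; exact heq
    · have h1 : R.fam j = ⊥ := by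
        rw [← le_bot_iff]
        refine (le_iff.1 hR j).trans ?_
        rw [fam_comp]; simp [hj]
      rw [h1, ← le_bot_iff, ← h1]
      exact le_iff.1 hPR.le j

/-- The homogeneous subspace with the given components. -/
def toSubmodule (P : GradedSub h hm) : Submodule F L := ⨆ i, P.fam i

theorem toSubmodule_mono {P R : GradedSub h hm} (hPR : P ≤ R) : P.toSubmodule ≤ R.toSubmodule :=
  iSup_mono fun i => le_iff.1 hPR i

theorem toSubmodule_sup (P R : GradedSub h hm) :
    (P ⊔ R).toSubmodule = P.toSubmodule ⊔ R.toSubmodule := by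
  simp only [toSubmodule, fam_sup, iSup_sup_eq]

theorem toSubmodule_top : (⊤ : GradedSub h hm).toSubmodule = ⊤ := by
  simp only [toSubmodule, fam_top]
  exact h.isInternal.submodule_iSup_eq_top

theorem toSubmodule_bot : (⊥ : GradedSub h hm).toSubmodule = ⊥ := by
  simp only [toSubmodule, fam_bot, iSup_bot]

theorem toSubmodule_single (i : ZMod n) (x : L) (hx : x ∈ 𝒜 i) :
    (single i x hx : GradedSub h hm).toSubmodule = F ∙ x := by
  simp [toSubmodule, single]

theorem toSubmodule_mul (P R : GradedSub h hm) : (P * R).toSubmodule =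
    Submodule.map₂ (LinearMap.mul F L) P.toSubmodule R.toSubmodule := by
  apply le_antisymm
  · refine iSup_le fun k => fam_mul_le.2 fun i j _ x hx y hy => ?_
    exact Submodule.apply_mem_map₂ (LinearMap.mul F L) (Submodule.mem_iSup_of_mem i hx)
      (Submodule.mem_iSup_of_mem j hy)
  · rw [toSubmodule, toSubmodule, Submodule.map₂_iSup_left]
    refine iSup_le fun i => ?_
    rw [Submodule.map₂_iSup_right]
    refine iSup_le fun j => Submodule.map₂_le.2 fun x hx y hy => ?_
    exact Submodule.mem_iSup_of_mem (i + j) (mul_mem_fam hx hy)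

theorem derived_toSubmodule (P : GradedSub h hm) (k : ℕ) :
    derived P.toSubmodule k = (der^[k] P).toSubmodule := by
  induction k with
  | zero => rfl
  | succ k ih => rw [derived, ih, Function.iterate_succ_apply', der, toSubmodule_mul]

theorem isHomogeneousSubspace_toSubmodule (P : GradedSub h hm) :
    IsHomogeneousSubspace 𝒜 P.toSubmodule :=
  le_antisymm (iSup_mono fun i => le_inf (le_iSup P.fam i) (P.fam_le i))
    (iSup_le fun _ => inf_le_left)

theorem isIdeal_toSubmodule {P : GradedSub h hm} (h1 : P * ⊤ ≤ P) (h2 : ⊤ * P ≤ P) :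
    IsIdeal P.toSubmodule := by
  intro x a ha
  have hx : x ∈ (⊤ : GradedSub h hm).toSubmodule := by rw [toSubmodule_top]; trivial
  constructor
  · refine toSubmodule_mono h2 ?_
    rw [toSubmodule_mul]
    exact Submodule.apply_mem_map₂ (LinearMap.mul F L) hx ha
  · refine toSubmodule_mono h1 ?_
    rw [toSubmodule_mul]
    exact Submodule.apply_mem_map₂ (LinearMap.mul F L) ha hx

theorem exists_finset_span (s : Finset (GradedSub h hm))
    (hs : ∀ p ∈ s, ∃ i x, ∃ hx : x ∈ 𝒜 i, p = single i x hx) :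
    ∃ t : Finset L, t.card ≤ s.card ∧ (s.sup id).toSubmodule = Submodule.span F (t : Set L) := by
  classical
  induction s using Finset.induction_on with
  | empty => exact ⟨∅, le_rfl, by simp [toSubmodule_bot]⟩
  | insert p s hp ih =>
    obtain ⟨t, ht, hst⟩ := ih fun p hp => hs p (by simp [hp])
    obtain ⟨i, x, hx, rfl⟩ := hs p (by simp)
    refine ⟨insert x t, ?_, ?_⟩
    · rw [Finset.card_insert_of_notMem hp]
      exact (Finset.card_insert_le x t).trans (by omega)
    · rw [Finset.sup_insert, toSubmodule_sup, hst, id, toSubmodule_single, Finset.coe_insert,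
        Submodule.span_insert]

theorem rank_quotient_le [NeZero n] {I C : GradedSub h hm} {c : ℕ} (hC : FG c C)
    (hIC : I ⊔ C = ⊤) : Module.rank F (L ⧸ I.toSubmodule) ≤ c := by
  classical
  obtain ⟨s, hs, hp, rfl⟩ := hC
  obtain ⟨t, ht, hst⟩ := exists_finset_span s hp
  have h1 : I.toSubmodule ⊔ Submodule.span F (t : Set L) = ⊤ := by
    rw [← hst, ← toSubmodule_sup, hIC, toSubmodule_top]
  have h2 : Submodule.span F ((t.image I.toSubmodule.mkQ : Finset _) : Set (L ⧸ I.toSubmodule)) =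
      ⊤ := by
    rw [Finset.coe_image, Submodule.span_image]
    rw [← Submodule.map_mkQ_eq_top] at h1
    exact h1
  rw [← rank_top, ← h2]
  refine (rank_span_finset_le _).trans ?_
  exact_mod_cast Finset.card_image_le.trans (ht.trans hs)

end GradedSub

end LieTypeAlgebra

/-! ### Transfer to algebras and conclusion. -/

namespace LieTypeLattice

variable {n : ℕ} {Q : Type*} [LieTypeLattice n Q]

theorem iterate_der_eq_bot_of_le {H : Q} {d e : ℕ} (h : der^[d] H = ⊥) (hde : d ≤ e) :
    der^[e] H = ⊥ := by
  induction e, hde using Nat.le_induction with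
  | base => exact h
  | succ e _ ih => rw [Function.iterate_succ_apply', ih, der, bot_mul']

/-- For `m = 0` Kreknin's argument applies to the whole algebra with `w = 0`, and all errors are
then zero. -/
theorem krekninData_bot_top (h : comp Q 0 = ⊥) : KrekninData 1 (⊥ : Q) ⊤ :=
  ⟨bot_le, act_bot_right _ 0, le_top, h.le⟩

theorem comp_zero_eq_bot {Q : Type*} [GenericLattice n 0 Q] : comp Q 0 = ⊥ := by
  by_contra hne
  have h1 := GenericLattice.rk_lt (bot_lt_iff_ne_bot.2 hne) le_rfl
  have h2 := GenericLattice.rk_le (comp Q 0)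
  omega

end LieTypeLattice

open LieTypeLattice LieTypeAlgebra.GradedSub in
theorem LieTypeAlgebra.exists_ideal_and_soluble.{u, v} (n : ℕ) (hn : 0 < n) :
    ∃ d, ∀ m : ℕ, ∃ c : ℕ,
      ∀ (F : Type u) (L : Type v) [Field F] [NonUnitalNonAssocRing L] [Module F L]
        [IsScalarTower F L L] [SMulCommClass F L L] (𝒜 : ZMod n → Submodule F L),
        IsGradedLieType 𝒜 → Module.rank F (𝒜 0) = (m : Cardinal) →
        (∃ I : Submodule F L, IsIdeal I ∧ IsHomogeneousSubspace 𝒜 I ∧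
          Module.rank F (L ⧸ I) ≤ (c : Cardinal) ∧ IsSolubleOfLength I d) ∧
        (m = 0 → IsSolubleOfLength (⊤ : Submodule F L) d) := by
  have : NeZero n := ⟨hn.ne'⟩
  obtain ⟨d₁, h₁⟩ := exists_soluble_ideal.{v} n
  obtain ⟨d₂, h₂⟩ := exists_iterate_der_le.{v} (n := n) 1 1
  refine ⟨max d₁ d₂, fun m => ?_⟩
  obtain ⟨c, hc⟩ := h₁ m
  refine ⟨c, fun F L _ _ _ _ _ 𝒜 h hm => ⟨?_, ?_⟩⟩
  · obtain ⟨I, C, hI, hI', hC, hIC, hd⟩ := hc (GradedSub h hm)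
    refine ⟨I.toSubmodule, isIdeal_toSubmodule hI hI', isHomogeneousSubspace_toSubmodule I,
      rank_quotient_le hC hIC, ?_⟩
    rw [IsSolubleOfLength, derived_toSubmodule,
      iterate_der_eq_bot_of_le hd (le_max_left _ _), toSubmodule_bot]
  · rintro rfl
    have hd := h₂ (GradedSub h hm) ⊥ ⊤ (krekninData_bot_top comp_zero_eq_bot)
    rw [act_bot_right, mulCl, mulCl, bot_mul', mul_bot', sup_bot_eq, sup_bot_eq, le_bot_iff] at hd
    rw [IsSolubleOfLength, ← toSubmodule_top (h := h) (hm := hm), derived_toSubmodule,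
      iterate_der_eq_bot_of_le hd (le_max_right _ _), toSubmodule_bot]

theorem theorem2 :
    ∃ (d : ℕ → ℕ) (c : ℕ → ℕ → ℕ),
      ∀ (n m : ℕ), 0 < n →
      ∀ (F : Type*) (L : Type*) [Field F] [NonUnitalNonAssocRing L] [Module F L]
        [IsScalarTower F L L] [SMulCommClass F L L] (𝒜 : ZMod n → Submodule F L),
        LieTypeAlgebra.IsGradedLieType 𝒜 →
        Module.rank F (𝒜 0) = (m : Cardinal) →
        (∃ I : Submodule F L,
          LieTypeAlgebra.IsIdeal I ∧
          LieTypeAlgebra.IsHomogeneousSubspace 𝒜 I ∧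
          Module.rank F (L ⧸ I) ≤ (c n m : Cardinal) ∧
          LieTypeAlgebra.IsSolubleOfLength I (d n)) ∧
        (m = 0 → LieTypeAlgebra.IsSolubleOfLength (⊤ : Submodule F L) (d n)) := by
  have key := LieTypeAlgebra.exists_ideal_and_soluble
  choose d c h using key
  -- The values at `n = 0` are placeholders.
  refine ⟨fun n => if hn : 0 < n then d n hn else 0,
    fun n m => if hn : 0 < n then c n hn m else 0, fun n m hn => ?_⟩
  simp only [dif_pos hn]
  exact h n hn m
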